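/- Let $\Sigma\subset\mathbb{R}^3$ be a compact, closed, regular $C^2$-curve of length $L>0$ without self-intersections, with arc length parametrization $\sigma$ (identified with its $L$-periodic $C^2$-extension to $\mathbb{R}$, $|\dot\sigma|=1$), and let $L^2(\Sigma)$ be the space of complex-valued functions that are square integrable with respect to the arc length measure $d\sigma$. For $x=\sigma(s_0)\in\Sigma$ and $\delta>0$ put $I_\delta^\Sigma(x)=\{\sigma(s): s\in(s_0-\delta,s_0+\delta)\}$. For $\lambda\le 0$ and $h$ in the space $C^{0,1}(\Sigma)$ of complex-valued Lipschitz continuous functions on $\Sigma$ set $$(B_\lambda h)(x)=\lim_{\delta\searrow 0}\bigg[\int_{\Sigma\setminus I_\delta^\Sigma(x)} h(y)\,\frac{e^{-\sqrt{-\lambda}\,|x-y|}}{4\pi|x-y|}\,d\sigma(y)+h(x)\,\frac{\ln\delta}{2\pi}\bigg],\qquad x\in\Sigma,\quad \operatorname{dom} B_\lambda=C^{0,1}(\Sigma).$$ Then the following assertions hold. (i) For every $\lambda\le 0$, $B_\lambda$ is a well-defined (the limit exists for all $h\in C^{0,1}(\Sigma)$ and $x\in\Sigma$, and $B_\lambda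 h\in L^2(\Sigma)$), essentially selfadjoint operator in $L^2(\Sigma)$, and $\operatorname{dom}\overline{B_\lambda}=\operatorname{dom}\overline{B_0}$. (ii) For every $\lambda\le 0$, $\overline{B_\lambda}$ is bounded from above and has a compact resolvent. (iii) For every $\lambda\le 0$ the eigenvalues of $\overline{B_\lambda}$, counted with multiplicities, can be arranged in a nonincreasing sequence $\nu_1(\lambda)\ge\nu_2(\lambda)\ge\dots$, and they satisfy $$\nu_k(\lambda)=-\frac{\ln k}{2\pi}+O(1)\qquad\text{as } k\to+\infty .$$ (iv) For every $k\in\mathbb{N}=\{1,2,\dots\}$ the function $\lambda\mapsto\nu_k(\lambda)$ is continuous and strictly increasing on $(-\infty,0]$, and $\nu_k(\lambda)\to-\infty$ as $\lambda\to-\infty$. -/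

import Mathlib

open Filter Topology MeasureTheory Set
open scoped ENNReal InnerProductSpace

noncomputable section

/-- A compact, closed, regular `C²`-curve in `ℝ³` without self-intersections, of length `len`,
given by the `len`-periodic extension of its arc length parametrization. -/
structure ClosedCurve where
  len : ℝ
  param : ℝ → EuclideanSpace ℝ (Fin 3)
  len_pos : 0 < len
  contDiff : ContDiff ℝ 2 param
  periodic : Function.Periodic param len
  unit_speed : ∀ s, ‖deriv param s‖ = 1
  injOn : Set.InjOn param (Set.Ico 0 len)

namespace ClosedCurve

variable (C : ClosedCurve)

/-- The curve `Σ` as a subset of `ℝ³`. -/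
def carrier : Set (EuclideanSpace ℝ (Fin 3)) := Set.range C.param

/-- The parametrization as a map into `Σ`. -/
def point (s : ℝ) : C.carrier := ⟨C.param s, s, rfl⟩

/-- The arc length measure `dσ` on `Σ`. -/
def arcLength : Measure C.carrier := (volume.restrict (Set.Ico 0 C.len)).map C.point

/-- The Hilbert space `L²(Σ)` of complex-valued functions. -/
abbrev L2 : Type := Lp ℂ 2 C.arcLength

/-- The open interval `I_δ(x) = {σ(s) : s ∈ (s₀ - δ, s₀ + δ)}` in `Σ`, where `x = σ(s₀)`. -/
def interval (δ : ℝ) (x : C.carrier) : Set C.carrier :=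
  {y | ∃ s₀ s : ℝ, x = C.point s₀ ∧ y = C.point s ∧ s ∈ Set.Ioo (s₀ - δ) (s₀ + δ)}

/-- The kernel `exp(-√(-λ) |x - y|) / (4 π |x - y|)`. -/
def kernel (lam : ℝ) (x y : C.carrier) : ℝ :=
  Real.exp (-Real.sqrt (-lam) * dist x y) / (4 * Real.pi * dist x y)

/-- The bracket
`∫_{Σ \ I_δ(x)} h(y) exp(-√(-λ) |x - y|) / (4 π |x - y|) dσ(y) + h(x) ln δ / (2 π)`. -/
def truncated (lam : ℝ) (h : C.carrier → ℂ) (x : C.carrier) (δ : ℝ) : ℂ :=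
  (∫ y in (C.interval δ x)ᶜ, h y * (C.kernel lam x y : ℂ) ∂C.arcLength)
    + h x * ((Real.log δ / (2 * Real.pi) : ℝ) : ℂ)

/-- `k` is the pointwise limit, as `δ ↘ 0`, of the brackets formed with `h`. -/
def IsRegularization (lam : ℝ) (h k : C.carrier → ℂ) : Prop :=
  ∀ x, Tendsto (C.truncated lam h x) (𝓝[>] 0) (𝓝 (k x))

/-- Membership in `C^{0,1}(Σ)`. -/
def IsLip (h : C.carrier → ℂ) : Prop := ∃ K : NNReal, LipschitzWith K h

theorem continuous_point : Continuous C.point :=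
  C.contDiff.continuous.subtype_mk _

instance : IsFiniteMeasure C.arcLength := by
  unfold arcLength; infer_instance

theorem integrable_truncated (lam : ℝ) {h : C.carrier → ℂ} (hh : Continuous h)
    (x : C.carrier) {δ : ℝ} (hδ : 0 < δ) :
    IntegrableOn (fun y => h y * (C.kernel lam x y : ℂ)) (C.interval δ x)ᶜ C.arcLength := by
  obtain ⟨_, s₀, rfl⟩ := x
  change IntegrableOn (fun y => h y * (C.kernel lam (C.point s₀) y : ℂ))
    (C.interval δ (C.point s₀))ᶜ C.arcLength
  set K : Set C.carrier := C.point '' Set.Icc (s₀ + δ) (s₀ + C.len - δ) with hK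
  have hKc : IsCompact K := isCompact_Icc.image C.continuous_point
  have hsub : (C.interval δ (C.point s₀))ᶜ ⊆ K := by
    rintro ⟨_, s, rfl⟩ hy
    obtain ⟨t, ht, hts⟩ := C.periodic.exists_mem_Ico C.len_pos s s₀
    refine ⟨t, ⟨?_, ?_⟩, Subtype.ext hts.symm⟩
    · by_contra! hlt
      exact hy ⟨s₀, t, rfl, Subtype.ext hts, by linarith [ht.1], hlt⟩
    · by_contra! hlt
      refine hy ⟨s₀, t - C.len, rfl, Subtype.ext ?_, by linarith, by linarith [ht.2]⟩
      change C.param s = C.param (t - C.len)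
      rw [C.periodic.sub_eq, hts]
  have hne : ∀ y ∈ K, dist (C.point s₀) y ≠ 0 := by
    rintro _ ⟨t, ht, rfl⟩ h0
    have he : C.param s₀ = C.param t := congrArg Subtype.val (dist_eq_zero.1 h0)
    have hper : ∀ s, C.param (toIcoMod C.len_pos 0 s) = C.param s := fun s => by
      rw [toIcoMod, C.periodic.sub_zsmul_eq]
    have hmem : ∀ s, toIcoMod C.len_pos 0 s ∈ Set.Ico 0 C.len := fun s => by
      simpa using toIcoMod_mem_Ico C.len_pos 0 s
    have hm := C.injOn (hmem s₀) (hmem t) (by rw [hper, hper, he])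
    rw [toIcoMod_inj, AddCommGroup.modEq_iff_zsmul] at hm
    obtain ⟨n, hn⟩ := hm
    have hL := C.len_pos
    rw [zsmul_eq_mul] at hn
    have h1 : 0 < (n : ℝ) * C.len := by linarith [ht.1]
    have h2 : (n : ℝ) * C.len < 1 * C.len := by linarith [ht.2]
    have h3 : (0 : ℝ) < n := by
      by_contra! hc
      nlinarith
    have h4 : (n : ℝ) < 1 := lt_of_mul_lt_mul_right h2 hL.le
    have h5 : 0 < n := by exact_mod_cast h3
    have h6 : n < 1 := by exact_mod_cast h4
    omega
  have hcont : ContinuousOn (fun y => h y * (C.kernel lam (C.point s₀) y : ℂ)) K := by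
    refine hh.continuousOn.mul (Complex.continuous_ofReal.comp_continuousOn ?_)
    unfold kernel
    refine ContinuousOn.div (by fun_prop) (by fun_prop) fun y hy => ?_
    exact mul_ne_zero (by positivity) (hne y hy)
  exact (hcont.integrableOn_compact hKc).mono_set hsub

theorem IsRegularization.add {lam : ℝ} {h₁ k₁ h₂ k₂ : C.carrier → ℂ}
    (c₁ : Continuous h₁) (c₂ : Continuous h₂)
    (H₁ : C.IsRegularization lam h₁ k₁) (H₂ : C.IsRegularization lam h₂ k₂) :
    C.IsRegularization lam (h₁ + h₂) (k₁ + k₂) := by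
  intro x
  refine ((H₁ x).add (H₂ x)).congr' ?_
  filter_upwards [self_mem_nhdsWithin] with δ hδ
  have := integral_add (C.integrable_truncated lam c₁ x hδ) (C.integrable_truncated lam c₂ x hδ)
  simp only [truncated, Pi.add_apply, add_mul]
  rw [this]
  ring

theorem IsRegularization.smul {lam : ℝ} {h k : C.carrier → ℂ} (c : ℂ)
    (H : C.IsRegularization lam h k) : C.IsRegularization lam (c • h) (c • k) := by
  intro x
  refine ((H x).const_mul c).congr fun δ => ?_
  simp only [truncated, Pi.smul_apply, smul_eq_mul, mul_assoc]
  rw [integral_const_mul]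
  ring

/-- The graph of `B_λ`: all pairs in `L²(Σ) × L²(Σ)` represented by `(h, B_λ h)` with
`h ∈ C^{0,1}(Σ)`. -/
def graphB (lam : ℝ) : Submodule ℂ (C.L2 × C.L2) where
  carrier := {p | ∃ h k : C.carrier → ℂ, C.IsLip h ∧ C.IsRegularization lam h k ∧
    p.1 =ᵐ[C.arcLength] h ∧ p.2 =ᵐ[C.arcLength] k}
  add_mem' := by
    rintro p q ⟨h₁, k₁, ⟨K₁, l₁⟩, r₁, a₁, b₁⟩ ⟨h₂, k₂, ⟨K₂, l₂⟩, r₂, a₂, b₂⟩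
    exact ⟨h₁ + h₂, k₁ + k₂, ⟨_, l₁.add l₂⟩,
      IsRegularization.add C l₁.continuous l₂.continuous r₁ r₂,
      (Lp.coeFn_add _ _).trans (a₁.add a₂), (Lp.coeFn_add _ _).trans (b₁.add b₂)⟩
  zero_mem' := by
    refine ⟨0, 0, ⟨0, LipschitzWith.const 0⟩, fun x => ?_, Lp.coeFn_zero _ _ _,
      Lp.coeFn_zero _ _ _⟩
    have h0 : C.truncated lam 0 x = fun _ => 0 := by
      ext δ
      simp [truncated]
    rw [h0]
    exact tendsto_const_nhds
  smul_mem' := by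
    rintro c p ⟨h, k, ⟨K, l⟩, r, a, b⟩
    exact ⟨c • h, c • k, ⟨_, (lipschitzWith_smul c).comp l⟩, IsRegularization.smul C c r,
      (Lp.coeFn_smul _ _).trans (a.const_smul c), (Lp.coeFn_smul _ _).trans (b.const_smul c)⟩

/-- The operator `B_λ` in `L²(Σ)` with domain `C^{0,1}(Σ)`. -/
def B (lam : ℝ) : C.L2 →ₗ.[ℂ] C.L2 := (C.graphB lam).toLinearPMap

end ClosedCurve

section Operators

variable {H : Type*} [NormedAddCommGroup H] [InnerProductSpace ℂ H] [CompleteSpace H]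

/-- A densely defined symmetric operator whose closure is selfadjoint. -/
def IsEssentiallySelfAdjoint (T : H →ₗ.[ℂ] H) : Prop :=
  Dense (T.domain : Set H) ∧ T.IsFormalAdjoint T ∧ T.IsClosable ∧ IsSelfAdjoint T.closure

/-- `⟨T f, f⟩ ≤ c ‖f‖²` on the domain, for some real `c`. -/
def IsBoundedAbove (T : H →ₗ.[ℂ] H) : Prop :=
  ∃ c : ℝ, ∀ f : T.domain, (⟪(f : H), T f⟫_ℂ).re ≤ c * ‖(f : H)‖ ^ 2

/-- `z` is in the resolvent set of `T` and `R = (T - z)⁻¹`. -/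
def IsResolventAt (T : H →ₗ.[ℂ] H) (z : ℂ) (R : H →L[ℂ] H) : Prop :=
  (∀ g : H, ∃ f : T.domain, (f : H) = R g ∧ T f - z • (f : H) = g) ∧
    ∀ f : T.domain, R (T f - z • (f : H)) = f

/-- The resolvent set of `T` is nonempty and all resolvents are compact. -/
def HasCompactResolvent (T : H →ₗ.[ℂ] H) : Prop :=
  (∃ z R, IsResolventAt T z R) ∧ ∀ z R, IsResolventAt T z R → IsCompactOperator R

/-- The space `ker (T - z)`. -/
def eigenspaceAt (T : H →ₗ.[ℂ] H) (z : ℂ) : Submodule ℂ T.domain :=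
  LinearMap.ker (T.toFun - z • T.domain.subtype)

/-- `ν 0 ≥ ν 1 ≥ ν 2 ≥ …` are all the eigenvalues of `T`, counted with multiplicities: each
complex number `z` occurs in the sequence exactly `dim ker (T - z)` times. -/
def IsEigenvalueSequence (T : H →ₗ.[ℂ] H) (ν : ℕ → ℝ) : Prop :=
  Antitone ν ∧ ∀ z : ℂ,
    {k : ℕ | (ν k : ℂ) = z}.encard = Cardinal.toENat (Module.rank ℂ (eigenspaceAt T z))

end Operators

end

/-!
On a `C²` curve, `1 / |x - y|` differs from `1 / |s - t|` by a bounded function, where `|s - t|` is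
the distance along the curve. Hence `B_λ` is the regularized convolution with `1 / (4π |s - t|)` on
the circle `ℝ / Lℤ` plus a bounded symmetric integral operator `S_λ`. The convolution is diagonal in
the Fourier basis, with real eigenvalues `-log (1 + |n|) / (2π) + O(1)`, so the closure of `B_λ` is
a diagonal operator with compact resolvent plus `S_λ`, on a domain which does not depend on `λ`.
The min–max principle then bounds the distance of `ν_k(λ)` to the `k`-th diagonal entry by
`‖S_λ‖`, and that of `ν_k(λ)` to `ν_k(μ)` by `‖S_λ - S_μ‖`.

For `λ < μ ≤ 0` the kernel of `S_μ - S_λ` is a positive mixture of Gaussians, so its quadratic form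
at `f` is an integral of squared moduli of the Fourier transform of `f dσ`. It vanishes only for
`f = 0`, which makes `ν_k` strictly increasing. Finally, if `k_λ` denotes the kernel of `B_λ`, then
`⟨h, B_λ h⟩ = ∫ B_λ 1 |h|² - ½ ∬ k_λ |h(x) - h(y)|²`, and `B_λ 1` tends to `-∞` uniformly on the
curve as `λ → -∞`.
-/

/-! ### Diagonal operators with bounded perturbation -/

section DiagGraph

variable {𝕜 ι H : Type*} [RCLike 𝕜] [NormedAddCommGroup H] [InnerProductSpace 𝕜 H]

theorem hilbertBasis_ext_inner (b : HilbertBasis ι 𝕜 H) {x y : H}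
    (h : ∀ i, ⟪b i, x⟫_𝕜 = ⟪b i, y⟫_𝕜) : x = y := by
  apply b.repr.injective
  ext i
  simpa only [b.repr_apply_apply] using h i

theorem hasSum_sq_norm_inner (b : HilbertBasis ι 𝕜 H) (x : H) :
    HasSum (fun i => ‖⟪b i, x⟫_𝕜‖ ^ 2) (‖x‖ ^ 2) := by
  have h := (b.hasSum_inner_mul_inner x x).mapL (RCLike.reCLM (K := 𝕜))
  simp only [RCLike.reCLM_apply, inner_self_eq_norm_sq] at h
  refine h.congr_fun fun i => ?_
  rw [← inner_conj_symm x (b i), RCLike.conj_mul]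
  norm_cast

theorem norm_le_mul_of_norm_inner_le (b : HilbertBasis ι 𝕜 H) {x y : H} {M : ℝ} (hM : 0 ≤ M)
    (h : ∀ i, ‖⟪b i, y⟫_𝕜‖ ≤ M * ‖⟪b i, x⟫_𝕜‖) : ‖y‖ ≤ M * ‖x‖ := by
  have hsq : ‖y‖ ^ 2 ≤ (M * ‖x‖) ^ 2 := by
    rw [mul_pow]
    refine hasSum_le (fun i => ?_) (hasSum_sq_norm_inner b y)
      ((hasSum_sq_norm_inner b x).mul_left (M ^ 2))
    rw [← mul_pow]
    exact pow_le_pow_left₀ (norm_nonneg _) (h i) 2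
  exact le_of_sq_le_sq hsq (by positivity)

theorem re_inner_le_mul_norm_sq (b : HilbertBasis ι 𝕜 H) {a : ι → ℝ} {f g : H}
    (h : ∀ i, ⟪b i, g⟫_𝕜 = a i * ⟪b i, f⟫_𝕜) {β : ℝ} (hβ : ∀ i, ⟪b i, f⟫_𝕜 ≠ 0 → a i ≤ β) :
    RCLike.re ⟪f, g⟫_𝕜 ≤ β * ‖f‖ ^ 2 := by
  refine hasSum_le (fun i => ?_) ((b.hasSum_inner_mul_inner f g).mapL (RCLike.reCLM (K := 𝕜)))
    ((hasSum_sq_norm_inner b f).mul_left β)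
  rw [h i, ← inner_conj_symm f (b i), mul_left_comm, RCLike.conj_mul, RCLike.reCLM_apply,
    RCLike.re_ofReal_mul, ← RCLike.ofReal_pow, RCLike.ofReal_re]
  by_cases h0 : ⟪b i, f⟫_𝕜 = 0
  · simp [h0]
  · exact mul_le_mul_of_nonneg_right (hβ i h0) (by positivity)

theorem mul_norm_sq_le_re_inner (b : HilbertBasis ι 𝕜 H) {a : ι → ℝ} {f g : H}
    (h : ∀ i, ⟪b i, g⟫_𝕜 = a i * ⟪b i, f⟫_𝕜) {α : ℝ} (hα : ∀ i, ⟪b i, f⟫_𝕜 ≠ 0 → α ≤ a i) :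
    α * ‖f‖ ^ 2 ≤ RCLike.re ⟪f, g⟫_𝕜 := by
  have hneg := re_inner_le_mul_norm_sq b (a := -a) (f := f) (g := -g) (β := -α)
    (fun i => by simp [h i]) fun i hi => neg_le_neg (hα i hi)
  simp only [inner_neg_right, map_neg] at hneg
  linarith

theorem abs_re_inner_apply_le (S : H →L[𝕜] H) (f : H) :
    |RCLike.re ⟪f, S f⟫_𝕜| ≤ ‖S‖ * ‖f‖ ^ 2 :=
  calc |RCLike.re ⟪f, S f⟫_𝕜| ≤ ‖⟪f, S f⟫_𝕜‖ := RCLike.abs_re_le_norm _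
    _ ≤ ‖f‖ * ‖S f‖ := norm_inner_le_norm _ _
    _ ≤ ‖f‖ * (‖S‖ * ‖f‖) := by gcongr; exact S.le_opNorm f
    _ = ‖S‖ * ‖f‖ ^ 2 := by ring

/-- The graph of the operator `diag(a) + S` on its maximal domain, where `diag(a)` is the diagonal
operator with entries `a` in the Hilbert basis `b`. The membership condition tests `g = a f + S f`
against the basis, so that no domain has to be specified. -/
def diagGraph (b : HilbertBasis ι 𝕜 H) (a : ι → ℝ) (S : H →L[𝕜] H) : Submodule 𝕜 (H × H) where
  carrier := {p | ∀ i, ⟪b i, p.2⟫_𝕜 = a i * ⟪b i, p.1⟫_𝕜 + ⟪b i, S p.1⟫_𝕜}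
  add_mem' {p q} hp hq i := by
    simp only [Prod.fst_add, Prod.snd_add, map_add, inner_add_right, hp i, hq i]
    ring
  zero_mem' i := by simp
  smul_mem' c p hp i := by
    simp only [Prod.smul_fst, Prod.smul_snd, map_smul, inner_smul_right, hp i]
    ring

variable {b : HilbertBasis ι 𝕜 H} {a : ι → ℝ} {S : H →L[𝕜] H} {f g : H}

theorem mem_diagGraph :
    (f, g) ∈ diagGraph b a S ↔ ∀ i, ⟪b i, g⟫_𝕜 = a i * ⟪b i, f⟫_𝕜 + ⟪b i, S f⟫_𝕜 := Iff.rfl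

theorem mem_diagGraph_iff_sub :
    (f, g) ∈ diagGraph b a S ↔ ∀ i, ⟪b i, g - S f⟫_𝕜 = a i * ⟪b i, f⟫_𝕜 := by
  simp only [mem_diagGraph, inner_sub_right, sub_eq_iff_eq_add]

theorem add_mem_diagGraph_of_mem (S' : H →L[𝕜] H) (h : (f, g) ∈ diagGraph b a S) :
    (f, g + (S' - S) f) ∈ diagGraph b a S' := by
  rw [mem_diagGraph_iff_sub] at h ⊢
  intro i
  rw [← h i]
  congr 1
  simp only [sub_apply]
  abel

theorem isClosed_diagGraph : IsClosed (diagGraph b a S : Set (H × H)) := by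
  have hInter : (diagGraph b a S : Set (H × H)) =
      ⋂ i, {p | ⟪b i, p.2⟫_𝕜 = a i * ⟪b i, p.1⟫_𝕜 + ⟪b i, S p.1⟫_𝕜} :=
    ofPred_forall _
  rw [hInter]
  exact isClosed_iInter fun i => isClosed_eq (by fun_prop) (by fun_prop)

theorem basis_mem_diagGraph (i : ι) : (b i, (a i : 𝕜) • b i + S (b i)) ∈ diagGraph b a S := by
  classical
  intro j
  rw [inner_add_right, inner_smul_right, orthonormal_iff_ite.1 b.orthonormal j i]
  split_ifs with h <;> simp [h]

theorem eq_of_mem_diagGraph {g' : H} (h : (f, g) ∈ diagGraph b a S)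
    (h' : (f, g') ∈ diagGraph b a S) : g = g' :=
  hilbertBasis_ext_inner b fun i => (h i).trans (h' i).symm

theorem inner_eq_of_mem_diagGraph (hS : S.IsSymmetric) {f' g' : H}
    (h : (f, g) ∈ diagGraph b a S) (h' : (f', g') ∈ diagGraph b a S) :
    ⟪g, f'⟫_𝕜 = ⟪f, g'⟫_𝕜 := by
  rw [mem_diagGraph_iff_sub] at h h'
  have hdiag : ⟪g - S f, f'⟫_𝕜 = ⟪f, g' - S f'⟫_𝕜 := by
    rw [← b.tsum_inner_mul_inner, ← b.tsum_inner_mul_inner]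
    congr 1; ext i
    rw [h' i, ← inner_conj_symm _ (b i), h i, ← inner_conj_symm f (b i)]
    simp only [map_mul, RCLike.conj_ofReal]
    ring
  rw [inner_sub_left, inner_sub_right, hS.apply_clm] at hdiag
  exact sub_left_injective hdiag

theorem re_inner_le_of_mem_diagGraph (h : (f, g) ∈ diagGraph b a S) {β : ℝ}
    (hβ : ∀ i, ⟪b i, f⟫_𝕜 ≠ 0 → a i ≤ β) : RCLike.re ⟪f, g⟫_𝕜 ≤ (β + ‖S‖) * ‖f‖ ^ 2 := by
  have hdiag := re_inner_le_mul_norm_sq b (mem_diagGraph_iff_sub.1 h) hβ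
  have hpert := (abs_le.1 (abs_re_inner_apply_le S f)).2
  rw [inner_sub_right, map_sub] at hdiag
  linarith

theorem le_re_inner_of_mem_diagGraph (h : (f, g) ∈ diagGraph b a S) {α : ℝ}
    (hα : ∀ i, ⟪b i, f⟫_𝕜 ≠ 0 → α ≤ a i) : (α - ‖S‖) * ‖f‖ ^ 2 ≤ RCLike.re ⟪f, g⟫_𝕜 := by
  have hdiag := mul_norm_sq_le_re_inner b (mem_diagGraph_iff_sub.1 h) hα
  have hpert := (abs_le.1 (abs_re_inner_apply_le S f)).1
  rw [inner_sub_right, map_sub] at hdiag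
  linarith

theorem topologicalClosure_eq_diagGraph {G : Submodule 𝕜 (H × H)} (hG : G ≤ diagGraph b a S)
    (hb : ∀ i, ∃ g, (b i, g) ∈ G) : G.topologicalClosure = diagGraph b a S := by
  apply le_antisymm (G.topologicalClosure_minimal hG isClosed_diagGraph)
  rintro ⟨f, g⟩ hfg
  have hbG (i) : (b i, (a i : 𝕜) • b i + S (b i)) ∈ G := by
    obtain ⟨g, hg⟩ := hb i
    rwa [eq_of_mem_diagGraph (basis_mem_diagGraph i) (hG hg)]
  have hf := b.hasSum_repr f
  have hg := (b.hasSum_repr (g - S f)).add (hf.mapL S)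
  rw [sub_add_cancel] at hg
  have hsum : HasSum (fun i => ⟪b i, f⟫_𝕜 • (b i, (a i : 𝕜) • b i + S (b i))) (f, g) := by
    refine (hf.prodMk hg).congr_fun fun i => ?_
    simp only [b.repr_apply_apply, mem_diagGraph_iff_sub.1 hfg i, map_smul, Prod.smul_mk, smul_add,
      smul_smul, mul_comm]
  exact mem_closure_of_tendsto hsum (Eventually.of_forall fun s =>
    sum_mem fun i _ => G.smul_mem _ (hbG i))

end DiagGraph

section Operator

variable {ι H : Type*} [NormedAddCommGroup H] [InnerProductSpace ℂ H]
  {b : HilbertBasis ι ℂ H} {a : ι → ℝ} {S : H →L[ℂ] H} {T : H →ₗ.[ℂ] H}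

theorem isClosable_of_graph_le_diagGraph (hT : T.graph ≤ diagGraph b a S) : T.IsClosable := by
  refine ⟨T.graph.topologicalClosure.toLinearPMap, ?_⟩
  rw [Submodule.toLinearPMap_graph_eq]
  rintro ⟨x, y⟩ hxy (rfl : x = 0)
  exact eq_of_mem_diagGraph (T.graph.topologicalClosure_minimal hT isClosed_diagGraph hxy)
    (Submodule.zero_mem _)

theorem closure_graph_eq_diagGraph (hT : T.graph ≤ diagGraph b a S) (hb : ∀ i, b i ∈ T.domain) :
    T.closure.graph = diagGraph b a S := by
  rw [← (isClosable_of_graph_le_diagGraph hT).graph_closure_eq_closure_graph]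
  exact topologicalClosure_eq_diagGraph hT fun i => ⟨T ⟨b i, hb i⟩, T.mem_graph ⟨b i, hb i⟩⟩

theorem dense_of_forall_hilbertBasis_mem {p : Submodule ℂ H} (hb : ∀ i, b i ∈ p) :
    Dense (p : Set H) :=
  (Submodule.dense_iff_topologicalClosure_eq_top.2 b.dense_span).mono
    (Submodule.span_le.2 (range_subset_iff.2 hb))

theorem isSelfAdjoint_of_graph_eq_diagGraph [CompleteSpace H] (hS : S.IsSymmetric)
    (hT : T.graph = diagGraph b a S) : IsSelfAdjoint T := by
  have hb (i) : b i ∈ T.domain :=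
    LinearPMap.mem_domain_of_mem_graph (hT ▸ basis_mem_diagGraph i)
  rw [LinearPMap.isSelfAdjoint_def]
  apply LinearPMap.eq_of_eq_graph
  rw [LinearPMap.adjoint_graph_eq_graph_adjoint (dense_of_forall_hilbertBasis_mem hb), hT]
  ext ⟨y, w⟩
  rw [Submodule.mem_adjoint_iff]
  refine ⟨fun h i => ?_, fun h f g hfg => sub_eq_zero.2 (inner_eq_of_mem_diagGraph hS hfg h)⟩
  have hi := sub_eq_zero.1 (h _ _ (basis_mem_diagGraph i))
  rw [← hi, inner_add_left, inner_smul_left, hS.apply_clm, RCLike.conj_ofReal]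

theorem isEssentiallySelfAdjoint_of_graph_le_diagGraph [CompleteSpace H] (hS : S.IsSymmetric)
    (hT : T.graph ≤ diagGraph b a S) (hb : ∀ i, b i ∈ T.domain) : IsEssentiallySelfAdjoint T :=
  ⟨dense_of_forall_hilbertBasis_mem hb,
    fun x y => inner_eq_of_mem_diagGraph hS (hT (T.mem_graph x)) (hT (T.mem_graph y)),
    isClosable_of_graph_le_diagGraph hT,
    isSelfAdjoint_of_graph_eq_diagGraph hS (closure_graph_eq_diagGraph hT hb)⟩

end Operator

section Reordering

theorem exists_equiv_nat_antitone {ι : Type*} [Infinite ι] {a : ι → ℝ}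
    (ha : Tendsto a cofinite atBot) : ∃ e : ℕ ≃ ι, Antitone (a ∘ e) := by
  have hfin (c : ℝ) : {i | c ≤ a i}.Finite := by
    simpa only [not_lt] using eventually_cofinite.1 (ha.eventually_lt_atBot c)
  have : Countable ι := by
    have hUnion : ⋃ n : ℕ, {i | -(n : ℝ) ≤ a i} = univ :=
      iUnion_eq_univ_iff.2 fun i => (exists_nat_ge (-a i)).imp fun n hn => neg_le.1 hn
    rw [← countable_univ_iff, ← hUnion]
    exact countable_iUnion fun n => (hfin (-n)).countable
  obtain ⟨f, hf⟩ := exists_injective_nat ι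
  let : LinearOrder ι := LinearOrder.lift' (fun i => toLex (-a i, f i)) fun i j hij =>
    hf (congrArg Prod.snd (toLex.injective hij))
  have anti {i j : ι} (hij : i ≤ j) : a j ≤ a i :=
    neg_le_neg_iff.1 (Prod.Lex.monotone_fst _ _ hij)
  have finite_Iic (i : ι) : (Iic i).Finite := (hfin (a i)).subset fun _ => anti
  let : LocallyFiniteOrder ι :=
    .ofFiniteIcc fun i j => (finite_Iic j).subset Icc_subset_Iic_self
  let : SuccOrder ι := LinearLocallyFiniteOrder.succOrder ι
  let : PredOrder ι := LinearLocallyFiniteOrder.predOrder ι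
  have : NoMaxOrder ι := ⟨fun i => by
    by_contra! h
    exact infinite_univ ((finite_Iic i).subset fun j _ => h j)⟩
  obtain ⟨i₀⟩ : Nonempty ι := inferInstance
  obtain ⟨m, hmem, hmin⟩ := (finite_Iic i₀).exists_minimal ⟨i₀, self_mem_Iic⟩
  let : OrderBot ι :=
    { bot := m
      bot_le := fun i => (le_total m i).elim id fun hi => hmin (hi.trans hmem) hi }
  let e : ι ≃o ℕ := orderIsoNatOfLinearSuccPredArch
  exact ⟨e.symm.toEquiv, fun m n hmn => anti (e.symm.monotone hmn)⟩

end Reordering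

section CompactDiagonal

variable {𝕜 ι H : Type*} [RCLike 𝕜] [NormedAddCommGroup H] [InnerProductSpace 𝕜 H]

theorem isCompactOperator_rankOne {E F : Type*} [NormedAddCommGroup E] [NormedSpace 𝕜 E]
    [NormedAddCommGroup F] [InnerProductSpace 𝕜 F] (x : E) (y : F) :
    IsCompactOperator (InnerProductSpace.rankOne 𝕜 x y) := by
  rw [InnerProductSpace.rankOne_def']
  exact (isCompactOperator_of_locallyCompactSpace_rng
    (ContinuousLinearMap.toSpanSingleton 𝕜 x)).comp_clm _

theorem inner_sum_smul_rankOne_apply [DecidableEq ι] (b : HilbertBasis ι 𝕜 H) (d : ι → 𝕜)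
    (s : Finset ι) (x : H) (j : ι) :
    ⟪b j, (∑ i ∈ s, d i • InnerProductSpace.rankOne 𝕜 (b i) (b i)) x⟫_𝕜 =
      if j ∈ s then d j * ⟪b j, x⟫_𝕜 else 0 := by
  simp only [sum_apply, smul_apply, InnerProductSpace.rankOne_apply, inner_sum, inner_smul_right,
    orthonormal_iff_ite.1 b.orthonormal, mul_ite, mul_one, mul_zero, Finset.sum_ite_eq]

theorem summable_smul_rankOne [CompleteSpace H] (b : HilbertBasis ι 𝕜 H) {d : ι → 𝕜}
    (hd : Tendsto d cofinite (𝓝 0)) :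
    Summable fun i => d i • InnerProductSpace.rankOne 𝕜 (b i) (b i) := by
  classical
  rw [summable_iff_vanishing_norm]
  intro ε hε
  have hfin : {i | ε / 2 ≤ ‖d i‖}.Finite := by
    have hnorm : Tendsto (fun i => ‖d i‖) cofinite (𝓝 0) := by simpa only [norm_zero] using hd.norm
    simpa only [not_lt] using eventually_cofinite.1 (hnorm.eventually_lt_const (half_pos hε))
  refine ⟨hfin.toFinset, fun t ht => (half_lt_self hε).trans_le' ?_⟩
  refine ContinuousLinearMap.opNorm_le_bound _ (half_pos hε).le fun x =>
    norm_le_mul_of_norm_inner_le b (half_pos hε).le fun j => ?_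
  rw [inner_sum_smul_rankOne_apply]
  split_ifs with hj
  · have hdj : ‖d j‖ < ε / 2 :=
      not_le.1 fun h => Finset.disjoint_left.1 ht hj (hfin.mem_toFinset.2 h)
    rw [norm_mul]
    gcongr
  · rw [norm_zero]
    positivity

theorem exists_isCompactOperator_diagonal [CompleteSpace H] (b : HilbertBasis ι 𝕜 H) {d : ι → 𝕜}
    (hd : Tendsto d cofinite (𝓝 0)) :
    ∃ D : H →L[𝕜] H, IsCompactOperator D ∧ ∀ i x, ⟪b i, D x⟫_𝕜 = d i * ⟪b i, x⟫_𝕜 := by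
  classical
  have hsum := (summable_smul_rankOne b hd).hasSum
  refine ⟨_, isCompactOperator_of_tendsto hsum (Eventually.of_forall fun s =>
    (sum_mem fun i _ => (isCompactOperator_rankOne (b i) (b i)).smul (d i) :
      _ ∈ compactOperator (RingHom.id 𝕜) H H)), fun j x => ?_⟩
  have hinner : Continuous fun A : H →L[𝕜] H => ⟪b j, A x⟫_𝕜 := by fun_prop
  refine tendsto_nhds_unique ((hinner.tendsto _).comp hsum) (tendsto_const_nhds.congr' ?_)
  filter_upwards [eventually_ge_atTop {j}] with s hs
  rw [Function.comp_apply, inner_sum_smul_rankOne_apply,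
    if_pos (Finset.singleton_subset_iff.1 hs)]

theorem tendsto_zero_of_isCompactOperator {v : HilbertBasis ι 𝕜 H} {d : ι → 𝕜} {R : H →L[𝕜] H}
    (hR : IsCompactOperator R) (hv : ∀ i, R (v i) = d i • v i) : Tendsto d cofinite (𝓝 0) := by
  classical
  have hRv (i j : ι) : ⟪v j, R (v i)⟫_𝕜 = if j = i then d i else 0 := by
    rw [hv, inner_smul_right, orthonormal_iff_ite.1 v.orthonormal, mul_ite, mul_one, mul_zero]
  obtain ⟨K, hK, hsub⟩ := hR.image_closedBall_subset_compact (f := (R : H →ₗ[𝕜] H)) 1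
  have hmem (i : ι) : R (v i) ∈ K :=
    hsub ⟨v i, by simpa using (v.orthonormal.1 i).le, rfl⟩
  have hlim : Tendsto (fun i => R (v i)) cofinite (𝓝 0) := by
    refine hK.tendsto_nhds_of_unique_mapClusterPt (Eventually.of_forall hmem) fun y _ hy =>
      hilbertBasis_ext_inner v fun j => ?_
    have hcluster : MapClusterPt ⟪v j, y⟫_𝕜 cofinite fun i => ⟪v j, R (v i)⟫_𝕜 :=
      hy.tendsto_comp (continuous_const.inner continuous_id).continuousAt.tendsto
    have hzero : Tendsto (fun i => ⟪v j, R (v i)⟫_𝕜) cofinite (𝓝 0) := by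
      refine tendsto_const_nhds.congr' ?_
      filter_upwards [(finite_singleton j).compl_mem_cofinite] with i hi
      rw [hRv, if_neg (Ne.symm hi)]
    rw [inner_zero_right]
    exact eq_of_nhds_neBot (NeBot.mono hcluster (inf_le_inf_left _ hzero))
  refine tendsto_zero_iff_norm_tendsto_zero.2 ((tendsto_zero_iff_norm_tendsto_zero.1 hlim).congr
    fun i => ?_)
  rw [hv, norm_smul, v.orthonormal.1, mul_one]

end CompactDiagonal

section Spectral

variable {𝕜 ι H : Type*} [RCLike 𝕜] [NormedAddCommGroup H] [InnerProductSpace 𝕜 H]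

theorem infinite_of_hilbertBasis [Infinite ι] {κ : Type*} (b : HilbertBasis ι 𝕜 H)
    (u : HilbertBasis κ 𝕜 H) : Infinite κ := by
  by_contra hfin
  rw [not_infinite_iff_finite] at hfin
  have := Fintype.ofFinite κ
  have : FiniteDimensional 𝕜 H := u.toOrthonormalBasis.toBasis.finiteDimensional_of_finite
  exact not_finite_iff_infinite.2 ‹_› b.orthonormal.linearIndependent.finite

theorem le_topologicalClosure_span_of_hilbertBasis {V : Submodule 𝕜 H} (e : HilbertBasis ι 𝕜 V) :
    V ≤ (Submodule.span 𝕜 (range fun i => (e i : H))).topologicalClosure := by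
  intro y hy
  refine mem_closure_of_tendsto ((e.hasSum_repr ⟨y, hy⟩).mapL V.subtypeL)
    (Eventually.of_forall fun s => sum_mem fun i _ => ?_)
  rw [map_smul]
  exact Submodule.smul_mem _ _ (Submodule.subset_span (mem_range_self i))

theorem exists_hilbertBasis_forall_mem_of_orthogonalFamily [CompleteSpace H] {κ : Type*}
    {V : κ → Submodule 𝕜 H} [∀ k, CompleteSpace (V k)]
    (hV : OrthogonalFamily 𝕜 (fun k => V k) fun k => (V k).subtypeₗᵢ) (hsup : (⨆ k, V k)ᗮ = ⊥) :
    ∃ (w : Set H) (v : HilbertBasis w 𝕜 H), ∀ i, ∃ k, v i ∈ V k := by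
  choose w e _ using fun k => exists_hilbertBasis 𝕜 (V k)
  let x (i : Σ k, w k) : H := e i.1 i.2
  have hx : Orthonormal 𝕜 x := hV.orthonormal_sigma_orthonormal fun k => (e k).orthonormal
  have hcompl : (Submodule.span 𝕜 (range x))ᗮ = ⊥ := by
    rw [← Submodule.orthogonal_closure, eq_bot_iff, ← hsup]
    refine Submodule.orthogonal_le (iSup_le fun k =>
      (le_topologicalClosure_span_of_hilbertBasis (e k)).trans
        (Submodule.topologicalClosure_mono (Submodule.span_mono ?_)))
    exact range_subset_iff.2 fun i => mem_range_self (f := x) ⟨k, i⟩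
  refine ⟨range x, .mkOfOrthogonalEqBot hx.toSubtypeRange (by rwa [Subtype.range_coe]), ?_⟩
  rw [HilbertBasis.coe_mkOfOrthogonalEqBot]
  rintro ⟨_, i, rfl⟩
  exact ⟨i.1, (e i.1 i.2).2⟩

theorem exists_hilbertBasis_eigenvectors [CompleteSpace H] {R : H →L[𝕜] H}
    (hc : IsCompactOperator R) (hs : R.IsSymmetric) :
    ∃ (w : Set H) (v : HilbertBasis w 𝕜 H) (ρ : w → ℝ), ∀ i, R (v i) = (ρ i : 𝕜) • v i := by
  let E (μ : 𝕜) : Submodule 𝕜 H := Module.End.eigenspace (R : Module.End 𝕜 H) μ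
  have hclosed (μ : 𝕜) : IsClosed (E μ : Set H) := by
    have hE : (E μ : Set H) = {x | R x = μ • x} := ext fun x => Module.End.mem_eigenspace_iff
    rw [hE]
    exact isClosed_eq R.continuous (continuous_const_smul μ)
  have (μ : 𝕜) : CompleteSpace (E μ) := (hclosed μ).completeSpace_coe
  obtain ⟨w, v, hv⟩ := exists_hilbertBasis_forall_mem_of_orthogonalFamily
    hs.orthogonalFamily_eigenspaces
    (ContinuousLinearMap.orthogonalComplement_iSup_eigenspaces_eq_bot hc hs)
  choose μ hv using hv
  have hreal (i : w) : ((RCLike.re (μ i) : ℝ) : 𝕜) = μ i :=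
    RCLike.conj_eq_iff_re.1 (hs.conj_eigenvalue_eq_self
      (Module.End.hasEigenvalue_of_hasEigenvector ⟨hv i, v.orthonormal.ne_zero i⟩))
  exact ⟨w, v, fun i => RCLike.re (μ i), fun i => by
    rw [hreal]
    exact Module.End.mem_eigenspace_iff.1 (hv i)⟩

variable {b : HilbertBasis ι 𝕜 H} {a : ι → ℝ} {S : H →L[𝕜] H}

theorem bddAbove_range_of_tendsto_cofinite_atBot (ha : Tendsto a cofinite atBot) :
    BddAbove (range a) :=
  IsBoundedUnder.bddAbove_range_of_cofinite ⟨0, ha.eventually (eventually_le_atBot 0)⟩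

theorem exists_mem_diagGraph_resolvent [CompleteSpace H] (ha : Tendsto a cofinite atBot) {c : ℝ}
    (hc : ∀ i, a i + ‖S‖ + 1 ≤ c) :
    ∃ R : H →L[𝕜] H, IsCompactOperator R ∧ ∀ w, (R w, (c : 𝕜) • R w - w) ∈ diagGraph b a S := by
  have hgap (i : ι) : ‖S‖ + 1 ≤ c - a i := by linarith [hc i]
  have hpos (i : ι) : 0 < c - a i := (hgap i).trans_lt' (by positivity)
  have hlim : Tendsto (fun i => (((c - a i)⁻¹ : ℝ) : 𝕜)) cofinite (𝓝 0) := by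
    have hinv : Tendsto (fun i => (c - a i)⁻¹) cofinite (𝓝 0) :=
      (tendsto_atTop_add_const_left _ c (tendsto_neg_atBot_atTop.comp ha)).inv_tendsto_atTop
    simpa only [map_zero] using! ((RCLike.continuous_ofReal (K := 𝕜)).tendsto 0).comp hinv
  obtain ⟨D, hDc, hD⟩ := exists_isCompactOperator_diagonal b hlim
  have hDnorm : ‖D‖ ≤ (‖S‖ + 1)⁻¹ := by
    refine D.opNorm_le_bound (by positivity) fun x =>
      norm_le_mul_of_norm_inner_le b (by positivity) fun i => ?_
    rw [hD, norm_mul, RCLike.norm_ofReal, abs_of_pos (inv_pos.2 (hpos i))]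
    gcongr
    exact hgap i
  have hSD : ‖S * D‖ < 1 :=
    calc ‖S * D‖ ≤ ‖S‖ * (‖S‖ + 1)⁻¹ := (norm_mul_le _ _).trans (by gcongr)
      _ < 1 := by rw [← div_eq_mul_inv, div_lt_one (by positivity)]; exact lt_add_one _
  -- `R = D (1 - S D)⁻¹` is a right inverse of `c - diag(a) - S`, as `D` is one of `c - diag(a)`.
  let V : H →L[𝕜] H := ↑(Units.oneSub (S * D) hSD)⁻¹
  have hV : (1 - S * D) * V = 1 := (Units.oneSub (S * D) hSD).mul_inv
  refine ⟨D * V, hDc.comp_clm V, fun w i => ?_⟩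
  have hw : V w - S (D (V w)) = w := DFunLike.congr_fun hV w
  have hSw : S (D (V w)) = V w - w := (sub_eq_of_eq_add' (sub_eq_iff_eq_add.1 hw)).symm
  have hne : ((c : 𝕜) - a i) ≠ 0 := by exact_mod_cast (hpos i).ne'
  simp only [mul_apply_eq_comp, inner_sub_right, inner_smul_right, hSw, hD]
  push_cast
  field_simp
  ring

theorem diagGraph_eq_of_forall_eigenvector_mem {κ : Type*} (hS : S.IsSymmetric)
    {u : HilbertBasis κ 𝕜 H} {ν : κ → ℝ}
    (h : ∀ i, (u i, (ν i : 𝕜) • u i) ∈ diagGraph b a S) : diagGraph b a S = diagGraph u ν 0 := by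
  have hle : diagGraph b a S ≤ diagGraph u ν 0 := by
    rintro ⟨f, g⟩ hfg i
    have hi := inner_eq_of_mem_diagGraph hS (h i) hfg
    rw [inner_smul_left, RCLike.conj_ofReal] at hi
    rw [← hi, zero_apply, inner_zero_right, add_zero]
  rw [← topologicalClosure_eq_diagGraph hle fun i => ⟨_, h i⟩,
    isClosed_diagGraph.submodule_topologicalClosure_eq]

theorem resolvent_apply_of_mem_diagGraph {c : ℝ} (hc : ∀ i, a i + ‖S‖ + 1 ≤ c) {R : H →L[𝕜] H}
    (hR : ∀ w, (R w, (c : 𝕜) • R w - w) ∈ diagGraph b a S) {f g : H}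
    (h : (f, g) ∈ diagGraph b a S) : R ((c : 𝕜) • f - g) = f := by
  let x := R ((c : 𝕜) • f - g) - f
  have hx : (x, (c : 𝕜) • x) ∈ diagGraph b a S := by
    convert! (diagGraph b a S).sub_mem (hR ((c : 𝕜) • f - g)) h using 1
    rw [Prod.mk_sub_mk, sub_sub, sub_add_cancel, ← smul_sub]
  have hre := re_inner_le_of_mem_diagGraph hx (β := c - ‖S‖ - 1) fun i _ => by linarith [hc i]
  rw [inner_smul_right, inner_self_eq_norm_sq_to_K, RCLike.re_ofReal_mul, ← RCLike.ofReal_pow,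
    RCLike.ofReal_re] at hre
  exact sub_eq_zero.1 (norm_eq_zero.1 (sq_eq_zero_iff.1 (by nlinarith [sq_nonneg ‖x‖])))

theorem isSymmetric_of_forall_mem_diagGraph (hS : S.IsSymmetric) {R : H →L[𝕜] H} {c : ℝ}
    (hR : ∀ w, (R w, (c : 𝕜) • R w - w) ∈ diagGraph b a S) : R.IsSymmetric := fun x y => by
  have h := inner_eq_of_mem_diagGraph hS (hR x) (hR y)
  simp only [inner_sub_left, inner_sub_right, inner_smul_left, inner_smul_right,
    RCLike.conj_ofReal, sub_right_inj] at h
  exact h.symm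

theorem eigenvector_mem_diagGraph_of_resolvent {R : H →L[𝕜] H} {c : ℝ}
    (hR : ∀ w, (R w, (c : 𝕜) • R w - w) ∈ diagGraph b a S) {x : H} {ρ : ℝ} (hx : x ≠ 0)
    (hRx : R x = (ρ : 𝕜) • x) : (x, ((c - ρ⁻¹ : ℝ) : 𝕜) • x) ∈ diagGraph b a S := by
  have hρ : (ρ : 𝕜) ≠ 0 := fun h0 => hx (by
    have h := hR x
    rw [hRx, h0, zero_smul, smul_zero, zero_sub] at h
    exact neg_eq_zero.1 (eq_of_mem_diagGraph h (Submodule.zero_mem _)))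
  convert! (diagGraph b a S).smul_mem (ρ : 𝕜)⁻¹ (hR x) using 1
  rw [hRx, Prod.smul_mk, inv_smul_smul₀ hρ, smul_sub, smul_comm, inv_smul_smul₀ hρ]
  push_cast
  rw [sub_smul]

theorem exists_hilbertBasis_eigenvector_mem_diagGraph [CompleteSpace H]
    (ha : Tendsto a cofinite atBot) (hS : S.IsSymmetric) :
    ∃ (w : Set H) (v : HilbertBasis w 𝕜 H) (ν : w → ℝ), Tendsto ν cofinite atBot ∧
      ∀ i, (v i, (ν i : 𝕜) • v i) ∈ diagGraph b a S := by
  obtain ⟨M, hM⟩ := bddAbove_range_of_tendsto_cofinite_atBot ha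
  rw [mem_upperBounds, forall_mem_range] at hM
  obtain ⟨R, hRc, hR⟩ := exists_mem_diagGraph_resolvent (b := b) (S := S) ha
    fun i => add_le_add_left (add_le_add_left (hM i) ‖S‖) 1
  obtain ⟨w, v, ρ, hρ⟩ :=
    exists_hilbertBasis_eigenvectors hRc (isSymmetric_of_forall_mem_diagGraph hS hR)
  have hmem (i : w) :=
    eigenvector_mem_diagGraph_of_resolvent hR (v.orthonormal.ne_zero i) (hρ i)
  have hρpos (i : w) : 0 < ρ i := by
    have hi := re_inner_le_of_mem_diagGraph (hmem i) fun j _ => hM j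
    rw [inner_smul_right, inner_self_eq_norm_sq_to_K, v.orthonormal.1, RCLike.ofReal_one, one_pow,
      mul_one, RCLike.ofReal_re, one_pow, mul_one] at hi
    exact inv_pos.1 (by linarith)
  have hρlim : Tendsto ρ cofinite (𝓝[>] 0) := by
    refine tendsto_nhdsWithin_iff.2 ⟨?_, Eventually.of_forall hρpos⟩
    simpa only [RCLike.ofReal_re, map_zero, Function.comp_def] using!
      (RCLike.continuous_re.tendsto 0).comp (tendsto_zero_of_isCompactOperator hRc hρ)
  refine ⟨w, v, fun i => M + ‖S‖ + 1 - (ρ i)⁻¹, ?_, hmem⟩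
  exact tendsto_const_nhds.add_atBot
    (tendsto_neg_atTop_atBot.comp (tendsto_inv_nhdsGT_zero.comp hρlim))

theorem exists_eigenbasis_diagGraph [CompleteSpace H] [Infinite ι] (ha : Tendsto a cofinite atBot)
    (hS : S.IsSymmetric) :
    ∃ (u : HilbertBasis ℕ 𝕜 H) (ν : ℕ → ℝ), Antitone ν ∧ Tendsto ν atTop atBot ∧
      diagGraph b a S = diagGraph u ν 0 := by
  obtain ⟨w, v, μ, hμ, hv⟩ := exists_hilbertBasis_eigenvector_mem_diagGraph (b := b) ha hS
  have : Infinite w := infinite_of_hilbertBasis b v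
  obtain ⟨e, he⟩ := exists_equiv_nat_antitone hμ
  have hspan : ⊤ ≤ (Submodule.span 𝕜 (range (v ∘ e))).topologicalClosure := by
    rw [e.surjective.range_comp, v.dense_span]
  refine ⟨.mk (v.orthonormal.comp e e.injective) hspan, μ ∘ e, he, ?_,
    diagGraph_eq_of_forall_eigenvector_mem hS fun n => ?_⟩
  · rw [← Nat.cofinite_eq_atTop]
    exact hμ.comp e.injective.tendsto_cofinite
  · rw [HilbertBasis.coe_mk]
    exact hv (e n)

end Spectral

section Resolvent

variable {ι H : Type*} [NormedAddCommGroup H] [InnerProductSpace ℂ H]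
  {b : HilbertBasis ι ℂ H} {a : ι → ℝ} {S : H →L[ℂ] H} {T : H →ₗ.[ℂ] H}

theorem isBoundedAbove_of_graph_eq_diagGraph (ha : Tendsto a cofinite atBot)
    (hT : T.graph = diagGraph b a S) : IsBoundedAbove T := by
  obtain ⟨M, hM⟩ := bddAbove_range_of_tendsto_cofinite_atBot ha
  exact ⟨M + ‖S‖, fun f =>
    re_inner_le_of_mem_diagGraph (hT ▸ T.mem_graph f) fun i _ => hM (mem_range_self i)⟩

theorem hasCompactResolvent_of_graph_eq_diagGraph [CompleteSpace H] (ha : Tendsto a cofinite atBot)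
    (hT : T.graph = diagGraph b a S) : HasCompactResolvent T := by
  obtain ⟨M, hM⟩ := bddAbove_range_of_tendsto_cofinite_atBot ha
  rw [mem_upperBounds, forall_mem_range] at hM
  obtain ⟨c, hc⟩ : ∃ c, ∀ i, a i + ‖S‖ + 1 ≤ c :=
    ⟨M + ‖S‖ + 1, fun i => add_le_add_left (add_le_add_left (hM i) ‖S‖) 1⟩
  obtain ⟨R, hRc, hR⟩ := exists_mem_diagGraph_resolvent (b := b) (S := S) ha hc
  have hleft (f : T.domain) : R ((c : ℂ) • (f : H) - T f) = f :=
    resolvent_apply_of_mem_diagGraph hc hR (hT ▸ T.mem_graph f)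
  constructor
  · refine ⟨c, -R, fun g => ?_, fun f => ?_⟩
    · obtain ⟨f, hf, hTf⟩ := T.mem_graph_iff.1 (hT ▸ hR (-g))
      simp only [map_neg] at hf hTf
      exact ⟨f, hf, by rw [hTf, hf]; exact (sub_sub_cancel_left _ _).trans (neg_neg g)⟩
    · rw [neg_apply, ← map_neg, neg_sub, hleft]
  · intro z Q hQ
    have hQR : Q = R.comp (((c : ℂ) - z) • Q - .id ℂ H) := by
      ext g
      obtain ⟨f, hf, hTf⟩ := hQ.1 g
      simp only [ContinuousLinearMap.comp_apply, sub_apply, smul_apply,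
        ContinuousLinearMap.id_apply, ← hf]
      have hfg : ((c : ℂ) - z) • (f : H) - g = (c : ℂ) • (f : H) - T f := by
        rw [← hTf, sub_smul, sub_sub_sub_cancel_right]
      rw [hfg, hleft]
    rw [hQR]
    exact hRc.comp_clm _

end Resolvent

section BasisSpan

variable {𝕜 ι H : Type*} [RCLike 𝕜] [NormedAddCommGroup H] [InnerProductSpace 𝕜 H]
  {b : HilbertBasis ι 𝕜 H} {s : Set ι} {f : H}

theorem inner_eq_zero_of_mem_span_image (hf : f ∈ Submodule.span 𝕜 (b '' s)) {i : ι} (hi : i ∉ s) :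
    ⟪b i, f⟫_𝕜 = 0 := by
  refine Submodule.mem_orthogonal_singleton_iff_inner_right.1 (Submodule.span_le.2 ?_ hf)
  rintro _ ⟨j, hj, rfl⟩
  exact Submodule.mem_orthogonal_singleton_iff_inner_right.2
    (b.orthonormal.2 fun hij => hi (hij ▸ hj))

theorem mem_span_image_of_inner_eq_zero (hs : s.Finite) (hf : ∀ i ∉ s, ⟪b i, f⟫_𝕜 = 0) :
    f ∈ Submodule.span 𝕜 (b '' s) := by
  have hsum : f = ∑ i ∈ hs.toFinset, ⟪b i, f⟫_𝕜 • b i := by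
    refine (b.hasSum_repr f).unique ?_
    simp only [b.repr_apply_apply]
    refine hasSum_sum_of_ne_finset_zero fun i hi => ?_
    rw [hf i fun his => hi (hs.mem_toFinset.2 his), zero_smul]
  rw [hsum]
  exact sum_mem fun i hi => Submodule.smul_mem _ _
    (Submodule.subset_span (mem_image_of_mem b (hs.mem_toFinset.1 hi)))

theorem rank_span_image (b : HilbertBasis ι 𝕜 H) (s : Set ι) :
    Module.rank 𝕜 (Submodule.span 𝕜 (b '' s)) = Cardinal.mk (b '' s) :=
  rank_span_set (b.orthonormal.linearIndependent.linearIndepOn s).id_image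

theorem finrank_span_image (b : HilbertBasis ι 𝕜 H) (s : Finset ι) :
    Module.finrank 𝕜 (Submodule.span 𝕜 (b '' s)) = s.card := by
  rw [Module.finrank, rank_span_image, ← Nat.card,
    Nat.card_image_of_injective b.orthonormal.linearIndependent.injective, Nat.card_coe_set_eq,
    ncard_coe_finset]

theorem exists_mem_diagGraph_of_mem_span_image {a : ι → ℝ} {S : H →L[𝕜] H}
    (hf : f ∈ Submodule.span 𝕜 (b '' s)) : ∃ g, (f, g) ∈ diagGraph b a S := by
  have hle : Submodule.span 𝕜 (b '' s) ≤ (diagGraph b a S).map (LinearMap.fst 𝕜 H H) := by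
    rw [Submodule.span_le]
    rintro _ ⟨i, -, rfl⟩
    exact Submodule.mem_map.2 ⟨_, basis_mem_diagGraph i, rfl⟩
  obtain ⟨⟨_, g⟩, hg, rfl⟩ := hle hf
  exact ⟨g, hg⟩

end BasisSpan

section EigenvalueSequence

variable {H : Type*} [NormedAddCommGroup H] [InnerProductSpace ℂ H]
  {u : HilbertBasis ℕ ℂ H} {ν : ℕ → ℝ} {T : H →ₗ.[ℂ] H}

theorem map_eigenspaceAt_of_graph_eq_diagGraph (hν : Tendsto ν atTop atBot)
    (hT : T.graph = diagGraph u ν 0) (z : ℂ) :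
    (eigenspaceAt T z).map T.domain.subtype = Submodule.span ℂ (u '' {k | (ν k : ℂ) = z}) := by
  have hinner (f : T.domain) (k : ℕ) : ⟪u k, T f⟫_ℂ = ν k * ⟪u k, (f : H)⟫_ℂ := by
    have hf : ((f : H), T f) ∈ diagGraph u ν 0 := hT ▸ T.mem_graph f
    simpa only [zero_apply, inner_zero_right, add_zero] using! hf k
  have hmem (f : T.domain) : f ∈ eigenspaceAt T z ↔ T f = z • (f : H) := sub_eq_zero
  have hfin : {k | (ν k : ℂ) = z}.Finite := by
    rw [← Nat.cofinite_eq_atTop] at hν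
    refine (eventually_cofinite.1 (hν.eventually_lt_atBot z.re)).subset fun k hk => ?_
    exact not_lt.2 (congrArg Complex.re hk).ge
  apply le_antisymm
  · rintro _ ⟨f, hf, rfl⟩
    refine mem_span_image_of_inner_eq_zero hfin fun k hk => ?_
    have hk' := hinner f k
    rw [(hmem f).1 hf, inner_smul_right] at hk'
    exact (mul_eq_mul_right_iff.1 hk').resolve_left (Ne.symm hk)
  · rw [Submodule.span_le]
    rintro _ ⟨k, hk, rfl⟩
    have huk : u k ∈ T.domain :=
      LinearPMap.mem_domain_of_mem_graph (hT ▸ basis_mem_diagGraph k)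
    refine ⟨⟨u k, huk⟩, (hmem _).2 (hilbertBasis_ext_inner u fun j => ?_), rfl⟩
    rw [hinner, inner_smul_right]
    by_cases hjk : j = k
    · rw [hjk, hk]
    · rw [u.orthonormal.2 hjk, mul_zero, mul_zero]

theorem isEigenvalueSequence_of_graph_eq_diagGraph (hν : Antitone ν)
    (hν' : Tendsto ν atTop atBot) (hT : T.graph = diagGraph u ν 0) :
    IsEigenvalueSequence T ν := by
  refine ⟨hν, fun z => ?_⟩
  let e := (eigenspaceAt T z).equivMapOfInjective T.domain.subtype T.domain.subtype_injective
  rw [e.rank_eq, map_eigenspaceAt_of_graph_eq_diagGraph hν' hT, rank_span_image,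
    ← u.orthonormal.linearIndependent.injective.encard_image]
  rfl

end EigenvalueSequence

section MinMax

variable {𝕜 H : Type*} [RCLike 𝕜] [NormedAddCommGroup H] [InnerProductSpace 𝕜 H]

theorem exists_ne_zero_inner_eq_zero {k : ℕ} (w : Fin k → H) (V : Submodule 𝕜 H)
    [FiniteDimensional 𝕜 V] (hV : k < Module.finrank 𝕜 V) :
    ∃ f ∈ V, f ≠ 0 ∧ ∀ j, ⟪w j, f⟫_𝕜 = 0 := by
  let Φ : V →ₗ[𝕜] (Fin k → 𝕜) :=
    LinearMap.pi fun j => (innerSL 𝕜 (w j) : H →ₗ[𝕜] 𝕜).comp V.subtype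
  have hker : LinearMap.ker Φ ≠ ⊥ := LinearMap.ker_ne_bot_of_finrank_lt (by simpa using hV)
  obtain ⟨f, hf, hf0⟩ := (Submodule.ne_bot_iff _).1 hker
  exact ⟨f, f.2, Submodule.coe_eq_zero.not.2 hf0, congrFun (LinearMap.mem_ker.1 hf)⟩

theorem exists_pos_forall_mul_norm_sq_le (V : Submodule 𝕜 H) [FiniteDimensional 𝕜 V]
    {S : H →L[𝕜] H} (hS : ∀ f ≠ 0, 0 < RCLike.re ⟪f, S f⟫_𝕜) :
    ∃ ε > 0, ∀ f ∈ V, ε * ‖f‖ ^ 2 ≤ RCLike.re ⟪f, S f⟫_𝕜 := by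
  have : ProperSpace V := FiniteDimensional.proper 𝕜 V
  obtain ⟨ε, hε, hle⟩ := (isCompact_sphere (0 : V) 1).exists_forall_le'
    (f := fun f : V => RCLike.re ⟪(f : H), S f⟫_𝕜) (by fun_prop) (a := 0) fun f hf =>
      hS f (Submodule.coe_eq_zero.not.2 (ne_zero_of_mem_unit_sphere ⟨f, hf⟩))
  refine ⟨ε, hε, fun f hf => ?_⟩
  rcases eq_or_ne f 0 with rfl | hf0
  · simp
  have hunit := hle (((‖f‖⁻¹ : ℝ) : 𝕜) • ⟨f, hf⟩) (by
    rw [mem_sphere_zero_iff_norm, RCLike.ofReal_inv]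
    exact norm_smul_inv_norm (𝕜 := 𝕜) (x := (⟨f, hf⟩ : V)) (by simpa using hf0))
  simp only [Submodule.coe_smul, map_smul, inner_smul_left, inner_smul_right,
    RCLike.conj_ofReal, RCLike.re_ofReal_mul] at hunit
  calc ε * ‖f‖ ^ 2 ≤ ‖f‖⁻¹ * (‖f‖⁻¹ * RCLike.re ⟪f, S f⟫_𝕜) * ‖f‖ ^ 2 := by gcongr
    _ = RCLike.re ⟪f, S f⟫_𝕜 := by field_simp

variable {u : HilbertBasis ℕ 𝕜 H} {ν : ℕ → ℝ}

theorem le_eigenvalue_of_finrank (hν : Antitone ν) {k : ℕ} (V : Submodule 𝕜 H)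
    [FiniteDimensional 𝕜 V] (hV : k < Module.finrank 𝕜 V) {α : ℝ}
    (h : ∀ f ∈ V, ∃ g, (f, g) ∈ diagGraph u ν 0 ∧ α * ‖f‖ ^ 2 ≤ RCLike.re ⟪f, g⟫_𝕜) :
    α ≤ ν k := by
  obtain ⟨f, hfV, hf0, hf⟩ := exists_ne_zero_inner_eq_zero (fun j : Fin k => u j) V hV
  obtain ⟨g, hg, hfg⟩ := h f hfV
  have hle := re_inner_le_of_mem_diagGraph hg (β := ν k) fun i hi =>
    hν (not_lt.1 fun hik => hi (hf ⟨i, hik⟩))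
  rw [norm_zero, add_zero] at hle
  exact le_of_mul_le_mul_right (hfg.trans hle) (by positivity)

theorem eigenvalue_mul_norm_sq_le_re_inner (hν : Antitone ν) {k : ℕ} {f g : H}
    (hf : f ∈ Submodule.span 𝕜 (u '' Finset.Iic k)) (hg : (f, g) ∈ diagGraph u ν 0) :
    ν k * ‖f‖ ^ 2 ≤ RCLike.re ⟪f, g⟫_𝕜 := by
  have hle := le_re_inner_of_mem_diagGraph hg (α := ν k) fun i hi =>
    hν (not_lt.1 fun hki => hi (inner_eq_zero_of_mem_span_image hf (by simpa using hki)))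
  rwa [norm_zero, sub_zero] at hle

theorem lt_finrank_span_image_Iic (u : HilbertBasis ℕ 𝕜 H) (k : ℕ) :
    k < Module.finrank 𝕜 (Submodule.span 𝕜 (u '' Finset.Iic k)) := by
  rw [finrank_span_image, Nat.card_Iic]
  exact k.lt_succ_self

theorem eigenvalue_le_of_forall_re_inner_le (hν : Antitone ν) {k : ℕ} (w : Fin k → H) {β : ℝ}
    (h : ∀ f g, (f, g) ∈ diagGraph u ν 0 → (∀ j, ⟪w j, f⟫_𝕜 = 0) →
      RCLike.re ⟪f, g⟫_𝕜 ≤ β * ‖f‖ ^ 2) : ν k ≤ β := by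
  have := FiniteDimensional.span_of_finite 𝕜 ((Finset.Iic k).finite_toSet.image u)
  obtain ⟨f, hfV, hf0, hf⟩ := exists_ne_zero_inner_eq_zero w _ (lt_finrank_span_image_Iic u k)
  obtain ⟨g, hg⟩ := exists_mem_diagGraph_of_mem_span_image (a := ν) (S := 0) hfV
  exact le_of_mul_le_mul_right
    ((eigenvalue_mul_norm_sq_le_re_inner hν hfV hg).trans (h f g hg hf)) (by positivity)

variable {ι : Type*} {b : HilbertBasis ι 𝕜 H} {a : ι → ℝ} {S S' : H →L[𝕜] H}
  {u' : HilbertBasis ℕ 𝕜 H} {ν' : ℕ → ℝ}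

theorem eigenvalue_add_le (hν : Antitone ν) (hν' : Antitone ν')
    (hG : diagGraph b a S = diagGraph u ν 0) (hG' : diagGraph b a S' = diagGraph u' ν' 0)
    {k : ℕ} {ε : ℝ} (h : ∀ f ∈ Submodule.span 𝕜 (u '' Finset.Iic k),
      ε * ‖f‖ ^ 2 ≤ RCLike.re ⟪f, (S' - S) f⟫_𝕜) : ν k + ε ≤ ν' k := by
  have := FiniteDimensional.span_of_finite 𝕜 ((Finset.Iic k).finite_toSet.image u)
  refine le_eigenvalue_of_finrank (u := u') hν' _ (lt_finrank_span_image_Iic u k) fun f hf => ?_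
  obtain ⟨g, hg⟩ := exists_mem_diagGraph_of_mem_span_image (a := ν) (S := 0) hf
  refine ⟨g + (S' - S) f, hG' ▸ add_mem_diagGraph_of_mem S' (hG ▸ hg), ?_⟩
  rw [inner_add_right, map_add, add_mul]
  exact add_le_add (eigenvalue_mul_norm_sq_le_re_inner hν hf hg) (h f hf)

theorem eigenvalue_sub_norm_le (hν : Antitone ν) (hν' : Antitone ν')
    (hG : diagGraph b a S = diagGraph u ν 0) (hG' : diagGraph b a S' = diagGraph u' ν' 0)
    (k : ℕ) : ν k - ‖S' - S‖ ≤ ν' k :=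
  eigenvalue_add_le hν hν' hG hG' fun f _ =>
    (neg_mul _ _).trans_le (abs_le.1 (abs_re_inner_apply_le (S' - S) f)).1

theorem abs_eigenvalue_sub_le (hν : Antitone ν) (hν' : Antitone ν')
    (hG : diagGraph b a S = diagGraph u ν 0) (hG' : diagGraph b a S' = diagGraph u' ν' 0)
    (k : ℕ) : |ν' k - ν k| ≤ ‖S' - S‖ := by
  have hle := eigenvalue_sub_norm_le hν hν' hG hG' k
  have hge := eigenvalue_sub_norm_le hν' hν hG' hG k
  rw [norm_sub_rev] at hge
  exact abs_le.2 ⟨by linarith, by linarith⟩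

theorem eigenvalue_lt (hν : Antitone ν) (hν' : Antitone ν')
    (hG : diagGraph b a S = diagGraph u ν 0) (hG' : diagGraph b a S' = diagGraph u' ν' 0)
    (h : ∀ f ≠ 0, 0 < RCLike.re ⟪f, (S' - S) f⟫_𝕜) (k : ℕ) : ν k < ν' k := by
  have := FiniteDimensional.span_of_finite 𝕜 ((Finset.Iic k).finite_toSet.image u)
  obtain ⟨ε, hε, hle⟩ :=
    exists_pos_forall_mul_norm_sq_le (Submodule.span 𝕜 (u '' Finset.Iic k)) h
  linarith [eigenvalue_add_le hν hν' hG hG' hle]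

theorem diag_sub_le_eigenvalue (hν : Antitone ν) (hG : diagGraph b a S = diagGraph u ν 0)
    {e : ℕ → ι} (he : Function.Injective e) {k : ℕ} {α : ℝ} (hα : ∀ j ≤ k, α ≤ a (e j)) :
    α - ‖S‖ ≤ ν k := by
  let s : Finset ι := (Finset.Iic k).map ⟨e, he⟩
  have := FiniteDimensional.span_of_finite 𝕜 (s.finite_toSet.image b)
  refine le_eigenvalue_of_finrank (u := u) hν (Submodule.span 𝕜 (b '' s)) ?_ fun f hf => ?_
  · rw [finrank_span_image, Finset.card_map, Nat.card_Iic]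
    exact k.lt_succ_self
  obtain ⟨g, hg⟩ := exists_mem_diagGraph_of_mem_span_image (a := a) (S := S) hf
  refine ⟨g, hG ▸ hg, le_re_inner_of_mem_diagGraph hg fun i hi => ?_⟩
  obtain ⟨j, hj, rfl⟩ := Finset.mem_map.1
    (not_not.1 fun his => hi (inner_eq_zero_of_mem_span_image hf (Finset.mem_coe.not.2 his)))
  exact hα j (Finset.mem_Iic.1 hj)

theorem eigenvalue_le_diag_add (hν : Antitone ν) (hG : diagGraph b a S = diagGraph u ν 0)
    {e : ℕ → ι} (he : Function.Surjective e) {k : ℕ} {β : ℝ} (hβ : ∀ j ≥ k, a (e j) ≤ β) :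
    ν k ≤ β + ‖S‖ := by
  refine eigenvalue_le_of_forall_re_inner_le (u := u) hν (fun j : Fin k => b (e j))
    fun f g hfg hf => re_inner_le_of_mem_diagGraph (hG ▸ hfg) fun i hi => ?_
  obtain ⟨j, rfl⟩ := he i
  exact hβ j (not_lt.1 fun hjk => hi (hf ⟨j, hjk⟩))

theorem abs_eigenvalue_sub_le_of_abs_diag_sub_le (hν : Antitone ν)
    (hG : diagGraph b a S = diagGraph u ν 0) (e : ℕ ≃ ι) {m : ℕ → ℝ} (hm : Antitone m) {K : ℝ}
    (hK : ∀ k, |a (e k) - m k| ≤ K) (k : ℕ) : |ν k - m k| ≤ K + ‖S‖ := by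
  have hlow := diag_sub_le_eigenvalue hν hG e.injective (α := m k - K) fun j hj => by
    linarith [(abs_le.1 (hK j)).1, hm hj]
  have hup := eigenvalue_le_diag_add hν hG e.surjective (β := m k + K) fun j hj => by
    linarith [(abs_le.1 (hK j)).2, hm hj]
  exact abs_le.2 ⟨by linarith, by linarith⟩

end MinMax

/-! ### Geometry of the curve -/

section Periodic

variable {E : Type*} [NormedAddCommGroup E] [NormedSpace ℝ E] {f : ℝ → E}

theorem periodic_deriv {L : ℝ} (hf : Function.Periodic f L) : Function.Periodic (deriv f) L :=
  fun s => by rw [← deriv_comp_add_const, hf.funext]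

theorem exists_lipschitzWith_of_contDiff_of_periodic {L : ℝ} (hf : ContDiff ℝ 1 f)
    (hper : Function.Periodic f L) (hL : L ≠ 0) : ∃ K, LipschitzWith K f := by
  obtain ⟨K, hK⟩ := isBounded_iff_forall_norm_le.1 <|
    (periodic_deriv hper).isBounded_of_continuous hL (hf.continuous_deriv le_rfl)
  refine ⟨K.toNNReal, lipschitzWith_of_nnnorm_deriv_le (hf.differentiable one_ne_zero) fun s => ?_⟩
  rw [← NNReal.coe_le_coe, coe_nnnorm]
  exact (hK _ (mem_range_self s)).trans (Real.le_coe_toNNReal K)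

theorem norm_sub_sub_smul_deriv_le (hf : Differentiable ℝ f) {K : NNReal}
    (hK : LipschitzWith K (deriv f)) (s u : ℝ) :
    ‖f (s + u) - f s - u • deriv f s‖ ≤ K * u ^ 2 := by
  have hder (t : ℝ) : HasDerivAt (fun t => f (s + t) - t • deriv f s)
      (deriv f (s + t) - deriv f s) t := by
    simpa using! ((hf (s + t)).hasDerivAt.comp_const_add s t).sub
      ((hasDerivAt_id t).smul_const (deriv f s))
  have hbound : ∀ t ∈ uIcc 0 u, ‖deriv f (s + t) - deriv f s‖ ≤ K * |u| := fun t ht => by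
    have ht' : |t| ≤ |u| := by simpa using abs_sub_left_of_mem_uIcc ht
    calc ‖deriv f (s + t) - deriv f s‖ ≤ K * |t| := by
          simpa [dist_eq_norm] using hK.dist_le_mul (s + t) s
      _ ≤ K * |u| := by gcongr
  have hmean := (convex_uIcc 0 u).norm_image_sub_le_of_norm_hasDerivWithin_le
    (fun t _ => (hder t).hasDerivWithinAt) hbound left_mem_uIcc right_mem_uIcc
  calc ‖f (s + u) - f s - u • deriv f s‖ = ‖f (s + u) - u • deriv f s - f s‖ := by
        rw [sub_right_comm]
    _ ≤ K * |u| * |u| := by simpa using hmean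
    _ = K * u ^ 2 := by rw [mul_assoc, abs_mul_abs_self, sq]

end Periodic

theorem exists_coe_eq_and_abs_eq_norm {L : ℝ} (p : AddCircle L) :
    ∃ u : ℝ, (u : AddCircle L) = p ∧ |u| = ‖p‖ := by
  obtain ⟨t, rfl⟩ := QuotientAddGroup.mk_surjective p
  refine ⟨t - round (L⁻¹ * t) * L, ?_, (AddCircle.norm_eq L).symm⟩
  rw [AddCircle.coe_sub, sub_eq_self]
  exact (QuotientAddGroup.eq_zero_iff _).2 ⟨_, zsmul_eq_mul _ _⟩

namespace ClosedCurve

variable (C : ClosedCurve)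

instance : Fact (0 < C.len) := ⟨C.len_pos⟩

theorem periodic_point : Function.Periodic C.point C.len := fun s => Subtype.ext (C.periodic s)

theorem injective_lift_point : Function.Injective C.periodic_point.lift := fun p q h => by
  obtain ⟨s, hs, rfl⟩ := AddCircle.eq_coe_Ico p
  obtain ⟨t, ht, rfl⟩ := AddCircle.eq_coe_Ico q
  exact congrArg _ (C.injOn hs ht (congrArg Subtype.val h))

theorem surjective_lift_point : Function.Surjective C.periodic_point.lift := by
  rintro ⟨_, s, rfl⟩
  exact ⟨s, rfl⟩

/-- The arc length parametrization as a homeomorphism from the circle `ℝ / len ℤ`. -/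
noncomputable def homeo : AddCircle C.len ≃ₜ C.carrier :=
  Continuous.homeoOfEquivCompactToT2
    (f := Equiv.ofBijective _ ⟨C.injective_lift_point, C.surjective_lift_point⟩)
    (continuous_quot_lift _ C.continuous_point)

theorem homeo_coe (s : ℝ) : C.homeo s = C.point s := rfl

instance : CompactSpace C.carrier := C.homeo.compactSpace

theorem arcLength_eq_map : C.arcLength = (volume : Measure (AddCircle C.len)).map C.homeo := by
  rw [← (AddCircle.measurePreserving_mk C.len 0).map_eq,
    Measure.map_map C.homeo.continuous.measurable AddCircle.measurable_mk', zero_add,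
    ← Measure.restrict_congr_set (Ico_ae_eq_Ioc (μ := (volume : Measure ℝ)))]
  rfl

theorem measurePreserving_homeo : MeasurePreserving C.homeo volume C.arcLength :=
  ⟨C.homeo.continuous.measurable, C.arcLength_eq_map.symm⟩

theorem integral_arcLength {E : Type*} [NormedAddCommGroup E] [NormedSpace ℝ E]
    (f : C.carrier → E) : ∫ x, f x ∂C.arcLength = ∫ p, f (C.homeo p) :=
  (C.measurePreserving_homeo.integral_comp C.homeo.measurableEmbedding f).symm

instance : C.arcLength.IsOpenPosMeasure := by
  rw [arcLength_eq_map]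
  exact C.homeo.continuous.isOpenPosMeasure_map C.homeo.surjective

theorem arcLength_real_univ : C.arcLength.real univ = C.len := by
  rw [measureReal_def, ← C.measurePreserving_homeo.measure_preimage nullMeasurableSet_univ,
    preimage_univ, AddCircle.measure_univ, ENNReal.toReal_ofReal C.len_pos.le]

/-- The length of the shorter of the two arcs between `x` and `y`. -/
noncomputable def arcDist (x y : C.carrier) : ℝ := ‖C.homeo.symm y - C.homeo.symm x‖

theorem arcDist_comm (x y : C.carrier) : C.arcDist x y = C.arcDist y x := norm_sub_rev _ _

theorem arcDist_nonneg (x y : C.carrier) : 0 ≤ C.arcDist x y := norm_nonneg _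

theorem arcDist_pos {x y : C.carrier} (h : x ≠ y) : 0 < C.arcDist x y :=
  norm_pos_iff.2 <| sub_ne_zero.2 fun h' => h (C.homeo.symm.injective h').symm

theorem continuous_arcDist : Continuous fun p : C.carrier × C.carrier => C.arcDist p.1 p.2 :=
  ((C.homeo.symm.continuous.comp continuous_snd).sub
    (C.homeo.symm.continuous.comp continuous_fst)).norm

theorem arcDist_homeo (p q : AddCircle C.len) :
    C.arcDist (C.homeo p) (C.homeo q) = ‖q - p‖ := by
  simp only [arcDist, Homeomorph.symm_apply_apply]

theorem arcDist_point_le (s t : ℝ) : C.arcDist (C.point s) (C.point t) ≤ |t - s| := by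
  rw [← homeo_coe, ← homeo_coe, arcDist_homeo, ← AddCircle.coe_sub]
  exact QuotientAddGroup.norm_mk_le_norm

theorem exists_eq_point_add (x y : C.carrier) :
    ∃ s u : ℝ, x = C.point s ∧ y = C.point (s + u) ∧ |u| = C.arcDist x y := by
  obtain ⟨_, s, rfl⟩ := x
  obtain ⟨_, t, rfl⟩ := y
  obtain ⟨u, hu, hnorm⟩ := exists_coe_eq_and_abs_eq_norm ((t - s : ℝ) : AddCircle C.len)
  refine ⟨s, u, rfl, ?_, hnorm.trans (C.arcDist_homeo s t).symm⟩
  change C.point t = C.point (s + u)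
  rw [← homeo_coe, ← homeo_coe, AddCircle.coe_add, hu, ← AddCircle.coe_add, add_sub_cancel]

theorem arcDist_le (x y : C.carrier) : C.arcDist x y ≤ C.len / 2 := by
  have h := AddCircle.norm_le_half_period C.len C.len_pos.ne' (x := C.homeo.symm y - C.homeo.symm x)
  rwa [abs_of_pos C.len_pos] at h

theorem interval_eq (δ : ℝ) (x : C.carrier) : C.interval δ x = {y | C.arcDist x y < δ} := by
  ext y
  constructor
  · rintro ⟨s, t, rfl, rfl, ht⟩
    exact (C.arcDist_point_le s t).trans_lt
      (abs_sub_lt_iff.2 ⟨by linarith [ht.2], by linarith [ht.1]⟩)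
  · intro (hy : C.arcDist x y < δ)
    obtain ⟨s, u, rfl, rfl, hu⟩ := C.exists_eq_point_add x y
    have hu' := abs_lt.1 (hu.trans_lt hy)
    exact ⟨s, s + u, rfl, rfl, by linarith [hu'.1], by linarith [hu'.2]⟩

theorem differentiable_param : Differentiable ℝ C.param := C.contDiff.differentiable two_ne_zero

theorem dist_le_arcDist (x y : C.carrier) : dist x y ≤ C.arcDist x y := by
  obtain ⟨s, u, rfl, rfl, hu⟩ := C.exists_eq_point_add x y
  have hlip : LipschitzWith 1 C.param :=
    lipschitzWith_of_nnnorm_deriv_le C.differentiable_param fun s => (C.unit_speed s).le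
  calc dist (C.param s) (C.param (s + u)) ≤ dist s (s + u) := by
        simpa using hlip.dist_le_mul s (s + u)
    _ = |u| := by simp
    _ = _ := hu

theorem exists_arcDist_sub_sq_le_dist :
    ∃ Q > 0, ∀ x y, C.arcDist x y - Q * C.arcDist x y ^ 2 ≤ dist x y := by
  have hder : ContDiff ℝ 1 (deriv C.param) :=
    (contDiff_succ_iff_deriv (n := 1).1 (C.contDiff.of_le one_add_one_eq_two.le)).2.2
  obtain ⟨K, hK⟩ := exists_lipschitzWith_of_contDiff_of_periodic hder
    (periodic_deriv C.periodic) C.len_pos.ne'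
  refine ⟨K + 1, by positivity, fun x y => ?_⟩
  obtain ⟨s, u, rfl, rfl, hu⟩ := C.exists_eq_point_add x y
  have htaylor := norm_sub_sub_smul_deriv_le C.differentiable_param hK s u
  have hunit : ‖u • deriv C.param s‖ = |u| := by
    rw [norm_smul, C.unit_speed, mul_one, Real.norm_eq_abs]
  have htri := norm_le_norm_add_norm_sub (C.param (s + u) - C.param s) (u • deriv C.param s)
  have hdist : dist (C.point s) (C.point (s + u)) = ‖C.param (s + u) - C.param s‖ := by
    rw [dist_comm, Subtype.dist_eq, dist_eq_norm]; rfl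
  rw [← hu, sq_abs, hdist]
  linarith [sq_nonneg u]

theorem exists_le_dist_of_le_arcDist {ε : ℝ} (hε : 0 < ε) :
    ∃ r > 0, ∀ x y, ε ≤ C.arcDist x y → r ≤ dist x y := by
  have hcomp : IsCompact {p : C.carrier × C.carrier | ε ≤ C.arcDist p.1 p.2} :=
    (isClosed_le continuous_const C.continuous_arcDist).isCompact
  obtain ⟨r, hr, hle⟩ := hcomp.exists_forall_le' continuous_dist.continuousOn (a := 0)
    fun p (hp : ε ≤ _) => dist_pos.2 fun h => by
      rw [h, arcDist, sub_self, norm_zero] at hp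
      exact hp.not_gt hε
  exact ⟨r, hr, fun x y hxy => hle (x, y) hxy⟩

theorem exists_mul_arcDist_le_dist : ∃ c > 0, ∀ x y, c * C.arcDist x y ≤ dist x y := by
  obtain ⟨Q, hQ, hloc⟩ := C.exists_arcDist_sub_sq_le_dist
  obtain ⟨r, hr, hfar⟩ := C.exists_le_dist_of_le_arcDist (ε := (2 * Q)⁻¹) (by positivity)
  have hL := C.len_pos
  refine ⟨min (1 / 2) (r / C.len), by positivity, fun x y => ?_⟩
  have hd := C.arcDist_nonneg x y
  rcases le_total (2 * Q)⁻¹ (C.arcDist x y) with hxy | hxy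
  · calc min (1 / 2) (r / C.len) * C.arcDist x y ≤ r / C.len * C.len :=
          mul_le_mul (min_le_right _ _) (by linarith [C.arcDist_le x y]) hd (by positivity)
      _ = r := div_mul_cancel₀ r hL.ne'
      _ ≤ dist x y := hfar x y hxy
  · have hsmall : Q * C.arcDist x y ≤ 1 / 2 :=
      calc Q * C.arcDist x y ≤ Q * (2 * Q)⁻¹ := by gcongr
        _ = 1 / 2 := by field_simp
    calc min (1 / 2) (r / C.len) * C.arcDist x y ≤ 1 / 2 * C.arcDist x y := by
          gcongr
          exact min_le_left _ _
      _ ≤ C.arcDist x y - Q * C.arcDist x y ^ 2 := by nlinarith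
      _ ≤ dist x y := hloc x y

theorem exists_inv_dist_sub_inv_arcDist_le :
    ∃ M > 0, ∀ x y, (dist x y)⁻¹ - (C.arcDist x y)⁻¹ ≤ M := by
  obtain ⟨Q, hQ, hloc⟩ := C.exists_arcDist_sub_sq_le_dist
  obtain ⟨c, hc, hcd⟩ := C.exists_mul_arcDist_le_dist
  refine ⟨Q / c, by positivity, fun x y => ?_⟩
  rcases eq_or_ne x y with rfl | hxy
  · simp only [arcDist, dist_self, sub_self, norm_zero, inv_zero]
    positivity
  have hd := C.arcDist_pos hxy
  have hx := dist_pos.2 hxy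
  calc (dist x y)⁻¹ - (C.arcDist x y)⁻¹ = (C.arcDist x y - dist x y) / (dist x y * C.arcDist x y) :=
        inv_sub_inv hx.ne' hd.ne'
    _ ≤ Q * C.arcDist x y ^ 2 / (c * C.arcDist x y * C.arcDist x y) := by
        gcongr
        · linarith [hloc x y]
        · exact hcd x y
    _ = Q / c := by field_simp

end ClosedCurve

/-! ### The logarithmic Fourier multiplier -/

section AddCircle

variable {L : ℝ} [hL : Fact (0 < L)]

theorem integral_addCircle_comp_norm (g : ℝ → ℝ) :
    ∫ p : AddCircle L, g ‖p‖ = 2 * ∫ u in (0 : ℝ)..(L / 2), g u := by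
  have hL0 := hL.out
  have hnorm : EqOn (fun a : ℝ => g ‖(a : AddCircle L)‖) (fun a => g |a|)
      (Icc (-(L / 2)) (L / 2)) := fun a ha => by
    have ha' : |a| ≤ |L| / 2 := by rwa [abs_of_pos hL0, abs_le]
    simp only [(AddCircle.norm_coe_eq_abs_iff L hL0.ne').2 ha']
  have hind : (Icc (-(L / 2)) (L / 2)).indicator (fun a => g |a|) =
      fun a => (Iic (L / 2)).indicator g |a| := by
    ext a
    simp only [indicator, mem_Icc, mem_Iic, ← abs_le]
  rw [← AddCircle.integral_preimage L (-(L / 2)), show -(L / 2) + L = L / 2 by ring,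
    ← integral_Icc_eq_integral_Ioc, setIntegral_congr_fun measurableSet_Icc hnorm,
    ← integral_indicator measurableSet_Icc, hind, integral_comp_abs,
    setIntegral_indicator measurableSet_Iic, intervalIntegral.integral_of_le (by positivity),
    Ioi_inter_Iic]

theorem setIntegral_addCircle_inv_norm {δ : ℝ} (hδ : 0 < δ) (hδL : δ ≤ L / 2) :
    ∫ p in {p : AddCircle L | δ ≤ ‖p‖}, ‖p‖⁻¹ = 2 * (Real.log (L / 2) - Real.log δ) := by
  have hind : {p : AddCircle L | δ ≤ ‖p‖}.indicator (fun p => ‖p‖⁻¹) =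
      fun p => (Ici δ).indicator (fun u => u⁻¹) ‖p‖ := rfl
  have hset : Ioc 0 (L / 2) ∩ Ici δ = Icc δ (L / 2) := by
    ext u
    exact ⟨fun h => ⟨h.2, h.1.2⟩, fun h => ⟨⟨hδ.trans_le h.1, h.2⟩, h.1⟩⟩
  rw [← integral_indicator (measurableSet_le measurable_const measurable_norm), hind,
    integral_addCircle_comp_norm, intervalIntegral.integral_of_le (hδ.le.trans hδL),
    setIntegral_indicator measurableSet_Ici, hset, integral_Icc_eq_integral_Ioc,
    ← intervalIntegral.integral_of_le hδL, integral_inv_of_pos hδ (hδ.trans_le hδL),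
    Real.log_div (hδ.trans_le hδL).ne' hδ.ne']

end AddCircle

section CosineIntegral

/-- The entire cosine integral `Cin x = ∫₀ˣ (1 - cos v) / v dv`, whose values at the integral
multiples of `π` are the Fourier coefficients of the regularized kernel `1 / |s|`. -/
noncomputable def cin (x : ℝ) : ℝ := ∫ v in (0 : ℝ)..x, (1 - Real.cos v) / v

theorem abs_one_sub_cos_div_le (v : ℝ) : |(1 - Real.cos v) / v| ≤ |v| := by
  rcases eq_or_ne v 0 with rfl | hv
  · simp
  rw [abs_div, div_le_iff₀ (abs_pos.2 hv), abs_mul_abs_self,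
    abs_of_nonneg (sub_nonneg.2 (Real.cos_le_one v))]
  linarith [Real.one_sub_sq_div_two_le_cos (x := v), sq_nonneg v]

theorem intervalIntegrable_one_sub_cos_div (a b : ℝ) :
    IntervalIntegrable (fun v : ℝ => (1 - Real.cos v) / v) volume a b :=
  (continuous_abs.intervalIntegrable a b).mono_fun
    (by fun_prop : Measurable fun v : ℝ => (1 - Real.cos v) / v).aestronglyMeasurable
    (Eventually.of_forall fun v => by
      simpa only [Real.norm_eq_abs, abs_abs] using abs_one_sub_cos_div_le v)

theorem abs_cin_le {x : ℝ} (hx : |x| ≤ 1) : |cin x| ≤ 1 := by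
  have hle : ∀ v ∈ uIoc 0 x, ‖(1 - Real.cos v) / v‖ ≤ 1 := fun v hv => by
    have hv' : |v| ≤ |x| := by simpa using abs_sub_left_of_mem_uIcc (uIoc_subset_uIcc hv)
    exact (abs_one_sub_cos_div_le v).trans (hv'.trans hx)
  calc |cin x| ≤ 1 * |x - 0| := intervalIntegral.norm_integral_le_of_norm_le_const hle
    _ ≤ 1 := by simpa using hx

theorem integral_cos_div {a b : ℝ} (h : (0 : ℝ) ∉ uIcc a b) :
    ∫ v in a..b, Real.cos v / v =
      Real.sin b / b - Real.sin a / a + ∫ v in a..b, Real.sin v / v ^ 2 := by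
  have hne : ∀ v ∈ uIcc a b, v ≠ 0 := fun v hv hv0 => h (hv0 ▸ hv)
  have hparts := intervalIntegral.integral_mul_deriv_eq_deriv_mul
    (fun v hv => hasDerivAt_inv (hne v hv)) (fun v _ => Real.hasDerivAt_sin v)
    (ContinuousOn.neg ((continuousOn_pow 2).inv₀ fun v hv =>
      pow_ne_zero 2 (hne v hv))).intervalIntegrable
    (Real.continuous_cos.intervalIntegrable a b)
  simp only [neg_mul, intervalIntegral.integral_neg, sub_neg_eq_add, inv_mul_eq_div] at hparts
  exact hparts

theorem abs_integral_sin_div_sq_le {x : ℝ} (hx : 1 ≤ x) :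
    |∫ v in (1 : ℝ)..x, Real.sin v / v ^ 2| ≤ 1 := by
  have h0 : (0 : ℝ) ∉ uIcc 1 x := by
    rw [uIcc_of_le hx]
    exact fun h => one_pos.not_ge h.1
  have hle : ∀ v : ℝ, ‖Real.sin v / v ^ 2‖ ≤ v ^ (-2 : ℤ) := fun v => by
    rw [norm_div, norm_pow, Real.norm_eq_abs v, sq_abs, zpow_neg, ← one_div]
    exact div_le_div_of_nonneg_right (Real.abs_sin_le_one v) (sq_nonneg v)
  calc |∫ v in (1 : ℝ)..x, Real.sin v / v ^ 2| ≤ ∫ v in (1 : ℝ)..x, v ^ (-2 : ℤ) :=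
        intervalIntegral.norm_integral_le_of_norm_le hx (Eventually.of_forall fun v _ => hle v)
          (intervalIntegral.intervalIntegrable_zpow (Or.inr h0))
    _ = 1 - x⁻¹ := by
        rw [integral_zpow (Or.inr ⟨by norm_num, h0⟩)]
        norm_num [zpow_neg, zpow_one, div_neg]
    _ ≤ 1 := sub_le_self _ (by positivity)

theorem abs_integral_cos_div_le {x : ℝ} (hx : 1 ≤ x) :
    |∫ v in (1 : ℝ)..x, Real.cos v / v| ≤ 3 := by
  have h0 : (0 : ℝ) ∉ uIcc 1 x := by
    rw [uIcc_of_le hx]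
    exact fun h => one_pos.not_ge h.1
  have hsin (y : ℝ) (hy : 1 ≤ y) : |Real.sin y / y| ≤ 1 := by
    rw [abs_div, abs_of_pos (one_pos.trans_le hy), div_le_one (one_pos.trans_le hy)]
    exact (Real.abs_sin_le_one y).trans hy
  rw [integral_cos_div h0]
  calc _ ≤ |Real.sin x / x| + |Real.sin 1 / 1| + |∫ v in (1 : ℝ)..x, Real.sin v / v ^ 2| :=
        (abs_add_le _ _).trans (add_le_add_left (abs_sub _ _) _)
    _ ≤ 1 + 1 + 1 :=
        add_le_add (add_le_add (hsin x hx) (hsin 1 le_rfl)) (abs_integral_sin_div_sq_le hx)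
    _ = 3 := by norm_num

theorem cin_eq_add_log_sub {x : ℝ} (hx : 0 < x) :
    cin x = cin 1 + Real.log x - ∫ v in (1 : ℝ)..x, Real.cos v / v := by
  have hne : ∀ v ∈ uIcc 1 x, v ≠ 0 := fun v hv => ((lt_inf_iff.2 ⟨one_pos, hx⟩).trans_le hv.1).ne'
  have hinv : IntervalIntegrable (fun v : ℝ => v⁻¹) volume 1 x :=
    (continuousOn_inv₀.mono hne).intervalIntegrable
  have hcos : IntervalIntegrable (fun v : ℝ => Real.cos v / v) volume 1 x :=
    (Real.continuous_cos.continuousOn.div continuousOn_id hne).intervalIntegrable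
  have hlog : Real.log x = ∫ v in (1 : ℝ)..x, v⁻¹ := by rw [integral_inv_of_pos one_pos hx, div_one]
  rw [cin, cin, hlog, add_sub_assoc, ← intervalIntegral.integral_sub hinv hcos,
    ← intervalIntegral.integral_add_adjacent_intervals
      (intervalIntegrable_one_sub_cos_div 0 1) (intervalIntegrable_one_sub_cos_div 1 x)]
  simp only [sub_div, one_div]

theorem abs_cin_sub_log_le {x : ℝ} (hx : 0 ≤ x) : |cin x - Real.log (1 + x)| ≤ 5 := by
  have hlog2 : Real.log 2 ≤ 1 := Real.log_two_lt_d9.le.trans (by norm_num)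
  have hlog0 : 0 ≤ Real.log (1 + x) := Real.log_nonneg (by linarith)
  rcases le_total x 1 with h1 | h1
  · have hcin := abs_le.1 (abs_cin_le (by rwa [abs_of_nonneg hx]))
    have hlog : Real.log (1 + x) ≤ Real.log 2 := Real.log_le_log (by linarith) (by linarith)
    exact abs_le.2 ⟨by linarith [hcin.1], by linarith [hcin.2]⟩
  · have hx0 : 0 < x := one_pos.trans_le h1
    have hcin := abs_le.1 (abs_cin_le (x := 1) (by simp))
    have hcos := abs_le.1 (abs_integral_cos_div_le h1)
    have hle : Real.log x ≤ Real.log (1 + x) := Real.log_le_log hx0 (by linarith)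
    have hge : Real.log (1 + x) ≤ Real.log 2 + Real.log x := by
      rw [← Real.log_mul two_ne_zero hx0.ne']
      exact Real.log_le_log (by linarith) (by linarith)
    rw [cin_eq_add_log_sub hx0]
    exact abs_le.2 ⟨by linarith [hcin.1, hcos.2], by linarith [hcin.2, hcos.1]⟩

end CosineIntegral

namespace ClosedCurve

variable (C : ClosedCurve)

/-- The Fourier multiplier of the operator with kernel `1 / (4π |s - t|)` on the circle
`ℝ / len ℤ`, regularized as in the definition of `B_λ`. -/
noncomputable def multiplier (n : ℤ) : ℝ :=
  Real.log (C.len / 2) / (2 * Real.pi) +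
    ∫ p : AddCircle C.len, (Real.cos (2 * Real.pi * n * ‖p‖ / C.len) - 1) / (4 * Real.pi * ‖p‖)

theorem multiplier_eq (n : ℤ) :
    C.multiplier n = (Real.log (C.len / 2) - cin (Real.pi * |(n : ℝ)|)) / (2 * Real.pi) := by
  have hL := C.len_pos.ne'
  set c : ℝ := 2 * Real.pi * |(n : ℝ)| / C.len with hc
  have hscale : c * ∫ u in (0 : ℝ)..(C.len / 2), (1 - Real.cos (c * u)) / (c * u) =
      cin (Real.pi * |(n : ℝ)|) := by
    have h := intervalIntegral.mul_integral_comp_mul_left (a := 0) (b := C.len / 2)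
      (f := fun v => (1 - Real.cos v) / v) (c := c)
    rwa [mul_zero, show c * (C.len / 2) = Real.pi * |(n : ℝ)| by rw [hc]; field_simp] at h
  have hcos (u : ℝ) : Real.cos (2 * Real.pi * n * u / C.len) = Real.cos (c * u) := by
    rw [← Real.cos_abs, ← Real.cos_abs (c * u)]
    simp only [hc, abs_div, abs_mul, abs_abs, div_mul_eq_mul_div]
  have hpoint (u : ℝ) : (Real.cos (2 * Real.pi * n * u / C.len) - 1) / (4 * Real.pi * u) =
      -(4 * Real.pi)⁻¹ * (c * ((1 - Real.cos (c * u)) / (c * u))) := by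
    rw [hcos]
    rcases eq_or_ne c 0 with h0 | h0
    · simp [h0]
    rcases eq_or_ne u 0 with rfl | hu
    · simp
    field_simp
    ring
  rw [multiplier, integral_addCircle_comp_norm (L := C.len)
    (fun u => (Real.cos (2 * Real.pi * n * u / C.len) - 1) / (4 * Real.pi * u))]
  simp only [hpoint, intervalIntegral.integral_const_mul, hscale]
  field_simp
  ring

theorem exists_abs_multiplier_add_log_le :
    ∃ K, ∀ n : ℤ, |C.multiplier n + Real.log (1 + |(n : ℝ)|) / (2 * Real.pi)| ≤ K := by
  refine ⟨(|Real.log (C.len / 2)| + (5 + Real.log Real.pi)) / (2 * Real.pi), fun n => ?_⟩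
  have hpi : 1 < Real.pi := by linarith [Real.pi_gt_three]
  have hn := abs_nonneg (n : ℝ)
  have hcin := abs_le.1 (abs_cin_sub_log_le (x := Real.pi * |(n : ℝ)|) (by positivity))
  have hle : Real.log (1 + |(n : ℝ)|) ≤ Real.log (1 + Real.pi * |(n : ℝ)|) :=
    Real.log_le_log (by positivity) (by nlinarith)
  have hge : Real.log (1 + Real.pi * |(n : ℝ)|) ≤ Real.log Real.pi + Real.log (1 + |(n : ℝ)|) := by
    rw [← Real.log_mul (by positivity) (by positivity)]
    exact Real.log_le_log (by positivity) (by linarith)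
  have hlogpi := Real.log_pos hpi
  have hdiff : |Real.log (1 + |(n : ℝ)|) - cin (Real.pi * |(n : ℝ)|)| ≤ 5 + Real.log Real.pi :=
    abs_le.2 ⟨by linarith [hcin.2], by linarith [hcin.1]⟩
  rw [multiplier_eq, ← add_div, abs_div, abs_of_pos Real.two_pi_pos, sub_add_eq_add_sub,
    add_sub_assoc]
  gcongr
  exact (abs_add_le _ _).trans (by gcongr)

theorem tendsto_multiplier : Tendsto C.multiplier cofinite atBot := by
  obtain ⟨K, hK⟩ := C.exists_abs_multiplier_add_log_le
  have habs : Tendsto (fun n : ℤ => 1 + |(n : ℝ)|) cofinite atTop :=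
    tendsto_atTop_add_const_left _ 1 <|
      tendsto_norm_cocompact_atTop.comp Int.tendsto_coe_cofinite
  have hlog : Tendsto (fun n : ℤ => K - Real.log (1 + |(n : ℝ)|) / (2 * Real.pi)) cofinite atBot :=
    tendsto_atBot_add_const_left _ K <| tendsto_neg_atTop_atBot.comp <|
      (Real.tendsto_log_atTop.comp habs).atTop_div_const Real.two_pi_pos
  exact tendsto_atBot_mono (fun n => by linarith [(abs_le.1 (hK n)).2]) hlog

end ClosedCurve

/-! ### Bounded integral kernels -/

section KernelOperator

variable {𝕜 X E : Type*} [RCLike 𝕜] [MeasurableSpace X] {μ : Measure X}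
  [NormedAddCommGroup E] [NormedSpace ℝ E] {m m' : X → X → ℝ} {M : ℝ}

/-- A jointly measurable, bounded real integral kernel. -/
def IsBoundedKernel (m : X → X → ℝ) : Prop :=
  Measurable (Function.uncurry m) ∧ ∃ M, ∀ x y, |m x y| ≤ M

theorem IsBoundedKernel.sub (hm : IsBoundedKernel m) (hm' : IsBoundedKernel m') :
    IsBoundedKernel fun x y => m x y - m' x y := by
  obtain ⟨M, hM⟩ := hm.2
  obtain ⟨M', hM'⟩ := hm'.2
  exact ⟨hm.1.sub hm'.1, M + M', fun x y =>
    (abs_sub _ _).trans (add_le_add (hM x y) (hM' x y))⟩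

/-- The integral transform with kernel `m`, acting on functions. -/
noncomputable def kernelFun (μ : Measure X) (m : X → X → ℝ) (f : X → E) (x : X) : E :=
  ∫ y, m x y • f y ∂μ

theorem IsBoundedKernel.integrable_smul (hm : IsBoundedKernel m) {f : X → E}
    (hf : Integrable f μ) (x : X) : Integrable (fun y => m x y • f y) μ := by
  obtain ⟨M, hM⟩ := hm.2
  exact hf.bdd_smul M (hm.1.comp measurable_prodMk_left).aestronglyMeasurable
    (Eventually.of_forall (hM x))

theorem kernelFun_congr {f g : X → E} (h : f =ᵐ[μ] g) : kernelFun μ m f = kernelFun μ m g :=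
  funext fun x => integral_congr_ae (h.mono fun y hy => congrArg (m x y • ·) hy)

theorem IsBoundedKernel.kernelFun_add (hm : IsBoundedKernel m) {f g : X → E}
    (hf : Integrable f μ) (hg : Integrable g μ) :
    kernelFun μ m (f + g) = kernelFun μ m f + kernelFun μ m g := by
  ext x
  simp only [kernelFun, Pi.add_apply, smul_add]
  exact integral_add (hm.integrable_smul hf x) (hm.integrable_smul hg x)

theorem kernelFun_const_smul (c : 𝕜) (f : X → 𝕜) :
    kernelFun μ m (c • f) = c • kernelFun μ m f := by
  ext x
  simp only [kernelFun, Pi.smul_apply, smul_comm _ c]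
  exact integral_smul c _

theorem IsBoundedKernel.kernelFun_sub_kernel (hm : IsBoundedKernel m) (hm' : IsBoundedKernel m')
    {f : X → E} (hf : Integrable f μ) :
    kernelFun μ (fun x y => m x y - m' x y) f = kernelFun μ m f - kernelFun μ m' f := by
  ext x
  simp only [kernelFun, sub_smul]
  exact integral_sub (hm.integrable_smul hf x) (hm'.integrable_smul hf x)

theorem norm_kernelFun_le (hM : ∀ x y, |m x y| ≤ M) {f : X → E} (hf : Integrable f μ) (x : X) :
    ‖kernelFun μ m f x‖ ≤ M * ∫ y, ‖f y‖ ∂μ := by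
  rw [← integral_const_mul]
  refine norm_integral_le_of_norm_le (hf.norm.const_mul M) (Eventually.of_forall fun y => ?_)
  rw [norm_smul]
  exact mul_le_mul_of_nonneg_right (hM x y) (norm_nonneg _)

theorem aestronglyMeasurable_kernelFun [SFinite μ] (hm : Measurable (Function.uncurry m))
    {f : X → E} (hf : AEStronglyMeasurable f μ) : AEStronglyMeasurable (kernelFun μ m f) μ :=
  (hm.aestronglyMeasurable.smul hf.comp_snd).integral_prod_right'

theorem IsBoundedKernel.integrable_prod_smul_inner (hm : IsBoundedKernel m)
    {f g : X → 𝕜} (hf : Integrable f μ) (hg : Integrable g μ) :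
    Integrable (fun p : X × X => m p.1 p.2 • ⟪f p.1, g p.2⟫_𝕜) (μ.prod μ) := by
  obtain ⟨M, hM⟩ := hm.2
  have hfg : Integrable (fun p : X × X => ⟪f p.1, g p.2⟫_𝕜) (μ.prod μ) :=
    hf.op_fst_snd continuous_inner ⟨1, fun a b => by
      simpa only [one_mul] using norm_inner_le_norm a b⟩ hg
  exact hfg.bdd_smul M hm.1.aestronglyMeasurable (Eventually.of_forall fun p => hM p.1 p.2)

variable [IsFiniteMeasure μ]

theorem integral_norm_Lp_two_le {F : Type*} [NormedAddCommGroup F] (f : Lp F 2 μ) :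
    ∫ x, ‖f x‖ ∂μ ≤ √(μ.real univ) * ‖f‖ := by
  have hle := eLpNorm_le_eLpNorm_mul_rpow_measure_univ (p := 1) (q := 2) (μ := μ)
    one_le_two (Lp.memLp f).1
  have hne := ENNReal.mul_ne_top (Lp.memLp f).eLpNorm_ne_top
    (ENNReal.rpow_ne_top_of_nonneg (y := 1 / (1 : ℝ≥0∞).toReal - 1 / (2 : ℝ≥0∞).toReal)
      (by norm_num) (measure_ne_top μ univ))
  calc ∫ x, ‖f x‖ ∂μ = (eLpNorm f 1 μ).toReal := by
        rw [eLpNorm_one_eq_lintegral_enorm, integral_norm_eq_lintegral_enorm (Lp.memLp f).1]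
    _ ≤ _ := ENNReal.toReal_mono hne hle
    _ = √(μ.real univ) * ‖f‖ := by
        rw [ENNReal.toReal_mul, ← ENNReal.toReal_rpow, ← measureReal_def, ← Lp.norm_def,
          Real.sqrt_eq_rpow, mul_comm]
        norm_num

theorem IsBoundedKernel.memLp_kernelFun (hm : IsBoundedKernel m) {f : X → E}
    (hf : Integrable f μ) {p : ℝ≥0∞} : MemLp (kernelFun μ m f) p μ := by
  obtain ⟨M, hM⟩ := hm.2
  exact MemLp.of_bound (aestronglyMeasurable_kernelFun hm.1 hf.1) _
    (Eventually.of_forall (norm_kernelFun_le hM hf))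

theorem norm_toLp_kernelFun_le (hM : ∀ x y, |m x y| ≤ M) (hM0 : 0 ≤ M) (f : Lp E 2 μ)
    (hf : MemLp (kernelFun μ m f) 2 μ) : ‖hf.toLp (kernelFun μ m f)‖ ≤ M * μ.real univ * ‖f‖ := by
  have hbound : ∀ᵐ x ∂μ, ‖hf.toLp (kernelFun μ m f) x‖ ≤ M * (√(μ.real univ) * ‖f‖) := by
    filter_upwards [hf.coeFn_toLp] with x hx
    rw [hx]
    exact (norm_kernelFun_le hM ((Lp.memLp f).integrable one_le_two) x).trans
      (mul_le_mul_of_nonneg_left (integral_norm_Lp_two_le f) hM0)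
  have hroot : (measureUnivNNReal μ : ℝ) ^ (2 : ℝ≥0∞).toReal⁻¹ = √(μ.real univ) := by
    rw [Real.sqrt_eq_rpow, ENNReal.toReal_ofNat, inv_eq_one_div]
    rfl
  calc ‖hf.toLp (kernelFun μ m f)‖
      ≤ (measureUnivNNReal μ : ℝ) ^ (2 : ℝ≥0∞).toReal⁻¹ * (M * (√(μ.real univ) * ‖f‖)) :=
        Lp.norm_le_of_ae_bound (by positivity) hbound
    _ = √(μ.real univ) * (M * (√(μ.real univ) * ‖f‖)) := by rw [hroot]
    _ = M * (√(μ.real univ) * √(μ.real univ)) * ‖f‖ := by ring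
    _ = M * μ.real univ * ‖f‖ := by rw [Real.mul_self_sqrt measureReal_nonneg]

variable (𝕜) in
/-- The integral operator with bounded kernel `m` on `L²(μ)`. -/
noncomputable def kernelOp (hm : IsBoundedKernel m) :
    Lp 𝕜 2 μ →L[𝕜] Lp 𝕜 2 μ :=
  LinearMap.mkContinuousOfExistsBound
    { toFun := fun f => (hm.memLp_kernelFun ((Lp.memLp f).integrable one_le_two)).toLp
      map_add' := fun f g => by
        rw [← MemLp.toLp_add]
        exact MemLp.toLp_congr _ _ <| .of_eq <| (kernelFun_congr (Lp.coeFn_add f g)).trans <|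
          hm.kernelFun_add ((Lp.memLp f).integrable one_le_two)
            ((Lp.memLp g).integrable one_le_two)
      map_smul' := fun c f => by
        rw [← MemLp.toLp_const_smul]
        exact MemLp.toLp_congr _ _ <| .of_eq <| (kernelFun_congr (Lp.coeFn_smul c f)).trans <|
          kernelFun_const_smul c f }
    (by
      obtain ⟨M, hM⟩ := hm.2
      exact ⟨_, fun f => norm_toLp_kernelFun_le (fun x y => (hM x y).trans (le_max_left M 0))
        (le_max_right M 0) f
        (hm.memLp_kernelFun ((Lp.memLp f).integrable one_le_two))⟩)

theorem coeFn_kernelOp (hm : IsBoundedKernel m) (f : Lp 𝕜 2 μ) :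
    kernelOp 𝕜 hm f =ᵐ[μ] kernelFun μ m f :=
  (hm.memLp_kernelFun ((Lp.memLp f).integrable one_le_two)).coeFn_toLp

theorem norm_kernelOp_le (hm : IsBoundedKernel m) (hM : ∀ x y, |m x y| ≤ M) (hM0 : 0 ≤ M) :
    ‖(kernelOp 𝕜 hm : Lp 𝕜 2 μ →L[𝕜] Lp 𝕜 2 μ)‖ ≤ M * μ.real univ :=
  ContinuousLinearMap.opNorm_le_bound _ (by positivity) fun f =>
    norm_toLp_kernelFun_le hM hM0 f (hm.memLp_kernelFun ((Lp.memLp f).integrable one_le_two))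

theorem kernelOp_sub (hm : IsBoundedKernel m) (hm' : IsBoundedKernel m') :
    (kernelOp 𝕜 hm - kernelOp 𝕜 hm' : Lp 𝕜 2 μ →L[𝕜] Lp 𝕜 2 μ) = kernelOp 𝕜 (hm.sub hm') := by
  ext1 f
  have hker := hm.kernelFun_sub_kernel hm' ((Lp.memLp f).integrable one_le_two)
  exact Lp.ext <| (Lp.coeFn_sub _ _).trans <|
    ((coeFn_kernelOp hm f).sub (coeFn_kernelOp hm' f)).trans <|
    (EventuallyEq.of_eq hker.symm).trans (coeFn_kernelOp (hm.sub hm') f).symm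

theorem inner_kernelOp (hm : IsBoundedKernel m) (f g : Lp 𝕜 2 μ) :
    ⟪f, kernelOp 𝕜 hm g⟫_𝕜 = ∫ x, ∫ y, m x y • ⟪f x, g y⟫_𝕜 ∂μ ∂μ := by
  rw [L2.inner_def]
  refine integral_congr_ae ?_
  filter_upwards [coeFn_kernelOp hm g] with x hx
  rw [hx, kernelFun, ← integral_inner (hm.integrable_smul ((Lp.memLp g).integrable one_le_two) x)]
  simp only [inner_smul_right_eq_smul]

theorem isSymmetric_kernelOp (hm : IsBoundedKernel m) (hsymm : ∀ x y, m x y = m y x) :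
    ((kernelOp 𝕜 hm : Lp 𝕜 2 μ →L[𝕜] Lp 𝕜 2 μ) : Lp 𝕜 2 μ →ₗ[𝕜] Lp 𝕜 2 μ).IsSymmetric := by
  intro f g
  calc ⟪kernelOp 𝕜 hm f, g⟫_𝕜 = ∫ x, ∫ y, m y x • ⟪f y, g x⟫_𝕜 ∂μ ∂μ := by
        rw [← inner_conj_symm, inner_kernelOp, ← integral_conj]
        simp only [← integral_conj, RCLike.conj_smul, inner_conj_symm, hsymm]
    _ = ∫ x, ∫ y, m x y • ⟪f x, g y⟫_𝕜 ∂μ ∂μ :=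
        integral_integral_swap (hm.integrable_prod_smul_inner
          ((Lp.memLp f).integrable one_le_two) ((Lp.memLp g).integrable one_le_two)).swap
    _ = ⟪f, kernelOp 𝕜 hm g⟫_𝕜 := (inner_kernelOp hm f g).symm

end KernelOperator

/-! ### Splitting of the regularized operator -/

section YukawaExponential

theorem abs_exp_neg_mul_sub_le {a b r : ℝ} (ha : 0 ≤ a) (hb : 0 ≤ b) (hr : 0 ≤ r) :
    |Real.exp (-a * r) - Real.exp (-b * r)| ≤ |a - b| * r := by
  wlog hab : a ≤ b generalizing a b
  · rw [abs_sub_comm, abs_sub_comm a]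
    exact this hb ha (not_le.1 hab).le
  have hle : Real.exp (-a * r) ≤ 1 := Real.exp_le_one_iff.2 (by nlinarith)
  have hmul : Real.exp (-b * r) = Real.exp (-a * r) * Real.exp (-((b - a) * r)) := by
    rw [← Real.exp_add]
    ring_nf
  have hexp := Real.add_one_le_exp (-((b - a) * r))
  have hdiff : 0 ≤ (b - a) * r := mul_nonneg (sub_nonneg.2 hab) hr
  have hdiff_le : 1 - Real.exp (-((b - a) * r)) ≤ (b - a) * r := by linarith
  have hdiff_nonneg : 0 ≤ 1 - Real.exp (-((b - a) * r)) :=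
    sub_nonneg.2 (Real.exp_le_one_iff.2 (neg_nonpos.2 hdiff))
  calc |Real.exp (-a * r) - Real.exp (-b * r)|
      = Real.exp (-a * r) * (1 - Real.exp (-((b - a) * r))) := by
        rw [hmul, ← mul_one_sub, abs_of_nonneg (by positivity)]
    _ ≤ 1 * ((b - a) * r) := mul_le_mul hle hdiff_le hdiff_nonneg zero_le_one
    _ = |a - b| * r := by rw [one_mul, abs_sub_comm, abs_of_nonneg (sub_nonneg.2 hab)]

end YukawaExponential

namespace ClosedCurve

variable (C : ClosedCurve)

theorem kernel_comm (lam : ℝ) (x y : C.carrier) : C.kernel lam x y = C.kernel lam y x := by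
  simp only [kernel, dist_comm]

theorem kernel_nonneg (lam : ℝ) (x y : C.carrier) : 0 ≤ C.kernel lam x y := by
  unfold kernel
  positivity

theorem measurable_kernel (lam : ℝ) : Measurable (Function.uncurry (C.kernel lam)) := by
  unfold Function.uncurry kernel
  fun_prop

theorem abs_kernel_sub_le (lam mu : ℝ) (x y : C.carrier) :
    |C.kernel lam x y - C.kernel mu x y| ≤ (4 * Real.pi)⁻¹ * |√(-lam) - √(-mu)| := by
  rw [kernel, kernel, ← sub_div, abs_div, abs_of_nonneg (by positivity : 0 ≤ 4 * Real.pi * _),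
    div_eq_inv_mul, mul_inv, mul_assoc]
  gcongr
  rcases eq_or_ne x y with rfl | hxy
  · simp
  rw [inv_mul_le_iff₀ (dist_pos.2 hxy), mul_comm (dist x y)]
  exact abs_exp_neg_mul_sub_le (Real.sqrt_nonneg _) (Real.sqrt_nonneg _) dist_nonneg

/-- The difference between the kernel of `B_λ` and the kernel `1 / (4π |s - t|)`, where `|s - t|`
is the distance along the curve. It is bounded, so that it needs no regularization. -/
noncomputable def remainderKernel (lam : ℝ) (x y : C.carrier) : ℝ :=
  C.kernel lam x y - (4 * Real.pi * C.arcDist x y)⁻¹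

theorem remainderKernel_comm (lam : ℝ) (x y : C.carrier) :
    C.remainderKernel lam x y = C.remainderKernel lam y x := by
  simp only [remainderKernel, C.kernel_comm lam x y, C.arcDist_comm x y]

theorem remainderKernel_self (lam : ℝ) (x : C.carrier) : C.remainderKernel lam x x = 0 := by
  simp [remainderKernel, kernel, arcDist]

theorem exists_abs_remainderKernel_zero_le : ∃ M, ∀ x y, |C.remainderKernel 0 x y| ≤ M := by
  obtain ⟨M, -, hM⟩ := C.exists_inv_dist_sub_inv_arcDist_le
  refine ⟨(4 * Real.pi)⁻¹ * M, fun x y => ?_⟩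
  rcases eq_or_ne x y with rfl | hxy
  · rw [remainderKernel_self, abs_zero]
    exact mul_nonneg (by positivity) (by simpa [arcDist] using hM x x)
  have hle : (C.arcDist x y)⁻¹ ≤ (dist x y)⁻¹ :=
    inv_anti₀ (dist_pos.2 hxy) (C.dist_le_arcDist x y)
  calc |C.remainderKernel 0 x y|
      = (4 * Real.pi)⁻¹ * |(dist x y)⁻¹ - (C.arcDist x y)⁻¹| := by
        rw [remainderKernel, kernel, neg_zero, Real.sqrt_zero, neg_zero, zero_mul, Real.exp_zero,
          one_div, mul_inv, mul_inv _ (C.arcDist x y), ← mul_sub, abs_mul,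
          abs_of_pos (by positivity : 0 < (4 * Real.pi)⁻¹)]
    _ ≤ (4 * Real.pi)⁻¹ * M := by
        rw [abs_of_nonneg (sub_nonneg.2 hle)]
        gcongr
        exact hM x y

theorem isBoundedKernel_remainderKernel (lam : ℝ) : IsBoundedKernel (C.remainderKernel lam) := by
  obtain ⟨M, hM⟩ := C.exists_abs_remainderKernel_zero_le
  refine ⟨(C.measurable_kernel lam).sub (C.continuous_arcDist.measurable.const_mul _).inv,
    (4 * Real.pi)⁻¹ * |√(-lam) - √(-0)| + M, fun x y => ?_⟩
  calc |C.remainderKernel lam x y|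
      = |C.kernel lam x y - C.kernel 0 x y + C.remainderKernel 0 x y| := by
        rw [remainderKernel, remainderKernel, sub_add_sub_cancel]
    _ ≤ _ := (abs_add_le _ _).trans (add_le_add (C.abs_kernel_sub_le lam 0 x y) (hM x y))

/-- The bounded part of `B_λ`: the integral operator with kernel `remainderKernel`. -/
noncomputable def remainderOp (lam : ℝ) : C.L2 →L[ℂ] C.L2 :=
  kernelOp ℂ (C.isBoundedKernel_remainderKernel lam)

theorem isSymmetric_remainderOp (lam : ℝ) :
    (C.remainderOp lam : C.L2 →ₗ[ℂ] C.L2).IsSymmetric :=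
  isSymmetric_kernelOp _ (C.remainderKernel_comm lam)

theorem norm_remainderOp_sub_le (lam mu : ℝ) : ‖C.remainderOp lam - C.remainderOp mu‖ ≤
    (4 * Real.pi)⁻¹ * |√(-lam) - √(-mu)| * C.len := by
  rw [remainderOp, remainderOp, kernelOp_sub, ← C.arcLength_real_univ]
  refine norm_kernelOp_le _ (fun x y => ?_) (by positivity)
  simpa only [remainderKernel, sub_sub_sub_cancel_right] using C.abs_kernel_sub_le lam mu x y

/-- The integrand of `arcRegularization`; at `y = x` it is `0` by the convention `0⁻¹ = 0`. -/
noncomputable def arcIntegrand (h : C.carrier → ℂ) (x y : C.carrier) : ℂ :=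
  (4 * Real.pi * C.arcDist x y)⁻¹ • (h y - h x)

/-- The regularized integral transform with kernel `1 / (4π |s - t|)`, where `|s - t|` is the
distance along the curve: the divergent part of the integral is replaced by its finite part
`log (len / 2) / (2π)`. -/
noncomputable def arcRegularization (h : C.carrier → ℂ) (x : C.carrier) : ℂ :=
  (∫ y, C.arcIntegrand h x y ∂C.arcLength) + (Real.log (C.len / 2) / (2 * Real.pi)) • h x

variable {C} {h k k' : C.carrier → ℂ} {lam δ : ℝ}

theorem IsLip.continuous (hh : C.IsLip h) : Continuous h :=
  hh.choose_spec.continuous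

theorem IsLip.memLp (hh : C.IsLip h) {p : ℝ≥0∞} : MemLp h p C.arcLength := by
  obtain ⟨K, hK⟩ := isCompact_univ.exists_bound_of_continuousOn hh.continuous.continuousOn
  exact MemLp.of_bound hh.continuous.aestronglyMeasurable K
    (Eventually.of_forall fun x => hK x (mem_univ x))

theorem IsLip.integrable (hh : C.IsLip h) : Integrable h C.arcLength :=
  memLp_one_iff_integrable.1 hh.memLp

theorem IsLip.exists_norm_arcIntegrand_le (hh : C.IsLip h) :
    ∃ K, ∀ x y, ‖C.arcIntegrand h x y‖ ≤ K := by
  obtain ⟨K, hK⟩ := hh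
  refine ⟨(4 * Real.pi)⁻¹ * K, fun x y => ?_⟩
  rcases eq_or_ne x y with rfl | hxy
  · rw [arcIntegrand, sub_self, smul_zero, norm_zero]
    positivity
  have hd := C.arcDist_pos hxy
  have hle : ‖h y - h x‖ ≤ K * C.arcDist x y := by
    rw [← dist_eq_norm, dist_comm]
    exact (hK.dist_le_mul x y).trans (by gcongr; exact C.dist_le_arcDist x y)
  calc ‖C.arcIntegrand h x y‖ = (4 * Real.pi * C.arcDist x y)⁻¹ * ‖h y - h x‖ := by
        rw [arcIntegrand, norm_smul, Real.norm_of_nonneg (by positivity)]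
    _ ≤ (4 * Real.pi * C.arcDist x y)⁻¹ * (K * C.arcDist x y) := by gcongr
    _ = (4 * Real.pi)⁻¹ * K := by field_simp

theorem IsLip.measurable_arcIntegrand (hh : C.IsLip h) :
    Measurable (Function.uncurry (C.arcIntegrand h)) :=
  (C.continuous_arcDist.measurable.const_mul _).inv.smul <|
    (hh.continuous.measurable.comp measurable_snd).sub
      (hh.continuous.measurable.comp measurable_fst)

theorem IsLip.integrable_arcIntegrand (hh : C.IsLip h) (x : C.carrier) :
    Integrable (C.arcIntegrand h x) C.arcLength := by
  obtain ⟨K, hK⟩ := hh.exists_norm_arcIntegrand_le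
  exact Integrable.of_bound
    (hh.measurable_arcIntegrand.comp measurable_prodMk_left).aestronglyMeasurable K
    (Eventually.of_forall (hK x))

theorem IsLip.memLp_arcRegularization (hh : C.IsLip h) {p : ℝ≥0∞} :
    MemLp (C.arcRegularization h) p C.arcLength := by
  obtain ⟨K, hK⟩ := hh.exists_norm_arcIntegrand_le
  refine MemLp.add ?_ (hh.memLp.const_smul (Real.log (C.len / 2) / (2 * Real.pi)))
  exact MemLp.of_bound
    hh.measurable_arcIntegrand.stronglyMeasurable.integral_prod_right.aestronglyMeasurable
    (K * C.arcLength.real univ)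
    (Eventually.of_forall fun x => norm_integral_le_of_norm_le_const (Eventually.of_forall (hK x)))

theorem compl_interval (δ : ℝ) (x : C.carrier) :
    (C.interval δ x)ᶜ = {y | δ ≤ C.arcDist x y} := by
  ext y
  simp only [interval_eq, mem_compl_iff, mem_ofPred_eq, not_lt]

theorem continuous_arcDist_right (x : C.carrier) : Continuous fun y => C.arcDist x y :=
  (C.homeo.symm.continuous.sub continuous_const).norm

theorem measurableSet_compl_interval (δ : ℝ) (x : C.carrier) :
    MeasurableSet (C.interval δ x)ᶜ := by
  rw [compl_interval]
  exact (isClosed_le continuous_const (continuous_arcDist_right x)).measurableSet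

theorem integral_compl_interval_inv_arcDist (x : C.carrier) (hδ : 0 < δ) (hδL : δ ≤ C.len / 2) :
    ∫ y in (C.interval δ x)ᶜ, (4 * Real.pi * C.arcDist x y)⁻¹ ∂C.arcLength =
      (Real.log (C.len / 2) - Real.log δ) / (2 * Real.pi) := by
  obtain ⟨q, rfl⟩ := C.homeo.surjective x
  have hdist (p : AddCircle C.len) : C.arcDist (C.homeo q) (C.homeo (p + q)) = ‖p‖ := by
    rw [arcDist_homeo, add_sub_cancel_right]
  have hpres := C.measurePreserving_homeo.comp (measurePreserving_add_right volume q)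
  rw [← hpres.setIntegral_preimage_emb
    (C.homeo.measurableEmbedding.comp (measurableEmbedding_addRight q)), compl_interval]
  simp only [preimage_ofPred_eq, Function.comp_apply, hdist, mul_inv]
  rw [integral_const_mul, setIntegral_addCircle_inv_norm hδ hδL]
  field_simp
  ring

theorem integrableOn_compl_interval_inv_arcDist (x : C.carrier) (hδ : 0 < δ) :
    IntegrableOn (fun y => (4 * Real.pi * C.arcDist x y)⁻¹) (C.interval δ x)ᶜ C.arcLength := by
  refine Measure.integrableOn_of_bounded (M := (4 * Real.pi * δ)⁻¹) (measure_ne_top _ _)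
    ((continuous_arcDist_right x).measurable.const_mul _).inv.aestronglyMeasurable ?_
  filter_upwards [ae_restrict_mem (measurableSet_compl_interval δ x)] with y hy
  rw [compl_interval] at hy
  rw [Real.norm_of_nonneg (inv_nonneg.2 (mul_nonneg (by positivity) (C.arcDist_nonneg x y)))]
  exact inv_anti₀ (by positivity) (by gcongr; exact hy)

theorem tendsto_setIntegral_compl_interval {E : Type*} [NormedAddCommGroup E] [NormedSpace ℝ E]
    {G : C.carrier → E} (hG : Integrable G C.arcLength) {x : C.carrier} (hx : G x = 0) :
    Tendsto (fun δ => ∫ y in (C.interval δ x)ᶜ, G y ∂C.arcLength) (𝓝[>] 0)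
      (𝓝 (∫ y, G y ∂C.arcLength)) := by
  simp_rw [← integral_indicator (measurableSet_compl_interval _ x)]
  refine tendsto_integral_filter_of_dominated_convergence (fun y => ‖G y‖)
    (Eventually.of_forall fun δ =>
      hG.aestronglyMeasurable.indicator (measurableSet_compl_interval δ x))
    (Eventually.of_forall fun δ => Eventually.of_forall fun y => norm_indicator_le_norm_self _ _)
    hG.norm (Eventually.of_forall fun y => ?_)
  refine tendsto_const_nhds.congr' ?_
  rcases eq_or_ne x y with rfl | hxy
  · exact Eventually.of_forall fun δ => (indicator_apply_eq_self.2 fun _ => hx).symm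
  · filter_upwards [Ioo_mem_nhdsGT (C.arcDist_pos hxy)] with δ hδ
    rw [indicator_of_mem]
    rw [compl_interval]
    exact hδ.2.le

theorem IsLip.integrable_arcIntegrand_add (hh : C.IsLip h) (lam : ℝ) (x : C.carrier) :
    Integrable (fun y => C.arcIntegrand h x y + C.remainderKernel lam x y • h y) C.arcLength :=
  (hh.integrable_arcIntegrand x).add
    ((C.isBoundedKernel_remainderKernel lam).integrable_smul hh.integrable x)

theorem IsLip.truncated_eq (hh : C.IsLip h) (lam : ℝ) (x : C.carrier) (hδ : 0 < δ)
    (hδL : δ ≤ C.len / 2) :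
    C.truncated lam h x δ =
      (∫ y in (C.interval δ x)ᶜ, (C.arcIntegrand h x y + C.remainderKernel lam x y • h y)
        ∂C.arcLength) + (Real.log (C.len / 2) / (2 * Real.pi)) • h x := by
  have hsplit (y : C.carrier) : h y * (C.kernel lam x y : ℂ) =
      C.arcIntegrand h x y + C.remainderKernel lam x y • h y +
        (4 * Real.pi * C.arcDist x y)⁻¹ • h x := by
    simp only [arcIntegrand, remainderKernel, Complex.real_smul]
    push_cast
    ring
  simp only [truncated, hsplit]
  rw [integral_add (hh.integrable_arcIntegrand_add lam x).integrableOn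
      ((integrableOn_compl_interval_inv_arcDist x hδ).smul_const _),
    integral_smul_const, integral_compl_interval_inv_arcDist x hδ hδL]
  simp only [Complex.real_smul]
  push_cast
  ring

theorem IsLip.isRegularization (hh : C.IsLip h) (lam : ℝ) :
    C.IsRegularization lam h
      (C.arcRegularization h + kernelFun C.arcLength (C.remainderKernel lam) h) := by
  intro x
  have hlim := (tendsto_setIntegral_compl_interval (hh.integrable_arcIntegrand_add lam x) (by
    rw [arcIntegrand, remainderKernel_self, sub_self, smul_zero, zero_smul, add_zero])).add_const
      ((Real.log (C.len / 2) / (2 * Real.pi)) • h x)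
  rw [integral_add (hh.integrable_arcIntegrand x)
    ((C.isBoundedKernel_remainderKernel lam).integrable_smul hh.integrable x),
    add_right_comm] at hlim
  refine hlim.congr' ?_
  filter_upwards [Ioo_mem_nhdsGT (half_pos C.len_pos)] with δ hδ
  exact (hh.truncated_eq lam x hδ.1 hδ.2.le).symm

theorem IsRegularization.unique (hk : C.IsRegularization lam h k)
    (hk' : C.IsRegularization lam h k') : k = k' :=
  funext fun x => tendsto_nhds_unique (hk x) (hk' x)

theorem isRegularization_zero : C.IsRegularization lam 0 0 := fun x => by
  have hzero : C.truncated lam 0 x = fun _ => 0 := by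
    ext δ
    simp [truncated]
  rw [hzero]
  exact tendsto_const_nhds

theorem graph_B (lam : ℝ) : (C.B lam).graph = C.graphB lam := by
  refine Submodule.toLinearPMap_graph_eq _ ?_
  rintro ⟨f, g⟩ ⟨h, k, hh, hk, hf, hg⟩ (rfl : f = 0)
  obtain rfl : h = 0 := (Continuous.ae_eq_iff_eq C.arcLength hh.continuous continuous_const).1 <|
    hf.symm.trans (Lp.coeFn_zero ℂ 2 C.arcLength)
  obtain rfl := hk.unique isRegularization_zero
  exact Lp.ext (hg.trans (Lp.coeFn_zero ℂ 2 C.arcLength).symm)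

theorem mem_graph_B_iff {f g : C.L2} : (f, g) ∈ (C.B lam).graph ↔
    ∃ h, C.IsLip h ∧ f =ᵐ[C.arcLength] h ∧ g =ᵐ[C.arcLength]
      C.arcRegularization h + kernelFun C.arcLength (C.remainderKernel lam) h := by
  rw [graph_B]
  constructor
  · rintro ⟨h, k, hh, hk, hf, hg⟩
    rw [hk.unique (hh.isRegularization lam)] at hg
    exact ⟨h, hh, hf, hg⟩
  · rintro ⟨h, hh, hf, hg⟩
    exact ⟨h, _, hh, hh.isRegularization lam, hf, hg⟩

theorem IsLip.memLp_regularization (hh : C.IsLip h) (lam : ℝ) {p : ℝ≥0∞} :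
    MemLp (C.arcRegularization h + kernelFun C.arcLength (C.remainderKernel lam) h) p
      C.arcLength :=
  hh.memLp_arcRegularization.add
    ((C.isBoundedKernel_remainderKernel lam).memLp_kernelFun hh.integrable)

theorem IsLip.toLp_mem_graph_B (hh : C.IsLip h) (lam : ℝ) :
    (hh.memLp.toLp h, (hh.memLp_regularization lam).toLp _) ∈ (C.B lam).graph :=
  mem_graph_B_iff.2 ⟨h, hh, MemLp.coeFn_toLp _, MemLp.coeFn_toLp _⟩

end ClosedCurve

/-! ### The Fourier basis of the curve -/

section Fourier

variable {L : ℝ}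

theorem fourier_coe_eq_exp_mul_I (n : ℤ) (u : ℝ) :
    fourier n (u : AddCircle L) =
      Complex.exp (((2 * Real.pi * n * u / L : ℝ) : ℂ) * Complex.I) := by
  rw [fourier_coe_apply]
  push_cast
  ring_nf

theorem re_fourier (n : ℤ) (p : AddCircle L) :
    (fourier n p).re = Real.cos (2 * Real.pi * n * ‖p‖ / L) := by
  obtain ⟨u, rfl, hu⟩ := exists_coe_eq_and_abs_eq_norm p
  rw [fourier_coe_eq_exp_mul_I, Complex.exp_ofReal_mul_I_re, ← hu]
  rcases abs_choice u with h | h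
  · rw [h]
  · rw [h, mul_neg, neg_div, Real.cos_neg]

theorem fourier_neg_apply_neg (n : ℤ) (p : AddCircle L) : fourier (-n) (-p) = fourier n p := by
  rw [fourier_apply, fourier_apply, neg_smul_neg]

theorem fourier_apply_add (n : ℤ) (p q : AddCircle L) :
    fourier n (p + q) = fourier n p * fourier n q := by
  simp only [fourier_apply, smul_add, AddCircle.toCircle_add, Circle.coe_mul]

theorem norm_fourier_sub_one_le (n : ℤ) (p : AddCircle L) :
    ‖fourier n p - 1‖ ≤ 2 * Real.pi * |(n : ℝ)| / |L| * ‖p‖ := by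
  obtain ⟨u, rfl, hu⟩ := exists_coe_eq_and_abs_eq_norm p
  rw [fourier_coe_eq_exp_mul_I, mul_comm _ Complex.I, ← hu]
  refine Real.norm_exp_I_mul_ofReal_sub_one_le.trans_eq ?_
  rw [Real.norm_eq_abs, abs_div, abs_mul, abs_mul, abs_of_pos Real.two_pi_pos]
  ring

theorem norm_fourier_sub_le (n : ℤ) (p q : AddCircle L) :
    ‖fourier n q - fourier n p‖ ≤ 2 * Real.pi * |(n : ℝ)| / |L| * ‖q - p‖ := by
  have hfactor : fourier n q - fourier n p = fourier n p * (fourier n (q - p) - 1) := by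
    rw [mul_sub, ← fourier_apply_add, mul_one, add_sub_cancel]
  rw [hfactor, norm_mul, fourier_apply, Circle.norm_coe, one_mul]
  exact norm_fourier_sub_one_le n (q - p)

variable [hL : Fact (0 < L)]

theorem ae_eq_zero_of_fourierCoeff_eq_zero {f : AddCircle L → ℂ}
    (hf : MemLp f 2 AddCircle.haarAddCircle) (h : ∀ n, fourierCoeff f n = 0) :
    f =ᵐ[AddCircle.haarAddCircle] 0 := by
  have hzero : hf.toLp f = 0 := fourierBasis.repr.injective <| by
    ext n
    rw [fourierBasis_repr, fourierCoeff_congr_ae hf.coeFn_toLp, h n, map_zero, lp.coeFn_zero,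
      Pi.zero_apply]
  exact (MemLp.toLp_eq_toLp_iff hf MemLp.zero).1 (hzero.trans (MemLp.toLp_zero _).symm)

theorem integrable_inv_norm_smul_fourier_sub_one (n : ℤ) :
    Integrable fun u : AddCircle L => (4 * Real.pi * ‖u‖)⁻¹ • (fourier n u - 1) := by
  have hmeas : Measurable fun u : AddCircle L => (4 * Real.pi * ‖u‖)⁻¹ • (fourier n u - 1) :=
    (measurable_norm.const_mul _).inv.smul ((map_continuous (fourier n)).measurable.sub_const 1)
  refine Integrable.of_bound hmeas.aestronglyMeasurable
    ((4 * Real.pi)⁻¹ * (2 * Real.pi * |(n : ℝ)| / |L|)) (Eventually.of_forall fun u => ?_)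
  rcases eq_or_ne u 0 with rfl | hu
  · rw [fourier_eval_zero, sub_self, smul_zero, norm_zero]
    positivity
  have hu' : 0 < ‖u‖ := norm_pos_iff.2 hu
  rw [norm_smul, Real.norm_of_nonneg (by positivity), mul_inv, mul_assoc]
  gcongr
  rw [inv_mul_le_iff₀ hu', mul_comm]
  exact norm_fourier_sub_one_le n u

theorem integral_inv_norm_smul_fourier_sub_one (n : ℤ) :
    ∫ u : AddCircle L, (4 * Real.pi * ‖u‖)⁻¹ • (fourier n u - 1) =
      ((∫ u : AddCircle L,
        (Real.cos (2 * Real.pi * n * ‖u‖ / L) - 1) / (4 * Real.pi * ‖u‖) : ℝ) : ℂ) := by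
  set g : AddCircle L → ℂ := fun u => (4 * Real.pi * ‖u‖)⁻¹ • (fourier n u - 1) with hg
  have hconj (u : AddCircle L) : starRingEnd ℂ (g (-u)) = g u := by
    rw [hg, RCLike.conj_smul, map_sub, map_one, ← fourier_neg, fourier_neg_apply_neg, norm_neg]
  have hreal : starRingEnd ℂ (∫ u, g u) = ∫ u, g u := by
    rw [← integral_conj, ← integral_neg_eq_self]
    simp only [hconj]
  rw [← Complex.conj_eq_iff_re.1 hreal]
  congr 1
  calc (∫ u, g u).re = ∫ u, (g u).re :=
        (integral_re (integrable_inv_norm_smul_fourier_sub_one n)).symm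
    _ = _ := by
        simp only [hg, Complex.smul_re, Complex.sub_re, Complex.one_re, re_fourier, smul_eq_mul,
          inv_mul_eq_div]

end Fourier

section InnerProduct

variable {𝕜 X : Type*} [RCLike 𝕜] [MeasurableSpace X] {μ : Measure X}

theorem inner_eq_integral_of_ae_eq {f g : Lp 𝕜 2 μ} {F G : X → 𝕜} (hf : f =ᵐ[μ] F)
    (hg : g =ᵐ[μ] G) : ⟪f, g⟫_𝕜 = ∫ x, ⟪F x, G x⟫_𝕜 ∂μ := by
  rw [L2.inner_def]
  exact integral_congr_ae (by filter_upwards [hf, hg] with x hx hx'; rw [hx, hx'])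

theorem integrable_inner_of_memLp_two {F G : X → 𝕜} (hF : MemLp F 2 μ) (hG : MemLp G 2 μ) :
    Integrable (fun x => ⟪F x, G x⟫_𝕜) μ := by
  refine (L2.integrable_inner (𝕜 := 𝕜) (hF.toLp F) (hG.toLp G)).congr ?_
  filter_upwards [hF.coeFn_toLp, hG.coeFn_toLp] with x hx hx'
  rw [hx, hx']

theorem integral_integral_eq_zero_of_antisymmetric [SFinite μ] {D : X → X → 𝕜}
    (hD : Integrable (Function.uncurry D) (μ.prod μ)) (hanti : ∀ x y, D y x = -D x y) :
    ∫ x, ∫ y, D x y ∂μ ∂μ = 0 := by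
  refine self_eq_neg.1 ?_
  calc ∫ x, ∫ y, D x y ∂μ ∂μ = ∫ y, ∫ x, D x y ∂μ ∂μ := integral_integral_swap hD
    _ = -∫ x, ∫ y, D x y ∂μ ∂μ := by
      rw [← integral_neg]
      simp only [← integral_neg, ← hanti]

end InnerProduct

namespace ClosedCurve

section Symmetry

variable {C : ClosedCurve} {f h : C.carrier → ℂ}

theorem IsLip.integrable_inner_arcIntegrand (hf : C.IsLip f) (hh : C.IsLip h) :
    Integrable (Function.uncurry fun x y => ⟪f x, C.arcIntegrand h x y⟫_ℂ)
      (C.arcLength.prod C.arcLength) := by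
  obtain ⟨K, hK⟩ := hh.exists_norm_arcIntegrand_le
  obtain ⟨M, hM⟩ := isCompact_univ.exists_bound_of_continuousOn hf.continuous.continuousOn
  refine Integrable.of_bound ((hf.continuous.measurable.comp measurable_fst).inner
    hh.measurable_arcIntegrand).aestronglyMeasurable (M * K) (Eventually.of_forall fun p => ?_)
  have hfM := hM p.1 (mem_univ _)
  exact (norm_inner_le_norm _ _).trans
    (mul_le_mul hfM (hK p.1 p.2) (norm_nonneg _) ((norm_nonneg _).trans hfM))

theorem IsLip.integral_inner_arcRegularization (hf : C.IsLip f) (hh : C.IsLip h) :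
    ∫ x, ⟪f x, C.arcRegularization h x⟫_ℂ ∂C.arcLength =
      ∫ x, ⟪C.arcRegularization f x, h x⟫_ℂ ∂C.arcLength := by
  set D : C.carrier → C.carrier → ℂ :=
    fun x y => ⟪f x, C.arcIntegrand h x y⟫_ℂ - ⟪C.arcIntegrand f x y, h x⟫_ℂ with hD
  have hright : Integrable (Function.uncurry fun x y => ⟪C.arcIntegrand f x y, h x⟫_ℂ)
      (C.arcLength.prod C.arcLength) := by
    refine (RCLike.conjLIE.toContinuousLinearEquiv.toContinuousLinearMap.integrable_comp
      (hh.integrable_inner_arcIntegrand hf)).congr (Eventually.of_forall fun p => ?_)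
    exact inner_conj_symm _ _
  have hanti (x y : C.carrier) : D y x = -D x y := by
    simp only [hD, arcIntegrand, C.arcDist_comm y x, inner_smul_right_eq_smul,
      inner_smul_left_eq_smul, inner_sub_left, inner_sub_right, smul_sub]
    abel
  have hpoint (x : C.carrier) : ⟪f x, C.arcRegularization h x⟫_ℂ -
      ⟪C.arcRegularization f x, h x⟫_ℂ = ∫ y, D x y ∂C.arcLength := by
    have hconj : ∫ y, ⟪C.arcIntegrand f x y, h x⟫_ℂ ∂C.arcLength =
        ⟪∫ y, C.arcIntegrand f x y ∂C.arcLength, h x⟫_ℂ := by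
      simp only [← inner_conj_symm _ (h x)]
      rw [integral_conj, integral_inner (hf.integrable_arcIntegrand x)]
    rw [hD, integral_sub ((hh.integrable_arcIntegrand x).const_inner _)
      ((hf.integrable_arcIntegrand x).inner_const _), hconj,
      integral_inner (hh.integrable_arcIntegrand x), arcRegularization, arcRegularization,
      inner_add_left, inner_add_right, inner_smul_left_eq_smul, inner_smul_right_eq_smul]
    abel
  rw [← sub_eq_zero,
    ← integral_sub (integrable_inner_of_memLp_two hf.memLp hh.memLp_arcRegularization)
    (integrable_inner_of_memLp_two hf.memLp_arcRegularization hh.memLp),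
    integral_congr_ae (ae_of_all _ hpoint)]
  exact integral_integral_eq_zero_of_antisymmetric
    ((hf.integrable_inner_arcIntegrand hh).sub hright) hanti

end Symmetry

variable (C : ClosedCurve)

/-- The `n`-th normalized Fourier mode on the curve. -/
noncomputable def mode (n : ℤ) (x : C.carrier) : ℂ := (√C.len)⁻¹ • fourier n (C.homeo.symm x)

theorem mode_homeo (n : ℤ) (p : AddCircle C.len) :
    C.mode n (C.homeo p) = (√C.len)⁻¹ • fourier n p := by
  rw [mode, Homeomorph.symm_apply_apply]

theorem isLip_mode (n : ℤ) : C.IsLip (C.mode n) := by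
  obtain ⟨c, hc, hcd⟩ := C.exists_mul_arcDist_le_dist
  refine ⟨((√C.len)⁻¹ * (2 * Real.pi * |(n : ℝ)| / |C.len| * c⁻¹)).toNNReal,
    LipschitzWith.of_dist_le_mul fun y x => ?_⟩
  rw [Real.coe_toNNReal _ (by positivity), dist_eq_norm, mode, mode, ← smul_sub, norm_smul,
    Real.norm_of_nonneg (by positivity), mul_assoc, mul_assoc]
  gcongr
  refine (norm_fourier_sub_le n _ _).trans ?_
  gcongr
  rw [inv_mul_eq_div, le_div_iff₀ hc, mul_comm, dist_comm]
  exact hcd x y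

theorem arcRegularization_mode (n : ℤ) :
    C.arcRegularization (C.mode n) = (C.multiplier n : ℂ) • C.mode n := by
  ext x
  obtain ⟨p, rfl⟩ := C.homeo.surjective x
  have hintegrand (u : AddCircle C.len) :
      C.arcIntegrand (C.mode n) (C.homeo p) (C.homeo (p + u)) =
        C.mode n (C.homeo p) * (4 * Real.pi * ‖u‖)⁻¹ • (fourier n u - 1) := by
    rw [arcIntegrand, arcDist_homeo, add_sub_cancel_left, mode_homeo, mode_homeo,
      fourier_apply_add, mul_smul_comm, mul_sub_one, smul_mul_assoc]
  rw [arcRegularization, integral_arcLength, ← integral_add_left_eq_self _ p]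
  simp only [hintegrand]
  rw [integral_const_mul, integral_inv_norm_smul_fourier_sub_one, multiplier, Pi.smul_apply,
    Complex.real_smul, smul_eq_mul]
  push_cast
  ring

/-- The Fourier modes as elements of `L²(Σ)`. -/
noncomputable def modeL2 (n : ℤ) : C.L2 := (C.isLip_mode n).memLp.toLp (C.mode n)

theorem coeFn_modeL2 (n : ℤ) : C.modeL2 n =ᵐ[C.arcLength] C.mode n := MemLp.coeFn_toLp _

theorem inner_modeL2 (n : ℤ) {f : C.L2} {h : C.carrier → ℂ} (hf : f =ᵐ[C.arcLength] h) :
    ⟪C.modeL2 n, f⟫_ℂ = √C.len • fourierCoeff (fun p => h (C.homeo p)) n := by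
  have hroot : (√C.len)⁻¹ = √C.len * C.len⁻¹ := by
    rw [← div_eq_mul_inv, Real.sqrt_div_self']
    exact (one_div _).symm
  rw [inner_eq_integral_of_ae_eq (C.coeFn_modeL2 n) hf, integral_arcLength, fourierCoeff,
    AddCircle.integral_haarAddCircle, smul_smul, ← hroot, ← integral_smul]
  simp only [mode_homeo, RCLike.inner_apply', RCLike.conj_smul, fourier_neg, smul_eq_mul,
    smul_mul_assoc]

theorem orthonormal_modeL2 : Orthonormal ℂ C.modeL2 := by
  rw [orthonormal_iff_ite]
  intro m n
  rw [C.inner_modeL2 m (C.coeFn_modeL2 n)]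
  have hroot : √C.len ≠ 0 := (Real.sqrt_pos.2 C.len_pos).ne'
  have hmode : (fun p => C.mode n (C.homeo p)) =
      (((√C.len)⁻¹ : ℝ) : ℂ) • (fourier n : AddCircle C.len → ℂ) := by
    ext p
    rw [mode_homeo, Complex.real_smul, Pi.smul_apply, smul_eq_mul]
  rw [hmode, fourierCoeff.const_smul, fourierCoeff_fourier, Complex.real_smul, smul_eq_mul,
    ← mul_assoc, ← Complex.ofReal_mul, mul_inv_cancel₀ hroot, Complex.ofReal_one, one_mul]
  simp only [Pi.single_apply]

theorem eq_zero_of_inner_modeL2_eq_zero {f : C.L2} (hf : ∀ n, ⟪C.modeL2 n, f⟫_ℂ = 0) :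
    f = 0 := by
  have hroot : √C.len ≠ 0 := (Real.sqrt_pos.2 C.len_pos).ne'
  have hmem : MemLp (fun p => f (C.homeo p)) 2 AddCircle.haarAddCircle :=
    memLp_haarAddCircle_iff.2 ((Lp.memLp f).comp_measurePreserving C.measurePreserving_homeo)
  have hhaar := ae_eq_zero_of_fourierCoeff_eq_zero hmem fun n =>
    (smul_eq_zero.1 ((C.inner_modeL2 n (ae_eq_refl f)).symm.trans (hf n))).resolve_left hroot
  have hvol : ∀ᵐ p ∂(volume : Measure (AddCircle C.len)), f (C.homeo p) = 0 :=
    Measure.ae_smul_measure hhaar _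
  have hmap : ∀ᵐ x ∂(volume.map C.homeo), f x = 0 :=
    C.homeo.measurableEmbedding.ae_map_iff.2 hvol
  rw [← arcLength_eq_map] at hmap
  exact Lp.ext (EventuallyEq.trans hmap (Lp.coeFn_zero _ _ _).symm)

/-- The Fourier basis of `L²(Σ)`. -/
noncomputable def modeBasis : HilbertBasis ℤ ℂ C.L2 :=
  HilbertBasis.mkOfOrthogonalEqBot C.orthonormal_modeL2 <| (Submodule.eq_bot_iff _).2 fun _ hf =>
    C.eq_zero_of_inner_modeL2_eq_zero fun n =>
      (Submodule.mem_orthogonal _ _).1 hf _ (Submodule.subset_span ⟨n, rfl⟩)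

theorem modeBasis_apply (n : ℤ) : C.modeBasis n = C.modeL2 n :=
  congrFun (HilbertBasis.coe_mkOfOrthogonalEqBot _ _) n

theorem graph_B_le_diagGraph (lam : ℝ) :
    (C.B lam).graph ≤ diagGraph C.modeBasis C.multiplier (C.remainderOp lam) := by
  rintro ⟨f, g⟩ hfg
  obtain ⟨h, hh, hf, hg⟩ := mem_graph_B_iff.1 hfg
  have hdiff : (g - C.remainderOp lam f : C.L2) =ᵐ[C.arcLength] C.arcRegularization h := by
    have hrem := coeFn_kernelOp (C.isBoundedKernel_remainderKernel lam) f
    rw [kernelFun_congr hf] at hrem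
    filter_upwards [hg, hrem, Lp.coeFn_sub g (C.remainderOp lam f)] with x hgx hrx hsub
    rw [hsub, Pi.sub_apply, hgx, remainderOp, hrx, Pi.add_apply, add_sub_cancel_right]
  refine mem_diagGraph_iff_sub.2 fun n => ?_
  rw [modeBasis_apply, inner_eq_integral_of_ae_eq (C.coeFn_modeL2 n) hdiff,
    (C.isLip_mode n).integral_inner_arcRegularization hh, arcRegularization_mode,
    inner_eq_integral_of_ae_eq (C.coeFn_modeL2 n) hf, ← integral_const_mul]
  simp only [Pi.smul_apply, inner_smul_left, Complex.conj_ofReal]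
  rfl

theorem modeBasis_mem_domain_B (lam : ℝ) (n : ℤ) : C.modeBasis n ∈ (C.B lam).domain := by
  rw [modeBasis_apply]
  exact LinearPMap.mem_domain_of_mem_graph ((C.isLip_mode n).toLp_mem_graph_B lam)

theorem closure_graph_B (lam : ℝ) : (C.B lam).closure.graph =
    diagGraph C.modeBasis C.multiplier (C.remainderOp lam) :=
  closure_graph_eq_diagGraph (C.graph_B_le_diagGraph lam) (C.modeBasis_mem_domain_B lam)

end ClosedCurve

/-! ### Positivity of the kernel differences -/

section Subordination

/-- The positive solution `u` of `a * u - b / u = v`. -/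
noncomputable def schlomilchRoot (a b v : ℝ) : ℝ := (v + √(v ^ 2 + 4 * a * b)) / (2 * a)

variable {a b c r : ℝ}

theorem schlomilchRoot_pos (ha : 0 < a) (hb : 0 < b) (v : ℝ) : 0 < schlomilchRoot a b v := by
  have habs : |v| < √(v ^ 2 + 4 * a * b) := by
    rw [← Real.sqrt_sq_eq_abs]
    exact Real.sqrt_lt_sqrt (sq_nonneg v) (lt_add_of_pos_right _ (by positivity))
  exact div_pos (by linarith [neg_abs_le v]) (by positivity)

theorem schlomilchRoot_sub_div (ha : 0 < a) (hb : 0 < b) (v : ℝ) :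
    a * schlomilchRoot a b v - b / schlomilchRoot a b v = v := by
  have hpos := schlomilchRoot_pos ha hb v
  have hsq := Real.sq_sqrt (show 0 ≤ v ^ 2 + 4 * a * b by positivity)
  have hroot : 2 * a * schlomilchRoot a b v - v = √(v ^ 2 + 4 * a * b) := by
    rw [schlomilchRoot]
    field_simp
    ring
  rw [← hroot] at hsq
  field_simp
  nlinarith

theorem strictMonoOn_mul_sub_div (ha : 0 < a) (hb : 0 < b) :
    StrictMonoOn (fun u => a * u - b / u) (Ioi 0) := fun u hu v _ huv => by
  have hu' : 0 < u := hu
  simp only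
  gcongr

theorem schlomilchRoot_mul_sub_div (ha : 0 < a) (hb : 0 < b) {u : ℝ} (hu : 0 < u) :
    schlomilchRoot a b (a * u - b / u) = u :=
  (strictMonoOn_mul_sub_div ha hb).injOn (schlomilchRoot_pos ha hb _) hu
    (schlomilchRoot_sub_div ha hb _)

theorem range_schlomilchRoot (ha : 0 < a) (hb : 0 < b) : range (schlomilchRoot a b) = Ioi 0 :=
  Subset.antisymm (range_subset_iff.2 (schlomilchRoot_pos ha hb)) fun _ hu =>
    ⟨_, schlomilchRoot_mul_sub_div ha hb hu⟩

theorem hasDerivAt_schlomilchRoot (ha : 0 < a) (hb : 0 < b) (v : ℝ) :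
    HasDerivAt (schlomilchRoot a b) ((2 * a)⁻¹ * (1 + v / √(v ^ 2 + 4 * a * b))) v := by
  have hrad : v ^ 2 + 4 * a * b ≠ 0 := by positivity
  have hsqrt : HasDerivAt (fun v => √(v ^ 2 + 4 * a * b))
      (2 * v / (2 * √(v ^ 2 + 4 * a * b))) v := by
    simpa using ((hasDerivAt_pow 2 v).add_const (4 * a * b)).sqrt hrad
  refine (((hasDerivAt_id v).add hsqrt).div_const (2 * a)).congr_deriv ?_
  field_simp

theorem abs_div_sqrt_sq_add_le (hc : 0 ≤ c) (v : ℝ) : |v / √(v ^ 2 + c)| ≤ 1 := by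
  rw [abs_div, abs_of_nonneg (Real.sqrt_nonneg _)]
  refine div_le_one_of_le₀ ?_ (Real.sqrt_nonneg _)
  rw [← Real.sqrt_sq_eq_abs]
  exact Real.sqrt_le_sqrt (le_add_of_nonneg_right hc)

/-- Cauchy–Schlömilch: the substitution `u = schlomilchRoot a b v` has derivative
`(1 + v / √(v² + 4 a b)) / (2 a)`, whose odd part integrates to zero against the even `g`. -/
theorem integrableOn_and_integral_comp_mul_sub_div {g : ℝ → ℝ} (hg : Integrable g)
    (heven : ∀ v, g (-v) = g v) (ha : 0 < a) (hb : 0 < b) :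
    IntegrableOn (fun u => g (a * u - b / u)) (Ioi 0) ∧
      ∫ u in Ioi 0, g (a * u - b / u) = (2 * a)⁻¹ * ∫ v, g v := by
  set q : ℝ → ℝ := fun v => v / √(v ^ 2 + 4 * a * b) with hq
  have hqle (v : ℝ) : |q v| ≤ 1 := abs_div_sqrt_sq_add_le (by positivity) v
  have hqg : Integrable fun v => q v * g v :=
    hg.bdd_mul (c := 1) (by fun_prop) (Eventually.of_forall hqle)
  have hodd : ∫ v, q v * g v = 0 := by
    refine self_eq_neg.1 ?_
    rw [← integral_neg, ← integral_neg_eq_self]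
    simp only [hq, heven, neg_sq, neg_div, neg_mul]
  have hsubst (v : ℝ) : |(2 * a)⁻¹ * (1 + q v)| •
      g (a * schlomilchRoot a b v - b / schlomilchRoot a b v) = (2 * a)⁻¹ * (g v + q v * g v) := by
    have hnonneg : 0 ≤ 1 + q v := by linarith [neg_abs_le (q v), hqle v]
    rw [schlomilchRoot_sub_div ha hb, abs_of_nonneg (by positivity), smul_eq_mul]
    ring
  have hderiv (v : ℝ) (_ : v ∈ univ) :
      HasDerivWithinAt (schlomilchRoot a b) ((2 * a)⁻¹ * (1 + q v)) univ v :=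
    (hasDerivAt_schlomilchRoot ha hb v).hasDerivWithinAt
  have hinj : InjOn (schlomilchRoot a b) univ :=
    (Function.LeftInverse.injective (g := fun u => a * u - b / u)
      (schlomilchRoot_sub_div ha hb)).injOn
  rw [← range_schlomilchRoot ha hb, ← image_univ, integral_image_eq_integral_abs_deriv_smul
    .univ hderiv hinj, integrableOn_image_iff_integrableOn_abs_deriv_smul .univ hderiv hinj]
  simp only [hsubst, integrableOn_univ, setIntegral_univ]
  exact ⟨(hg.add hqg).const_mul _, by rw [integral_const_mul, integral_add hg hqg, hodd, add_zero]⟩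

theorem integrableOn_and_integral_exp_mul_exp (ha : 0 ≤ a) (hr : 0 < r) :
    IntegrableOn (fun u => Real.exp (-(a / 2 / u) ^ 2) * Real.exp (-u ^ 2 * r ^ 2)) (Ioi 0) ∧
      ∫ u in Ioi 0, Real.exp (-(a / 2 / u) ^ 2) * Real.exp (-u ^ 2 * r ^ 2) =
        √Real.pi / 2 * (Real.exp (-a * r) / r) := by
  rcases ha.eq_or_lt with rfl | ha
  · have hgauss (u : ℝ) : Real.exp (-(0 / 2 / u) ^ 2) * Real.exp (-u ^ 2 * r ^ 2) =
        Real.exp (-r ^ 2 * u ^ 2) := by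
      rw [← Real.exp_add]
      ring_nf
    simp only [hgauss, neg_zero, zero_mul, Real.exp_zero]
    refine ⟨(integrable_exp_neg_mul_sq (by positivity)).integrableOn, ?_⟩
    rw [integral_gaussian_Ioi, Real.sqrt_div Real.pi_pos.le, Real.sqrt_sq hr.le]
    ring
  have hsquare : EqOn (fun u => Real.exp (-a * r) * Real.exp (-(r * u - a / 2 / u) ^ 2))
      (fun u => Real.exp (-(a / 2 / u) ^ 2) * Real.exp (-u ^ 2 * r ^ 2)) (Ioi 0) := fun u hu => by
    have hu' : u ≠ 0 := ne_of_gt hu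
    simp only [← Real.exp_add]
    congr 1
    field_simp
    ring
  have hgauss : Integrable fun v : ℝ => Real.exp (-v ^ 2) := by
    simpa using integrable_exp_neg_mul_sq one_pos
  obtain ⟨hint, heq⟩ := integrableOn_and_integral_comp_mul_sub_div hgauss (by simp) hr (half_pos ha)
  refine ⟨IntegrableOn.congr_fun (hint.const_mul _) hsquare measurableSet_Ioi, ?_⟩
  have hvalue : ∫ v : ℝ, Real.exp (-v ^ 2) = √Real.pi := by simpa using integral_gaussian 1
  rw [← setIntegral_congr_fun measurableSet_Ioi hsquare, integral_const_mul, heq, hvalue]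
  field_simp

/-- The density in `u` of `(exp (-a r) - exp (-b r)) / r` as a mixture of the Gaussians
`exp (-u² r²)`. -/
noncomputable def yukawaWeight (a b u : ℝ) : ℝ :=
  Real.exp (-(a / 2 / u) ^ 2) - Real.exp (-(b / 2 / u) ^ 2)

theorem integral_yukawaWeight_mul_exp (ha : 0 ≤ a) (hb : 0 ≤ b) (hr : 0 < r) :
    ∫ u in Ioi 0, yukawaWeight a b u * Real.exp (-u ^ 2 * r ^ 2) =
      √Real.pi / 2 * ((Real.exp (-a * r) - Real.exp (-b * r)) / r) := by
  obtain ⟨hint, heq⟩ := integrableOn_and_integral_exp_mul_exp ha hr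
  obtain ⟨hint', heq'⟩ := integrableOn_and_integral_exp_mul_exp hb hr
  simp only [yukawaWeight, sub_mul]
  rw [integral_sub hint hint', heq, heq']
  ring

theorem yukawaWeight_pos (ha : 0 ≤ a) (hab : a < b) {u : ℝ} (hu : 0 < u) :
    0 < yukawaWeight a b u := by
  have hlt : a / 2 / u < b / 2 / u := by gcongr
  have hnonneg : 0 ≤ a / 2 / u := by positivity
  exact sub_pos.2 (Real.exp_lt_exp.2 (by nlinarith))

theorem integrableOn_yukawaWeight (ha : 0 ≤ a) (hab : a < b) :
    IntegrableOn (yukawaWeight a b) (Ioi 0) := by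
  have hmeas : Measurable (yukawaWeight a b) := by
    unfold yukawaWeight
    fun_prop
  have hle (u : ℝ) : yukawaWeight a b u ≤ 1 - Real.exp (-(b / 2 / u) ^ 2) :=
    sub_le_sub_right (Real.exp_le_one_iff.2 (neg_nonpos.2 (sq_nonneg _))) _
  rw [← Ioc_union_Ioi_eq_Ioi zero_le_one, integrableOn_union]
  constructor
  · refine Measure.integrableOn_of_bounded (M := 1) (by simp) hmeas.aestronglyMeasurable ?_
    filter_upwards [ae_restrict_mem measurableSet_Ioc] with u hu
    rw [Real.norm_of_nonneg (yukawaWeight_pos ha hab hu.1).le]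
    exact (hle u).trans (sub_le_self _ (Real.exp_pos _).le)
  · have hdom : IntegrableOn (fun u : ℝ => (b / 2) ^ 2 * u ^ (-2 : ℝ)) (Ioi 1) :=
      (integrableOn_Ioi_rpow_of_lt (by norm_num) one_pos).const_mul _
    refine hdom.mono' hmeas.aestronglyMeasurable ?_
    filter_upwards [ae_restrict_mem measurableSet_Ioi] with u hu
    have hu' : 0 < u := one_pos.trans hu
    rw [Real.norm_of_nonneg (yukawaWeight_pos ha hab hu').le, Real.rpow_neg hu'.le,
      Real.rpow_two, ← div_eq_mul_inv, ← div_pow]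
    linarith [hle u, Real.add_one_le_exp (-(b / 2 / u) ^ 2)]

end Subordination

section PositiveDefinite

variable {X E : Type*} [MeasurableSpace X] {μ : Measure X} [NormedAddCommGroup E]
  [InnerProductSpace ℝ E] {j : X → E} {f : X → ℂ}

/-- The characteristic function of the pushforward under `j` of the complex measure `f • μ`. -/
noncomputable def densityCharFun (μ : Measure X) (j : X → E) (f : X → ℂ) (v : E) : ℂ :=
  ∫ x, f x * Complex.exp (⟪j x, v⟫_ℝ * Complex.I) ∂μ

theorem densityCharFun_conj (v : E) :
    densityCharFun μ j (fun x => starRingEnd ℂ (f x)) v =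
      starRingEnd ℂ (densityCharFun μ j f (-v)) := by
  rw [densityCharFun, densityCharFun, ← integral_conj]
  simp only [map_mul, ← Complex.exp_conj, Complex.conj_ofReal, Complex.conj_I, inner_neg_right,
    mul_neg, Complex.ofReal_neg, map_neg, neg_mul, neg_neg]

theorem densityCharFun_const_mul (c : ℂ) (v : E) :
    densityCharFun μ j (fun x => c * f x) v = c * densityCharFun μ j f v := by
  simp only [densityCharFun, mul_assoc, integral_const_mul]

theorem norm_densityCharFun_le (v : E) : ‖densityCharFun μ j f v‖ ≤ ∫ x, ‖f x‖ ∂μ := by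
  refine (norm_integral_le_integral_norm _).trans_eq ?_
  simp only [norm_mul, Complex.norm_exp_ofReal_mul_I, mul_one]

variable [MeasurableSpace E]

theorem charFun_sub_mul_inner {κ : Measure E} (x y : E) (a b : ℂ) :
    charFun κ (y - x) * ⟪a, b⟫_ℂ = ∫ v, starRingEnd ℂ (a * Complex.exp (⟪x, v⟫_ℝ * Complex.I)) *
      (b * Complex.exp (⟪y, v⟫_ℝ * Complex.I)) ∂κ := by
  rw [charFun_apply, ← integral_mul_const]
  congr 1 with v
  rw [RCLike.inner_apply, map_mul, ← Complex.exp_conj, inner_sub_right, real_inner_comm x,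
    real_inner_comm y, map_mul, Complex.conj_ofReal, Complex.conj_I, Complex.ofReal_sub, sub_mul,
    Complex.exp_sub, mul_neg, Complex.exp_neg]
  ring

variable [BorelSpace E] [SecondCountableTopology E]

theorem integrable_mul_exp_inner_mul_I (hj : Measurable j) (hf : Integrable f μ) (v : E) :
    Integrable (fun x => f x * Complex.exp (⟪j x, v⟫_ℝ * Complex.I)) μ :=
  hf.mul_bdd (c := 1) (by fun_prop)
    (Eventually.of_forall fun _ => (Complex.norm_exp_ofReal_mul_I _).le)

theorem densityCharFun_add {g : X → ℂ} (hj : Measurable j) (hf : Integrable f μ)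
    (hg : Integrable g μ) (v : E) :
    densityCharFun μ j (fun x => f x + g x) v =
      densityCharFun μ j f v + densityCharFun μ j g v := by
  simp only [densityCharFun, add_mul]
  exact integral_add (integrable_mul_exp_inner_mul_I hj hf v)
    (integrable_mul_exp_inner_mul_I hj hg v)

theorem continuous_densityCharFun (hj : Measurable j) (hf : Integrable f μ) :
    Continuous (densityCharFun μ j f) := by
  refine continuous_of_dominated (bound := fun x => ‖f x‖)
    (fun v => (integrable_mul_exp_inner_mul_I hj hf v).aestronglyMeasurable)
    (fun v => Eventually.of_forall fun x => ?_) hf.norm (Eventually.of_forall fun x => by fun_prop)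
  rw [norm_mul, Complex.norm_exp_ofReal_mul_I, mul_one]

theorem integrable_sq_norm_densityCharFun {κ : Measure E} [IsFiniteMeasure κ]
    (hj : Measurable j) (hf : Integrable f μ) :
    Integrable (fun v => ‖densityCharFun μ j f v‖ ^ 2) κ := by
  refine Integrable.of_bound
    ((continuous_densityCharFun hj hf).norm.pow 2).aestronglyMeasurable ((∫ x, ‖f x‖ ∂μ) ^ 2)
    (Eventually.of_forall fun v => ?_)
  rw [norm_pow, norm_norm]
  exact pow_le_pow_left₀ (norm_nonneg _) (norm_densityCharFun_le v) 2

theorem charFun_map_withDensity_ofReal (hj : Measurable j) {w : X → ℝ} (hw : Integrable w μ)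
    (v : E) :
    charFun ((μ.withDensity fun x => ENNReal.ofReal (w x)).map j) v =
      densityCharFun μ j (fun x => (max (w x) 0 : ℝ)) v := by
  rw [charFun_apply, integral_map hj.aemeasurable (by fun_prop),
    integral_withDensity_eq_integral_toReal_smul₀ hw.aemeasurable.ennreal_ofReal (by simp),
    densityCharFun]
  simp only [ENNReal.toReal_ofReal', Complex.real_smul, mul_comm]

theorem ae_eq_zero_of_densityCharFun_ofReal_eq_zero [CompleteSpace E] (hj : MeasurableEmbedding j)
    {w : X → ℝ} (hw : Integrable w μ) (h : ∀ v, densityCharFun μ j (fun x => (w x : ℂ)) v = 0) :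
    w =ᵐ[μ] 0 := by
  have hfin := isFiniteMeasure_withDensity_ofReal hw.2
  have hfin' := isFiniteMeasure_withDensity_ofReal hw.neg.2
  have hpos : Integrable (fun x => ((max (w x) 0 : ℝ) : ℂ)) μ := hw.pos_part.ofReal
  have hneg : Integrable (fun x => ((max (-w x) 0 : ℝ) : ℂ)) μ := hw.neg_part.ofReal
  have hmap : (μ.withDensity fun x => ENNReal.ofReal (w x)).map j =
      (μ.withDensity fun x => ENNReal.ofReal ((-w) x)).map j := by
    refine Measure.ext_of_charFun (funext fun v => ?_)
    rw [charFun_map_withDensity_ofReal hj.measurable hw,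
      charFun_map_withDensity_ofReal hj.measurable hw.neg, ← sub_eq_zero, ← h v, densityCharFun,
      densityCharFun]
    simp only [Pi.neg_apply]
    rw [← integral_sub (integrable_mul_exp_inner_mul_I hj.measurable hpos v)
      (integrable_mul_exp_inner_mul_I hj.measurable hneg v)]
    simp only [← sub_mul, ← Complex.ofReal_sub, max_zero_sub_max_neg_zero_eq_self, densityCharFun]
  have hdensity := congrArg (Measure.comap j) hmap
  rw [hj.comap_map, hj.comap_map, withDensity_eq_iff hw.aemeasurable.ennreal_ofReal
    hw.neg.aemeasurable.ennreal_ofReal hw.lintegral_lt_top.ne] at hdensity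
  filter_upwards [hdensity] with x hx
  have hmax : max (w x) 0 = max (-w x) 0 := congrArg ENNReal.toReal hx
  rw [← max_zero_sub_max_neg_zero_eq_self (w x), hmax, sub_self, Pi.zero_apply]

theorem ae_eq_zero_of_densityCharFun_eq_zero [CompleteSpace E] (hj : MeasurableEmbedding j)
    (hf : Integrable f μ) (h : ∀ v, densityCharFun μ j f v = 0) : f =ᵐ[μ] 0 := by
  have hconj : Integrable (fun x => starRingEnd ℂ (f x)) μ :=
    RCLike.conjLIE.toContinuousLinearEquiv.toContinuousLinearMap.integrable_comp hf
  have hcomb (a b : ℂ) (v : E) :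
      densityCharFun μ j (fun x => a * f x + b * starRingEnd ℂ (f x)) v = 0 := by
    rw [densityCharFun_add hj.measurable (hf.const_mul a) (hconj.const_mul b),
      densityCharFun_const_mul, densityCharFun_const_mul, densityCharFun_conj, h, h, map_zero,
      mul_zero, mul_zero, add_zero]
  have hre : (fun x => (f x).re) =ᵐ[μ] 0 := by
    refine ae_eq_zero_of_densityCharFun_ofReal_eq_zero hj hf.re fun v => ?_
    rw [← hcomb (1 / 2) (1 / 2) v]
    congr 1 with x
    rw [Complex.re_eq_add_conj]
    ring
  have him : (fun x => (f x).im) =ᵐ[μ] 0 := by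
    refine ae_eq_zero_of_densityCharFun_ofReal_eq_zero hj hf.im fun v => ?_
    rw [← hcomb (-Complex.I / 2) (Complex.I / 2) v]
    congr 1 with x
    rw [Complex.im_eq_sub_conj]
    field_simp
    simp only [Complex.I_sq]
    ring
  filter_upwards [hre, him] with x hx hx'
  exact Complex.ext hx hx'

theorem integrable_conj_mul_exp_inner_mul_I_mul {κ : Measure E} [IsFiniteMeasure κ]
    (hj : Measurable j) (hf : Integrable f μ) :
    Integrable (fun p : (X × X) × E =>
      starRingEnd ℂ (f p.1.1 * Complex.exp (⟪j p.1.1, p.2⟫_ℝ * Complex.I)) *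
        (f p.1.2 * Complex.exp (⟪j p.1.2, p.2⟫_ℝ * Complex.I))) ((μ.prod μ).prod κ) := by
  have hconj : Integrable (fun x => starRingEnd ℂ (f x)) μ :=
    RCLike.conjLIE.toContinuousLinearEquiv.toContinuousLinearMap.integrable_comp hf
  have hprod : Integrable (fun p : (X × X) × E => starRingEnd ℂ (f p.1.1) * f p.1.2)
      ((μ.prod μ).prod κ) := (hconj.mul_prod hf).comp_fst κ
  have hexp : Measurable fun p : X × E => Complex.exp (⟪j p.1, p.2⟫_ℝ * Complex.I) := by fun_prop
  have hleft : Measurable fun p : (X × X) × E => (p.1.1, p.2) := by fun_prop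
  have hright : Measurable fun p : (X × X) × E => (p.1.2, p.2) := by fun_prop
  refine (hprod.mul_bdd (c := 1)
    ((Complex.continuous_conj.measurable.comp (hexp.comp hleft)).mul
      (hexp.comp hright)).aestronglyMeasurable
    (Eventually.of_forall fun p => ?_)).congr (Eventually.of_forall fun p => ?_)
  · simp only [Pi.mul_apply, Function.comp_apply, norm_mul, RCLike.norm_conj,
      Complex.norm_exp_ofReal_mul_I, mul_one, le_refl]
  · simp only [Pi.mul_apply, Function.comp_apply, map_mul]
    ring

theorem integral_charFun_mul_inner [SFinite μ] {κ : Measure E} [IsFiniteMeasure κ]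
    (hj : Measurable j) (hf : Integrable f μ) :
    ∫ z, charFun κ (j z.2 - j z.1) * ⟪f z.1, f z.2⟫_ℂ ∂μ.prod μ =
      ((∫ v, ‖densityCharFun μ j f v‖ ^ 2 ∂κ : ℝ) : ℂ) := by
  simp only [charFun_sub_mul_inner]
  rw [integral_integral_swap (integrable_conj_mul_exp_inner_mul_I_mul hj hf),
    ← integral_complex_ofReal]
  congr 1 with v
  rw [integral_prod_mul
    (fun x => starRingEnd ℂ (f x * Complex.exp (⟪j x, v⟫_ℝ * Complex.I)))
    (fun x => f x * Complex.exp (⟪j x, v⟫_ℝ * Complex.I)), integral_conj, Complex.ofReal_pow]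
  exact Complex.conj_mul' _

end PositiveDefinite

section GaussianKernel

open ProbabilityTheory

instance isOpenPosMeasure_gaussianReal {m : ℝ} {v : NNReal} [NeZero v] :
    (gaussianReal m v).IsOpenPosMeasure :=
  (gaussianReal_absolutelyContinuous' m (NeZero.ne v)).isOpenPosMeasure

variable {X E : Type*} [MeasurableSpace X] {μ : Measure X} [NormedAddCommGroup E]
  [InnerProductSpace ℝ E] [FiniteDimensional ℝ E] [MeasurableSpace E] [BorelSpace E]
  {j : X → E} {f : X → ℂ}

instance isOpenPosMeasure_stdGaussian : (stdGaussian E).IsOpenPosMeasure := by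
  let b := stdOrthonormalBasis ℝ E
  rw [stdGaussian_eq_map_pi_orthonormalBasis b]
  refine Continuous.isOpenPosMeasure_map (by fun_prop) fun x => ⟨fun i => b.repr x i, ?_⟩
  exact b.sum_repr x

theorem re_integral_gaussian_mul_inner_pos [SFinite μ] (hj : MeasurableEmbedding j)
    (hf : Integrable f μ) (hf0 : ¬ f =ᵐ[μ] 0) {c : ℝ} (hc : 0 < c) :
    0 < (∫ z, (Real.exp (-c * ‖j z.2 - j z.1‖ ^ 2) : ℂ) * ⟪f z.1, f z.2⟫_ℂ ∂μ.prod μ).re := by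
  have hsc : √(2 * c) ≠ 0 := (Real.sqrt_pos.2 (by positivity)).ne'
  have hj' : MeasurableEmbedding (fun x => √(2 * c) • j x) :=
    (MeasurableEquiv.smul₀ _ hsc).measurableEmbedding.comp hj
  have hkernel (z : X × X) : (Real.exp (-c * ‖j z.2 - j z.1‖ ^ 2) : ℂ) =
      charFun (stdGaussian E) (√(2 * c) • j z.2 - √(2 * c) • j z.1) := by
    have hexp : ‖√(2 * c) • j z.2 - √(2 * c) • j z.1‖ ^ 2 / 2 = c * ‖j z.2 - j z.1‖ ^ 2 := by
      rw [← smul_sub, norm_smul, mul_pow, Real.norm_eq_abs, sq_abs, Real.sq_sqrt (by positivity)]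
      ring
    rw [charFun_stdGaussian, neg_mul, ← hexp]
    push_cast
    rw [neg_div]
  simp only [hkernel]
  rw [integral_charFun_mul_inner hj'.measurable hf, Complex.ofReal_re]
  obtain ⟨v, hv⟩ := not_forall.1 (mt (ae_eq_zero_of_densityCharFun_eq_zero hj' hf) hf0)
  refine integral_pos_of_integrable_nonneg_nonzero (x := v)
    ((continuous_densityCharFun hj'.measurable hf).norm.pow 2)
    (integrable_sq_norm_densityCharFun hj'.measurable hf) (fun _ => by positivity) ?_
  exact pow_ne_zero 2 (norm_ne_zero_iff.2 hv)

theorem integrable_gaussianMixture_mul_inner (hj : Measurable j)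
    (hf : Integrable f μ) {w : ℝ → ℝ} (hw : IntegrableOn w (Ioi 0)) :
    Integrable (Function.uncurry fun (z : X × X) (u : ℝ) =>
      ((w u * Real.exp (-u ^ 2 * ‖j z.2 - j z.1‖ ^ 2) : ℝ) : ℂ) * ⟪f z.1, f z.2⟫_ℂ)
      ((μ.prod μ).prod (volume.restrict (Ioi 0))) := by
  have hinner : Integrable (fun z : X × X => ⟪f z.1, f z.2⟫_ℂ) (μ.prod μ) :=
    hf.op_fst_snd continuous_inner ⟨1, fun a b => by
      simpa only [one_mul] using norm_inner_le_norm a b⟩ hf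
  have hweight : Integrable (fun u => (w u : ℂ)) (volume.restrict (Ioi 0)) := hw.ofReal
  have hgauss : Measurable fun p : (X × X) × ℝ =>
      (Real.exp (-p.2 ^ 2 * ‖j p.1.2 - j p.1.1‖ ^ 2) : ℂ) := by fun_prop
  refine ((hinner.mul_prod hweight).mul_bdd (c := 1) hgauss.aestronglyMeasurable
    (Eventually.of_forall fun p => ?_)).congr (Eventually.of_forall fun p => ?_)
  · rw [Complex.norm_real, Real.norm_eq_abs, Real.abs_exp, Real.exp_le_one_iff, neg_mul]
    exact neg_nonpos.2 (by positivity)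
  · simp only [Function.uncurry, Complex.ofReal_mul]
    ring

theorem re_integral_gaussianMixture_mul_inner_pos [SFinite μ] (hj : MeasurableEmbedding j)
    (hf : Integrable f μ) (hf0 : ¬ f =ᵐ[μ] 0) {w : ℝ → ℝ} (hw : IntegrableOn w (Ioi 0))
    (hw0 : ∀ u, 0 < u → 0 < w u) :
    0 < (∫ z, ((∫ u in Ioi 0, w u * Real.exp (-u ^ 2 * ‖j z.2 - j z.1‖ ^ 2) : ℝ) : ℂ) *
      ⟪f z.1, f z.2⟫_ℂ ∂μ.prod μ).re := by
  have hint := integrable_gaussianMixture_mul_inner hj.measurable hf hw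
  set G : ℝ → ℂ := fun u => ∫ z, ((w u * Real.exp (-u ^ 2 * ‖j z.2 - j z.1‖ ^ 2) : ℝ) : ℂ) *
    ⟪f z.1, f z.2⟫_ℂ ∂μ.prod μ with hG
  have hGint : IntegrableOn G (Ioi 0) := hint.integral_prod_right
  have hGpos (u : ℝ) (hu : 0 < u) : 0 < (G u).re := by
    simp only [hG, Complex.ofReal_mul, mul_assoc]
    rw [integral_const_mul, Complex.re_ofReal_mul]
    exact mul_pos (hw0 u hu) (re_integral_gaussian_mul_inner_pos hj hf hf0 (by positivity))
  have hsupport : Function.support (fun u => (G u).re) ∩ Ioi 0 = Ioi 0 :=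
    inter_eq_right.2 fun u hu => (hGpos u hu).ne'
  have hre : (∫ u in Ioi 0, G u).re = ∫ u in Ioi 0, (G u).re := (integral_re (𝕜 := ℂ) hGint).symm
  simp only [← integral_complex_ofReal, ← integral_mul_const]
  rw [integral_integral_swap hint, hre, setIntegral_pos_iff_support_of_nonneg_ae
    ((ae_restrict_mem measurableSet_Ioi).mono fun u hu => (hGpos u hu).le) hGint.re, hsupport,
    Real.volume_Ioi]
  exact ENNReal.zero_lt_top

end GaussianKernel

namespace ClosedCurve

variable (C : ClosedCurve)

instance : NullSingletonClass C.arcLength where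
  measure_singleton x := by
    have hpre : C.homeo ⁻¹' {x} = Metric.closedBall (C.homeo.symm x) 0 := by
      rw [Metric.closedBall_zero, ← C.homeo.image_symm, image_singleton]
    rw [arcLength_eq_map, Measure.map_apply C.homeo.continuous.measurable
      (measurableSet_singleton x), hpre, AddCircle.volume_closedBall, mul_zero,
      min_eq_right C.len_pos.le, ENNReal.ofReal_zero]

theorem ae_fst_ne_snd :
    ∀ᵐ z : C.carrier × C.carrier ∂C.arcLength.prod C.arcLength, z.1 ≠ z.2 := by
  refine (Measure.ae_prod_iff_ae_ae ?_).2 (ae_of_all _ fun x => ?_)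
  · exact (isClosed_eq continuous_fst continuous_snd).measurableSet.compl
  · exact ((countable_singleton x).ae_notMem _).mono fun y hy => Ne.symm hy

theorem measurableEmbedding_coe :
    MeasurableEmbedding (Subtype.val : C.carrier → EuclideanSpace ℝ (Fin 3)) :=
  MeasurableEmbedding.subtype_coe
    (isCompact_iff_compactSpace.2 inferInstance : IsCompact C.carrier).isClosed.measurableSet

theorem kernel_sub_eq_integral {x y : C.carrier} (hxy : x ≠ y) (lam mu : ℝ) :
    C.kernel mu x y - C.kernel lam x y = (2 * Real.pi * √Real.pi)⁻¹ *
      ∫ u in Ioi 0, yukawaWeight √(-mu) √(-lam) u *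
        Real.exp (-u ^ 2 * ‖(y : EuclideanSpace ℝ (Fin 3)) - x‖ ^ 2) := by
  have hdist : ‖(y : EuclideanSpace ℝ (Fin 3)) - x‖ = dist x y := by
    rw [dist_comm, Subtype.dist_eq, dist_eq_norm]
  have hpos : 0 < dist x y := dist_pos.2 hxy
  rw [hdist, integral_yukawaWeight_mul_exp (Real.sqrt_nonneg _) (Real.sqrt_nonneg _) hpos,
    kernel, kernel]
  have := Real.pi_pos
  field_simp
  ring

theorem re_inner_remainderOp_sub_pos {lam mu : ℝ} (hlm : lam < mu) (hmu : mu ≤ 0) {f : C.L2}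
    (hf : f ≠ 0) : 0 < (⟪f, (C.remainderOp mu - C.remainderOp lam) f⟫_ℂ).re := by
  have hint : Integrable f C.arcLength := (Lp.memLp f).integrable one_le_two
  have hm := (C.isBoundedKernel_remainderKernel mu).sub (C.isBoundedKernel_remainderKernel lam)
  have hab : √(-mu) < √(-lam) :=
    Real.sqrt_lt_sqrt (neg_nonneg.2 hmu) (neg_lt_neg hlm)
  have hinner : ⟪f, (C.remainderOp mu - C.remainderOp lam) f⟫_ℂ =
      ((2 * Real.pi * √Real.pi)⁻¹ : ℝ) * ∫ z : C.carrier × C.carrier,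
        ((∫ u in Ioi 0, yukawaWeight √(-mu) √(-lam) u * Real.exp
          (-u ^ 2 * ‖(z.2 : EuclideanSpace ℝ (Fin 3)) - z.1‖ ^ 2) : ℝ) : ℂ) *
            ⟪f z.1, f z.2⟫_ℂ ∂C.arcLength.prod C.arcLength := by
    rw [remainderOp, remainderOp, kernelOp_sub, inner_kernelOp,
      ← integral_prod _ (hm.integrable_prod_smul_inner hint hint), ← integral_const_mul]
    refine integral_congr_ae ?_
    filter_upwards [C.ae_fst_ne_snd] with z hz
    rw [← mul_assoc, ← Complex.ofReal_mul, ← C.kernel_sub_eq_integral hz, remainderKernel,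
      remainderKernel, sub_sub_sub_cancel_right, Complex.real_smul]
  rw [hinner, Complex.re_ofReal_mul]
  exact mul_pos (by positivity) (re_integral_gaussianMixture_mul_inner_pos
    C.measurableEmbedding_coe hint (fun h => hf ((Lp.eq_zero_iff_ae_eq_zero).2 h))
    (integrableOn_yukawaWeight (Real.sqrt_nonneg _) hab)
    fun u hu => yukawaWeight_pos (Real.sqrt_nonneg _) hab hu)

end ClosedCurve

/-! ### The Dirichlet form -/

section DirichletForm

variable {X : Type*} [MeasurableSpace X] {μ : Measure X} [SFinite μ]

theorem integral_integral_nonpos_of_add_swap_nonpos {D : X → X → ℝ}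
    (hD : Integrable (Function.uncurry D) (μ.prod μ)) (h : ∀ x y, D x y + D y x ≤ 0) :
    ∫ x, ∫ y, D x y ∂μ ∂μ ≤ 0 := by
  have hswap : ∫ p, Function.uncurry D p ∂μ.prod μ =
      ∫ p, (Function.uncurry D ∘ Prod.swap) p ∂μ.prod μ := (integral_prod_swap _).symm
  have hadd : ∫ p, (Function.uncurry D p + (Function.uncurry D ∘ Prod.swap) p) ∂μ.prod μ ≤ 0 :=
    integral_nonpos fun p => h p.1 p.2
  rw [integral_add hD hD.swap, ← hswap, integral_prod _ hD] at hadd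
  exact le_of_not_gt fun hpos => (add_pos hpos hpos).not_ge hadd

theorem integral_re_inner_kernel_smul_sub_nonpos {𝕜 F : Type*} [RCLike 𝕜]
    [NormedAddCommGroup F] [InnerProductSpace 𝕜 F] [NormedSpace ℝ F] [IsScalarTower ℝ 𝕜 F]
    {m : X → X → ℝ} {h : X → F} (hm : ∀ x y, 0 ≤ m x y) (hsymm : ∀ x y, m x y = m y x)
    (hint : Integrable (Function.uncurry fun x y => RCLike.re ⟪h x, m x y • (h y - h x)⟫_𝕜)
      (μ.prod μ)) :
    ∫ x, ∫ y, RCLike.re ⟪h x, m x y • (h y - h x)⟫_𝕜 ∂μ ∂μ ≤ 0 := by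
  refine integral_integral_nonpos_of_add_swap_nonpos hint fun x y => ?_
  have hdirichlet : RCLike.re ⟪h x, m x y • (h y - h x)⟫_𝕜 +
      RCLike.re ⟪h y, m y x • (h x - h y)⟫_𝕜 = -(m x y * ‖h y - h x‖ ^ 2) := by
    rw [hsymm y x, ← neg_sub (h y), smul_neg, inner_neg_right, map_neg, ← sub_eq_add_neg,
      ← map_sub, ← inner_sub_left, ← neg_sub (h y), inner_neg_left, map_neg,
      inner_smul_right_eq_smul, RCLike.smul_re, inner_self_eq_norm_sq]
  rw [hdirichlet, neg_nonpos]
  exact mul_nonneg (hm x y) (sq_nonneg _)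

end DirichletForm

namespace ClosedCurve

variable (C : ClosedCurve)

theorem kernel_mul_dist_le (lam : ℝ) (x y : C.carrier) :
    C.kernel lam x y * dist x y ≤ (4 * Real.pi)⁻¹ := by
  rcases eq_or_ne x y with rfl | hxy
  · rw [dist_self, mul_zero]
    positivity
  have hr : 0 < dist x y := dist_pos.2 hxy
  calc C.kernel lam x y * dist x y
      = Real.exp (-√(-lam) * dist x y) * (4 * Real.pi)⁻¹ := by
        rw [kernel]
        field_simp
    _ ≤ (4 * Real.pi)⁻¹ := mul_le_of_le_one_left (by positivity) <|
        Real.exp_le_one_iff.2 <|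
          mul_nonpos_of_nonpos_of_nonneg (neg_nonpos.2 (Real.sqrt_nonneg _)) hr.le

/-- The image of the constant function `1` under `B_λ`. -/
noncomputable def potential (lam : ℝ) (x : C.carrier) : ℝ :=
  (∫ y, C.remainderKernel lam x y ∂C.arcLength) + Real.log (C.len / 2) / (2 * Real.pi)

theorem integrable_remainderKernel (lam : ℝ) (x : C.carrier) :
    Integrable (C.remainderKernel lam x) C.arcLength := by
  simpa only [smul_eq_mul, mul_one] using
    (C.isBoundedKernel_remainderKernel lam).integrable_smul (integrable_const (1 : ℝ)) x

variable {C} {h : C.carrier → ℂ}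

theorem IsLip.exists_norm_kernel_smul_sub_le (hh : C.IsLip h) (lam : ℝ) :
    ∃ K, ∀ x y, ‖C.kernel lam x y • (h y - h x)‖ ≤ K := by
  obtain ⟨K, hK⟩ := hh
  refine ⟨K * (4 * Real.pi)⁻¹, fun x y => ?_⟩
  have hle : ‖h y - h x‖ ≤ K * dist x y := by
    rw [← dist_eq_norm, dist_comm]
    exact hK.dist_le_mul x y
  calc ‖C.kernel lam x y • (h y - h x)‖ = C.kernel lam x y * ‖h y - h x‖ := by
        rw [norm_smul, Real.norm_of_nonneg (C.kernel_nonneg lam x y)]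
    _ ≤ C.kernel lam x y * (K * dist x y) := by
        gcongr
        exact C.kernel_nonneg lam x y
    _ = K * (C.kernel lam x y * dist x y) := mul_left_comm _ _ _
    _ ≤ K * (4 * Real.pi)⁻¹ := by
        gcongr
        exact C.kernel_mul_dist_le lam x y

theorem IsLip.measurable_kernel_smul_sub (hh : C.IsLip h) (lam : ℝ) :
    Measurable (Function.uncurry fun x y => C.kernel lam x y • (h y - h x)) :=
  (C.measurable_kernel lam).smul <|
    (hh.continuous.measurable.comp measurable_snd).sub
      (hh.continuous.measurable.comp measurable_fst)

theorem IsLip.integrable_kernel_smul_sub (hh : C.IsLip h) (lam : ℝ) (x : C.carrier) :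
    Integrable (fun y => C.kernel lam x y • (h y - h x)) C.arcLength := by
  obtain ⟨K, hK⟩ := hh.exists_norm_kernel_smul_sub_le lam
  exact Integrable.of_bound
    ((hh.measurable_kernel_smul_sub lam).comp measurable_prodMk_left).aestronglyMeasurable K
    (Eventually.of_forall (hK x))

theorem IsLip.integrable_re_inner_kernel_smul_sub (hh : C.IsLip h) (lam : ℝ) :
    Integrable (Function.uncurry fun x y => RCLike.re ⟪h x, C.kernel lam x y • (h y - h x)⟫_ℂ)
      (C.arcLength.prod C.arcLength) := by
  obtain ⟨K, hK⟩ := hh.exists_norm_kernel_smul_sub_le lam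
  obtain ⟨M, hM⟩ := isCompact_univ.exists_bound_of_continuousOn hh.continuous.continuousOn
  refine Integrable.of_bound (RCLike.measurable_re.comp
    ((hh.continuous.measurable.comp measurable_fst).inner
      (hh.measurable_kernel_smul_sub lam))).aestronglyMeasurable (M * K)
    (Eventually.of_forall fun p => ?_)
  have hhM := hM p.1 (mem_univ _)
  exact (RCLike.norm_re_le_norm _).trans <| (norm_inner_le_norm _ _).trans <|
    mul_le_mul hhM (hK p.1 p.2) (norm_nonneg _) ((norm_nonneg _).trans hhM)

theorem IsLip.regularization_eq (hh : C.IsLip h) (lam : ℝ) (x : C.carrier) :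
    C.arcRegularization h x + kernelFun C.arcLength (C.remainderKernel lam) h x =
      (∫ y, C.kernel lam x y • (h y - h x) ∂C.arcLength) + C.potential lam x • h x := by
  have hsplit (y : C.carrier) : C.arcIntegrand h x y + C.remainderKernel lam x y • h y =
      C.kernel lam x y • (h y - h x) + C.remainderKernel lam x y • h x := by
    rw [arcIntegrand, remainderKernel]
    module
  rw [arcRegularization, add_right_comm, kernelFun, ← integral_add (hh.integrable_arcIntegrand x)
    ((C.isBoundedKernel_remainderKernel lam).integrable_smul hh.integrable x), potential, add_smul,
    ← add_assoc]
  simp only [hsplit]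
  rw [integral_add (hh.integrable_kernel_smul_sub lam x)
    ((C.integrable_remainderKernel lam x).smul_const _), integral_smul_const]

theorem IsLip.re_inner_regularization_le (hh : C.IsLip h) {lam v : ℝ}
    (hv : ∀ x, C.potential lam x ≤ v) (x : C.carrier) :
    RCLike.re ⟪h x,
        (C.arcRegularization h + kernelFun C.arcLength (C.remainderKernel lam) h) x⟫_ℂ ≤
      (∫ y, RCLike.re ⟪h x, C.kernel lam x y • (h y - h x)⟫_ℂ ∂C.arcLength) +
        v * RCLike.re ⟪h x, h x⟫_ℂ := by
  have hint := hh.integrable_kernel_smul_sub lam x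
  rw [Pi.add_apply, hh.regularization_eq lam x, inner_add_right, map_add,
    ← integral_inner hint, ← integral_re (hint.const_inner (h x)), inner_smul_right_eq_smul,
    RCLike.smul_re]
  gcongr
  · exact inner_self_nonneg
  · exact hv x

theorem re_inner_le_of_mem_graph_B {lam v : ℝ} (hv : ∀ x, C.potential lam x ≤ v) {f g : C.L2}
    (hfg : (f, g) ∈ (C.B lam).graph) : RCLike.re ⟪f, g⟫_ℂ ≤ v * ‖f‖ ^ 2 := by
  obtain ⟨h, hh, hf, hg⟩ := mem_graph_B_iff.1 hfg
  have hreg := (integrable_inner_of_memLp_two (𝕜 := ℂ) hh.memLp (hh.memLp_regularization lam))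
  have hself := (integrable_inner_of_memLp_two (𝕜 := ℂ) hh.memLp hh.memLp)
  have hdir := hh.integrable_re_inner_kernel_smul_sub lam
  rw [← inner_self_eq_norm_sq (𝕜 := ℂ), inner_eq_integral_of_ae_eq hf hg,
    inner_eq_integral_of_ae_eq hf hf, ← integral_re hreg, ← integral_re hself]
  calc _ ≤ ∫ x, ((∫ y, RCLike.re ⟪h x, C.kernel lam x y • (h y - h x)⟫_ℂ ∂C.arcLength) +
          v * RCLike.re ⟪h x, h x⟫_ℂ) ∂C.arcLength :=
        integral_mono hreg.re (hdir.integral_prod_left.add (hself.re.const_mul v))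
          (hh.re_inner_regularization_le hv)
    _ = (∫ x, ∫ y, RCLike.re ⟪h x, C.kernel lam x y • (h y - h x)⟫_ℂ ∂C.arcLength ∂C.arcLength) +
          v * ∫ x, RCLike.re ⟪h x, h x⟫_ℂ ∂C.arcLength := by
        rw [← integral_const_mul]
        exact integral_add hdir.integral_prod_left (hself.re.const_mul v)
    _ ≤ _ := add_le_of_nonpos_left
        (integral_re_inner_kernel_smul_sub_nonpos (C.kernel_nonneg lam) (C.kernel_comm lam) hdir)

theorem re_inner_le_of_mem_graph_closure_B {lam v : ℝ} (hv : ∀ x, C.potential lam x ≤ v)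
    {f g : C.L2} (hfg : (f, g) ∈ (C.B lam).closure.graph) :
    RCLike.re ⟪f, g⟫_ℂ ≤ v * ‖f‖ ^ 2 := by
  have hclosed : IsClosed {p : C.L2 × C.L2 | RCLike.re ⟪p.1, p.2⟫_ℂ ≤ v * ‖p.1‖ ^ 2} :=
    isClosed_le (by fun_prop) (by fun_prop)
  rw [← (isClosable_of_graph_le_diagGraph
    (C.graph_B_le_diagGraph lam)).graph_closure_eq_closure_graph] at hfg
  exact closure_minimal (fun p => re_inner_le_of_mem_graph_B hv) hclosed hfg

theorem remainderKernel_le {M lam : ℝ} (hM : ∀ x y : C.carrier,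
    (dist x y)⁻¹ - (C.arcDist x y)⁻¹ ≤ M) (x y : C.carrier) :
    C.remainderKernel lam x y ≤ Real.exp (-√(-lam) * dist x y) * (M / (4 * Real.pi)) -
      (1 - Real.exp (-√(-lam) * dist x y)) * (4 * Real.pi * C.arcDist x y)⁻¹ := by
  calc C.remainderKernel lam x y
      = Real.exp (-√(-lam) * dist x y) * ((dist x y)⁻¹ - (C.arcDist x y)⁻¹) / (4 * Real.pi) -
        (1 - Real.exp (-√(-lam) * dist x y)) * (4 * Real.pi * C.arcDist x y)⁻¹ := by
        rw [remainderKernel, kernel]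
        ring
    _ ≤ _ := by
        rw [← mul_div_assoc]
        gcongr
        exact hM x y

theorem remainderKernel_le_sub_indicator {c M lam δ : ℝ} (hc : 0 < c) (hM0 : 0 ≤ M)
    (hdist : ∀ x y : C.carrier, c * C.arcDist x y ≤ dist x y)
    (hM : ∀ x y : C.carrier, (dist x y)⁻¹ - (C.arcDist x y)⁻¹ ≤ M)
    (hδ : 1 ≤ √(-lam) * (c * δ)) (x y : C.carrier) :
    C.remainderKernel lam x y ≤ M / (4 * Real.pi) - (C.interval δ x)ᶜ.indicator
      (fun y => (1 - Real.exp (-1)) * (4 * Real.pi * C.arcDist x y)⁻¹) y := by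
  have harc := C.arcDist_nonneg x y
  have hexp : Real.exp (-√(-lam) * dist x y) ≤ 1 := Real.exp_le_one_iff.2 <|
    mul_nonpos_of_nonpos_of_nonneg (neg_nonpos.2 (Real.sqrt_nonneg _)) dist_nonneg
  refine (remainderKernel_le hM x y).trans (sub_le_sub
    (mul_le_of_le_one_left (by positivity) hexp) (indicator_apply_le' (fun hy => ?_) fun _ => ?_))
  · rw [compl_interval] at hy
    have hscale : 1 ≤ √(-lam) * dist x y := hδ.trans <| by
      gcongr
      exact (mul_le_mul_of_nonneg_left hy hc.le).trans (hdist x y)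
    gcongr
    linarith
  · exact mul_nonneg (sub_nonneg.2 hexp) (by positivity)

theorem potential_le {c M lam δ : ℝ} (hc : 0 < c) (hM0 : 0 ≤ M)
    (hdist : ∀ x y : C.carrier, c * C.arcDist x y ≤ dist x y)
    (hM : ∀ x y : C.carrier, (dist x y)⁻¹ - (C.arcDist x y)⁻¹ ≤ M) (hδ0 : 0 < δ)
    (hδL : δ ≤ C.len / 2) (hδ : 1 ≤ √(-lam) * (c * δ)) (x : C.carrier) :
    C.potential lam x ≤ C.len * (M / (4 * Real.pi)) -
      (1 - Real.exp (-1)) * ((Real.log (C.len / 2) - Real.log δ) / (2 * Real.pi)) +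
        Real.log (C.len / 2) / (2 * Real.pi) := by
  have hind := (integrable_indicator_iff (measurableSet_compl_interval δ x)).2
    ((integrableOn_compl_interval_inv_arcDist x hδ0).const_mul (1 - Real.exp (-1)))
  refine add_le_add_left ((integral_mono (C.integrable_remainderKernel lam x)
    ((integrable_const _).sub hind)
    (remainderKernel_le_sub_indicator hc hM0 hdist hM hδ x)).trans_eq ?_) _
  rw [integral_sub' (integrable_const _) hind,
    integral_indicator (measurableSet_compl_interval δ x), integral_const_mul,
    integral_compl_interval_inv_arcDist x hδ0 hδL, integral_const, C.arcLength_real_univ,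
    smul_eq_mul]

variable (C)

theorem eventually_potential_le (v : ℝ) : ∀ᶠ lam in atBot, ∀ x, C.potential lam x ≤ v := by
  obtain ⟨c, hc, hdist⟩ := C.exists_mul_arcDist_le_dist
  obtain ⟨M, hM0, hM⟩ := C.exists_inv_dist_sub_inv_arcDist_le
  have hexp : 0 < 1 - Real.exp (-1) := sub_pos.2 (Real.exp_lt_one_iff.2 neg_one_lt_zero)
  have hlim : Tendsto (fun δ => C.len * (M / (4 * Real.pi)) -
      (1 - Real.exp (-1)) * ((Real.log (C.len / 2) - Real.log δ) / (2 * Real.pi)) +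
        Real.log (C.len / 2) / (2 * Real.pi)) (𝓝[>] 0) atBot := by
    have hlog : Tendsto (fun δ => Real.log (C.len / 2) - Real.log δ) (𝓝[>] 0) atTop :=
      tendsto_const_nhds.add_atTop (tendsto_neg_atBot_atTop.comp Real.tendsto_log_nhdsGT_zero)
    exact tendsto_atBot_add_const_right _ _ <| tendsto_const_nhds.add_atBot <|
      tendsto_neg_atTop_atBot.comp <|
        (hlog.atTop_div_const Real.two_pi_pos).const_mul_atTop hexp
  obtain ⟨δ, hδv, hδ0, hδL⟩ :=
    ((hlim.eventually_le_atBot v).and (Ioc_mem_nhdsGT (half_pos C.len_pos))).exists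
  have hsqrt : Tendsto (fun lam : ℝ => √(-lam) * (c * δ)) atBot atTop :=
    (Real.tendsto_sqrt_atTop.comp tendsto_neg_atBot_atTop).atTop_mul_const (mul_pos hc hδ0)
  filter_upwards [hsqrt.eventually_ge_atTop 1] with lam hlam x
  exact (potential_le hc hM0.le hdist hM hδ0 hδL hlam x).trans hδv

end ClosedCurve

/-! ### Eigenvalues -/

section Enumeration

theorem natAbs_intEquivNat_symm (k : ℕ) : (Equiv.intEquivNat.symm k).natAbs = (k + 1) / 2 := by
  obtain ⟨n, rfl⟩ := Equiv.intEquivNat.surjective k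
  rw [Equiv.symm_apply_apply]
  cases n with
  | ofNat n =>
    have heven : Equiv.intEquivNat (n : ℤ) = 2 * n :=
      congrFun Equiv.natSumNatEquivNat_apply (Sum.inl n)
    rw [Int.ofNat_eq_natCast, heven]
    omega
  | negSucc n =>
    have hodd : Equiv.intEquivNat (Int.negSucc n) = 2 * n + 1 :=
      congrFun Equiv.natSumNatEquivNat_apply (Sum.inr n)
    rw [hodd]
    omega

theorem abs_log_one_add_half_sub_log_le (k : ℕ) :
    |Real.log (1 + ((k + 1) / 2 : ℕ)) - Real.log (k + 1)| ≤ Real.log 2 := by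
  have hle : (1 + ((k + 1) / 2 : ℕ) : ℝ) ≤ k + 1 := by
    norm_cast
    omega
  have hge : (k + 1 : ℝ) ≤ 2 * (1 + ((k + 1) / 2 : ℕ)) := by
    norm_cast
    omega
  have hlog_le := Real.log_le_log (by positivity) hle
  have hlog_ge := Real.log_le_log (by positivity) hge
  rw [Real.log_mul two_ne_zero (by positivity)] at hlog_ge
  exact abs_le.2 ⟨by linarith, by linarith [Real.log_nonneg one_le_two]⟩

end Enumeration

namespace ClosedCurve

section Domain

variable {C : ClosedCurve} {h : C.carrier → ℂ}

theorem IsLip.exists_isRegularization (hh : C.IsLip h) (lam : ℝ) :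
    ∃ k : C.carrier → ℂ, C.IsRegularization lam h k ∧ MemLp k 2 C.arcLength ∧
      ∃ f : (C.B lam).domain, ((f : C.L2) : C.carrier → ℂ) =ᵐ[C.arcLength] h ∧
        (C.B lam f : C.carrier → ℂ) =ᵐ[C.arcLength] k := by
  refine ⟨_, hh.isRegularization lam, hh.memLp_regularization lam, ?_⟩
  obtain ⟨f, hf, hg⟩ := (LinearPMap.mem_graph_iff _).1 (hh.toLp_mem_graph_B lam)
  refine ⟨f, ?_, ?_⟩
  · rw [hf]
    exact hh.memLp.coeFn_toLp
  · rw [hg]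
    exact (hh.memLp_regularization lam).coeFn_toLp

theorem exists_isLip_ae_eq {lam : ℝ} (f : (C.B lam).domain) :
    ∃ h, C.IsLip h ∧ ((f : C.L2) : C.carrier → ℂ) =ᵐ[C.arcLength] h := by
  obtain ⟨h, hh, hf, -⟩ := mem_graph_B_iff.1 ((C.B lam).mem_graph f)
  exact ⟨h, hh, hf⟩

variable (C)

theorem domain_closure_B_le (lam mu : ℝ) :
    (C.B lam).closure.domain ≤ (C.B mu).closure.domain := by
  intro f hf
  have hgraph := (C.B lam).closure.mem_graph ⟨f, hf⟩
  rw [closure_graph_B] at hgraph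
  have hgraph' := add_mem_diagGraph_of_mem (C.remainderOp mu) hgraph
  rw [← closure_graph_B] at hgraph'
  exact LinearPMap.mem_domain_of_mem_graph hgraph'

theorem domain_closure_B_eq (lam mu : ℝ) :
    (C.B lam).closure.domain = (C.B mu).closure.domain :=
  (C.domain_closure_B_le lam mu).antisymm (C.domain_closure_B_le mu lam)

end Domain

section Eigenvalues

variable (C : ClosedCurve)

theorem exists_eigenbasis_closure_B (lam : ℝ) :
    ∃ (u : HilbertBasis ℕ ℂ C.L2) (ν : ℕ → ℝ), Antitone ν ∧ Tendsto ν atTop atBot ∧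
      (C.B lam).closure.graph = diagGraph u ν 0 := by
  rw [closure_graph_B]
  exact exists_eigenbasis_diagGraph C.tendsto_multiplier (C.isSymmetric_remainderOp lam)

variable {C} {u : ℝ → HilbertBasis ℕ ℂ C.L2} {ν : ℝ → ℕ → ℝ}

theorem eigenvalue_isBigO {lam : ℝ} (hν : Antitone (ν lam))
    (hG : (C.B lam).closure.graph = diagGraph (u lam) (ν lam) 0) :
    (fun k : ℕ => ν lam k - (-(Real.log ((k : ℝ) + 1) / (2 * Real.pi))))
      =O[atTop] (fun _ => (1 : ℝ)) := by
  rw [closure_graph_B] at hG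
  obtain ⟨K, hK⟩ := C.exists_abs_multiplier_add_log_le
  set m : ℕ → ℝ := fun k => -(Real.log ((k : ℝ) + 1) / (2 * Real.pi)) with hm
  have hm_anti : Antitone m := fun j k hjk => by
    have hjk' : (j : ℝ) ≤ k := Nat.cast_le.2 hjk
    simp only [hm]
    gcongr
  have hdiag (k : ℕ) : |C.multiplier (Equiv.intEquivNat.symm k) - m k| ≤
      K + Real.log 2 / (2 * Real.pi) := by
    have hmult := hK (Equiv.intEquivNat.symm k)
    rw [← Int.cast_abs, Int.abs_eq_natAbs, natAbs_intEquivNat_symm, Int.cast_natCast] at hmult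
    calc |C.multiplier (Equiv.intEquivNat.symm k) - m k|
        = |C.multiplier (Equiv.intEquivNat.symm k) +
              Real.log (1 + ((k + 1) / 2 : ℕ)) / (2 * Real.pi) -
            (Real.log (1 + ((k + 1) / 2 : ℕ)) - Real.log (k + 1)) / (2 * Real.pi)| := by
          congr 1
          simp only [hm]
          ring
      _ ≤ K + Real.log 2 / (2 * Real.pi) := by
          refine (abs_sub _ _).trans (add_le_add hmult ?_)
          rw [abs_div, abs_of_pos Real.two_pi_pos]
          gcongr
          exact abs_log_one_add_half_sub_log_le k
  refine Asymptotics.IsBigO.of_bound (K + Real.log 2 / (2 * Real.pi) + ‖C.remainderOp lam‖)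
    (Eventually.of_forall fun k => ?_)
  rw [norm_one, mul_one, Real.norm_eq_abs]
  exact abs_eigenvalue_sub_le_of_abs_diag_sub_le hν hG Equiv.intEquivNat.symm hm_anti hdiag k

theorem continuous_eigenvalue (hν : ∀ lam, Antitone (ν lam))
    (hG : ∀ lam, (C.B lam).closure.graph = diagGraph (u lam) (ν lam) 0) (k : ℕ) :
    Continuous fun lam => ν lam k := by
  refine continuous_iff_continuousAt.2 fun lam => tendsto_iff_dist_tendsto_zero.2 ?_
  have hcont : Continuous fun mu => (4 * Real.pi)⁻¹ * |√(-mu) - √(-lam)| * C.len := by fun_prop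
  have hlim := hcont.tendsto lam
  rw [sub_self, abs_zero, mul_zero, zero_mul] at hlim
  refine squeeze_zero (fun _ => dist_nonneg) (fun mu => ?_) hlim
  exact (abs_eigenvalue_sub_le (hν lam) (hν mu) ((C.closure_graph_B lam).symm.trans (hG lam))
    ((C.closure_graph_B mu).symm.trans (hG mu)) k).trans (C.norm_remainderOp_sub_le mu lam)

theorem strictMonoOn_eigenvalue (hν : ∀ lam, Antitone (ν lam))
    (hG : ∀ lam, (C.B lam).closure.graph = diagGraph (u lam) (ν lam) 0) (k : ℕ) :
    StrictMonoOn (fun lam => ν lam k) (Iic 0) :=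
  fun lam _ mu hmu hlt => eigenvalue_lt (hν lam) (hν mu)
    ((C.closure_graph_B lam).symm.trans (hG lam)) ((C.closure_graph_B mu).symm.trans (hG mu))
    (fun _ hf => C.re_inner_remainderOp_sub_pos hlt hmu hf) k

theorem tendsto_eigenvalue_atBot (hν : ∀ lam, Antitone (ν lam))
    (hG : ∀ lam, (C.B lam).closure.graph = diagGraph (u lam) (ν lam) 0) (k : ℕ) :
    Tendsto (fun lam => ν lam k) atBot atBot := by
  refine tendsto_atBot.2 fun v => ?_
  filter_upwards [C.eventually_potential_le v] with lam hlam
  refine (hν lam (Nat.zero_le k)).trans <|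
    eigenvalue_le_of_forall_re_inner_le (u := u lam) (hν lam) Fin.elim0 fun f g hfg _ => ?_
  rw [← hG lam] at hfg
  exact re_inner_le_of_mem_graph_closure_B hlam hfg

end Eigenvalues

end ClosedCurve

/-- The eigenvalue `ν_k(λ)`, `k = 1, 2, …`, is `ν (k - 1) λ` below. -/
theorem proposition4p5 (C : ClosedCurve) :
    -- (i), well-definedness of `B_λ` on `C^{0,1}(Σ)`
    (∀ lam ≤ 0, ∀ h : C.carrier → ℂ, C.IsLip h →
      ∃ k : C.carrier → ℂ, C.IsRegularization lam h k ∧ MemLp k 2 C.arcLength ∧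
        ∃ f : (C.B lam).domain,
          ((f : C.L2) : C.carrier → ℂ) =ᵐ[C.arcLength] h ∧
          (C.B lam f : C.carrier → ℂ) =ᵐ[C.arcLength] k) ∧
    (∀ lam ≤ 0, ∀ f : (C.B lam).domain, ∃ h : C.carrier → ℂ, C.IsLip h ∧
      ((f : C.L2) : C.carrier → ℂ) =ᵐ[C.arcLength] h) ∧
    -- (i), essential selfadjointness and the domain of the closure
    (∀ lam ≤ 0, IsEssentiallySelfAdjoint (C.B lam) ∧
      (C.B lam).closure.domain = (C.B 0).closure.domain) ∧
    -- (ii)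
    (∀ lam ≤ 0, IsBoundedAbove (C.B lam).closure ∧ HasCompactResolvent (C.B lam).closure) ∧
    -- (iii) and (iv)
    ∃ ν : ℕ → ℝ → ℝ,
      (∀ lam ≤ 0, IsEigenvalueSequence (C.B lam).closure (fun k => ν k lam)) ∧
      (∀ lam ≤ 0, (fun k : ℕ => ν k lam - (-(Real.log ((k : ℝ) + 1) / (2 * Real.pi))))
        =O[atTop] (fun _ => (1 : ℝ))) ∧
      ∀ k : ℕ, ContinuousOn (ν k) (Set.Iic 0) ∧ StrictMonoOn (ν k) (Set.Iic 0) ∧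
        Tendsto (ν k) atBot atBot := by
  refine ⟨fun lam _ h hh => hh.exists_isRegularization lam,
    fun lam _ f => ClosedCurve.exists_isLip_ae_eq f,
    fun lam _ => ⟨isEssentiallySelfAdjoint_of_graph_le_diagGraph (C.isSymmetric_remainderOp lam)
      (C.graph_B_le_diagGraph lam) (C.modeBasis_mem_domain_B lam), C.domain_closure_B_eq lam 0⟩,
    fun lam _ => ⟨isBoundedAbove_of_graph_eq_diagGraph C.tendsto_multiplier (C.closure_graph_B lam),
      hasCompactResolvent_of_graph_eq_diagGraph C.tendsto_multiplier (C.closure_graph_B lam)⟩, ?_⟩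
  choose u ν hν hν' hG using C.exists_eigenbasis_closure_B
  exact ⟨fun k lam => ν lam k,
    fun lam _ => isEigenvalueSequence_of_graph_eq_diagGraph (hν lam) (hν' lam) (hG lam),
    fun lam _ => ClosedCurve.eigenvalue_isBigO (hν lam) (hG lam),
    fun k => ⟨(ClosedCurve.continuous_eigenvalue hν hG k).continuousOn,
      ClosedCurve.strictMonoOn_eigenvalue hν hG k,
      ClosedCurve.tendsto_eigenvalue_atBot hν hG k⟩⟩
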